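/- Let $0<|a|<M$, $r_\pm=M\pm\sqrt{M^2-a^2}$, $\Delta=r^2-2Mr+a^2$, and let $r_*:(r_+,\infty)\to\mathbb R$ be any solution of $\frac{dr_*}{dr}=\frac{r^2+a^2}{\Delta}$, with inverse $r_*\mapsto r(r_*)$. For $\omega\in\mathbb R$, $m\in\mathbb Z$ and an integer $l\ge|m|$, let $\lambda_{\omega ml}$ be the eigenvalues, enumerated in increasing order by $l=|m|,|m|+1,\dots$, of $$-\frac1{\sin\theta}\frac{d}{d\theta}\Big(\sin\theta\frac{dS}{d\theta}\Big)+\Big(\frac{m^2}{\sin^2\theta}-a^2\omega^2\cos^2\theta\Big)S=\lambda S\quad\text{on }(0,\pi),\qquad S\text{ bounded},$$ and for complex $\omega$ with small imaginary part let $\lambda_{\omega ml}$ be the holomorphic family of eigenvalues of the same problem that extends the family of real $\omega$. Put $$V_{\omega ml}(r)=\frac{4Mram\omega-a^2m^2+\Delta(\lambda_{\omega ml}+a^2\omega^2)}{(r^2+a^2)^2}+\frac{\Delta}{(r^2+a^2)^4}\big(a^2\Delta+2Mr(r^2-a^2)\big).$$ Let $\omega_R\in\mathbb R\setminus\{0\}$,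 $m\in\mathbb Z$, $l\ge|m|$ be a superradiant triad, that is, $\omega_R\big(\omega_R-\frac{am}{2Mr_+}\big)<0$. Then there exist constants $C>r_+$ and $C^{(0)}>0$, depending only on $\omega_R,m,l,M,a$, such that the following holds. For every smooth $\mathcal G:\mathbb R^4\to\mathbb C$ with $\mathcal G(\omega_R,0,\cdot,\cdot)\equiv0$ and $\mathcal G(\omega_R,\cdot,0,\cdot)\equiv0$, every $r_0>C$, every $0<\varepsilon_1\le1$, and every $\omega_I\ge0$ that is sufficiently small in terms of $\omega_R,m,l,M,a,r_0,\varepsilon_1,\mathcal G$ (and the normalization of $r_*$), there exists a smooth function $V:(r_+,\infty)\to[0,\infty)$ supported in $\{r_0\le r\le r_0+C^{(0)}\}$ with $$V(r)+\frac{4Mram\omega_R-a^2m^2+\Delta(\lambda_{\omega_Rml}+a^2\omega_R^2)}{(r^2+a^2)^2}\le(1+\varepsilon_1)\omega_R^2\qquad\text{for all }r\ge r_0,$$ such that, with $\omega=\omega_R+i\omega_I$ and $'=\frac{d}{dr_*}$, the equation $$u''+\Big(\omega^2-V_{\omega ml}(r(r_*))+\mathcal G\big(\omega_R,\omega_I,V(r(r_*)),r_*\big)-V(r(r_*))\Big)u=0$$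 admits a smooth solution $u:\mathbb R\to\mathbb C$, not identically zero, satisfying $$\lim_{r_*\to+\infty}e^{-i\omega r_*}\big(u'-i\omega u\big)=0,\qquad \lim_{r_*\to-\infty}e^{i(\omega-\frac{am}{2Mr_+})r_*}\Big(u'+i\big(\omega-\tfrac{am}{2Mr_+}\big)u\Big)=0.$$ -/

import Mathlib

noncomputable section

namespace Kerr

/-- The radius `r₊ = M + √(M² - a²)` of the event horizon. -/
def rPlus (M a : ℝ) : ℝ := M + Real.sqrt (M ^ 2 - a ^ 2)

/-- `Δ = r² - 2 M r + a² = (r - r₊) (r - r₋)`. -/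
def Delta (M a r : ℝ) : ℝ := r ^ 2 - 2 * M * r + a ^ 2

/-- The tortoise coordinate: the general solution of `dr_*/dr = (r² + a²)/Δ` on `(r₊, ∞)`.
It is determined up to an additive constant; `c` is its value at `r = 2 r₊`. -/
def rStar (M a c r : ℝ) : ℝ :=
  c + ∫ s in (2 * rPlus M a)..r, (s ^ 2 + a ^ 2) / Delta M a s

/-- The inverse function `r_* ↦ r(r_*)` of the tortoise coordinate, from `ℝ` to `(r₊, ∞)`. -/
def radius (M a c : ℝ) : ℝ → ℝ :=
  Function.invFunOn (rStar M a c) (Set.Ioi (rPlus M a))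

/-- `μ` is an eigenvalue of the angular (oblate spheroidal) problem
`-(1/sin θ) (sin θ S')' + (m²/sin² θ - a² ω² cos² θ) S = μ S` on `(0, π)`,
with `S` bounded at `θ = 0, π` and not identically zero. -/
def IsAngularEigenvalue (a : ℝ) (ω : ℂ) (m : ℤ) (μ : ℂ) : Prop :=
  ∃ S S₁ S₂ : ℝ → ℂ,
    (∃ θ ∈ Set.Ioo 0 Real.pi, S θ ≠ 0) ∧
    (∃ B : ℝ, ∀ θ ∈ Set.Ioo 0 Real.pi, ‖S θ‖ ≤ B) ∧
    ∀ θ ∈ Set.Ioo 0 Real.pi,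
      HasDerivAt S (S₁ θ) θ ∧
      HasDerivAt (fun t : ℝ => (Real.sin t : ℂ) * S₁ t) (S₂ θ) θ ∧
      -(1 / (Real.sin θ : ℂ)) * S₂ θ
        + ((m : ℂ) ^ 2 / (Real.sin θ : ℂ) ^ 2
            - (a : ℂ) ^ 2 * ω ^ 2 * (Real.cos θ : ℂ) ^ 2) * S θ = μ * S θ

/-- For real `ω`: `μ` is the eigenvalue labelled by `l ≥ |m|` in the increasing enumeration
of the (real, simple) eigenvalues of the angular problem, that is, exactly `l - |m|`
eigenvalues are smaller. -/
def IsOrderedEigenvalue (a ω : ℝ) (m l : ℤ) (μ : ℝ) : Prop :=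
  IsAngularEigenvalue a ω m μ ∧
    {ν : ℝ | ν < μ ∧ IsAngularEigenvalue a ω m ν}.encard = ((l - |m|).toNat : ℕ∞)

/-- The eigenvalue `λ_{ωml}` for real `ω`. -/
def eigenvalueReal (a ω : ℝ) (m l : ℤ) : ℝ :=
  Classical.epsilon (IsOrderedEigenvalue a ω m l)

/-- `f` is a holomorphic family of eigenvalues of the angular problem on the disc of radius `ρ`
around the real frequency `w`, extending the eigenvalues `λ_{xml}` for real `x`. -/
def IsHolomorphicBranch (a : ℝ) (m l : ℤ) (w ρ : ℝ) (f : ℂ → ℂ) : Prop :=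
  DifferentiableOn ℂ f (Metric.ball (w : ℂ) ρ) ∧
    (∀ z ∈ Metric.ball (w : ℂ) ρ, IsAngularEigenvalue a z m (f z)) ∧
    ∀ x : ℝ, (x : ℂ) ∈ Metric.ball (w : ℂ) ρ → f x = (eigenvalueReal a x m l : ℂ)

open scoped Classical in
/-- The eigenvalue `λ_{ωml}` for complex `ω` with small imaginary part: the value at `ω` of the
holomorphic family of eigenvalues, defined on a disc around `Re ω` that contains `ω`, which
extends the family `λ_{xml}`, `x` real. (By the identity theorem the value does not depend on the
disc or on the family. If `Im ω` is so large that there is no such family on a disc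
containing `ω`, the function takes the conventional value `λ_{(Re ω)ml}`.) -/
def eigenvalue (a : ℝ) (ω : ℂ) (m l : ℤ) : ℂ :=
  if h : ∃ f : ℂ → ℂ, ∃ ρ : ℝ, |ω.im| < ρ ∧ IsHolomorphicBranch a m l ω.re ρ f then
    h.choose ω
  else (eigenvalueReal a ω.re m l : ℂ)

/-- On real frequencies the two definitions of `λ_{ωml}` agree. -/
theorem eigenvalue_ofReal (a ω : ℝ) (m l : ℤ) :
    eigenvalue a (ω : ℂ) m l = (eigenvalueReal a ω m l : ℂ) := by
  unfold eigenvalue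
  split_ifs with h
  · obtain ⟨ρ, hρ, -, -, h3⟩ := h.choose_spec
    have hρ' : 0 < ρ := by simpa using hρ
    simpa using h3 ω (by simpa using hρ')
  · simp

/-- The potential `V_{ωml}` of the separated radial equation, as a function of `r`. -/
def potential (M a : ℝ) (ω : ℂ) (m l : ℤ) (r : ℝ) : ℂ :=
  (4 * M * r * a * m * ω - (a : ℂ) ^ 2 * (m : ℂ) ^ 2
      + (Delta M a r : ℂ) * (eigenvalue a ω m l + (a : ℂ) ^ 2 * ω ^ 2))
    / ((r : ℂ) ^ 2 + (a : ℂ) ^ 2) ^ 2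
  + (Delta M a r : ℂ) / ((r : ℂ) ^ 2 + (a : ℂ) ^ 2) ^ 4
    * ((a : ℂ) ^ 2 * (Delta M a r : ℂ) + 2 * M * r * ((r : ℂ) ^ 2 - (a : ℂ) ^ 2))

/-- The frequency triad `(ω, m, l)` is superradiant: `ω (ω - a m / (2 M r₊)) < 0`
(with `l ≥ |m|`). -/
def IsSuperradiant (M a ω : ℝ) (m l : ℤ) : Prop :=
  |m| ≤ l ∧ ω * (ω - a * m / (2 * M * rPlus M a)) < 0

/-- The outgoing condition `e^{-iω r_*} (u' - iω u) → 0` as `r_* → +∞`. -/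
def IsOutgoing (ω : ℂ) (u : ℝ → ℂ) : Prop :=
  Filter.Tendsto
    (fun x : ℝ => Complex.exp (-Complex.I * ω * x) * (deriv u x - Complex.I * ω * u x))
    Filter.atTop (nhds 0)

/-- The horizon condition `e^{ik r_*} (u' + ik u) → 0` as `r_* → -∞`,
with `k = ω - a m / (2 M r₊)`. -/
def IsRegularAtHorizon (M a : ℝ) (ω : ℂ) (m : ℤ) (u : ℝ → ℂ) : Prop :=
  Filter.Tendsto
    (fun x : ℝ => Complex.exp (Complex.I * (ω - a * m / (2 * M * rPlus M a)) * x)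
      * (deriv u x + Complex.I * (ω - a * m / (2 * M * rPlus M a)) * u x))
    Filter.atBot (nhds 0)

end Kerr

end

/-!
In the tortoise coordinate the radial equation is `u'' = (V_ω - ω² + …) u`, with coefficient tending
to `-ω²` at `+∞` and, with `k = ω - a m / (2 M r₊)`, to `-k²` at the horizon `-∞`; the errors are
`O(x⁻²)`. For `Im ω ≥ 0` there is, up to a factor, one solution with each radiation condition, the
Jost solution, constructed from a Volterra equation (`JostData.solvesODE_jost`) and continuous in
the parameters of the equation (`JostData.continuous_jost`). A mode is a zero of the Wronskian of the
two (`RadialFamily.exists_mode`).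

*Real frequency.* At a real frequency `ω` the flux `Im (ū u')` of a solution is constant. It is `ω`
for the outgoing solution and `-k` for the horizon solution, so superradiance says that both have
the same sign. Then they can be joined by a barrier (`exists_barrier`). In the Liouville form of the
equation, in which the modulus of the outgoing solution `v` is the amplitude and its phase the new
variable (`exists_liouville`), `v` becomes the free wave `e^{is}` and the horizon solution becomes
`A e^{is} + B e^{-is}` with `|A| > |B|`. A barrier with reflection coefficient `|B| / |A|`, at the
right distance, turns the latter into a multiple of the former. Barriers with weak reflection exist
by continuity in the coupling constant, and they can be put in series so that the rapidities
`artanh (|B| / |A|)` add (`IsScatterer.add`); hence arbitrarily low barriers achieve any reflection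
(`isScatterer`). Far out, `|v|` is close to `1` and the phase of `v` grows at a fixed rate, so that the
length of the barrier does not depend on its position.

*Complex frequency.* Let `U` be the mode found for the real frequency and `V₀` its barrier. The
barriers `V₀ (1 + Re (p̄ U²))`, `p` complex, change the Wronskian to first order by a multiple of the
integral of `V₀ Re (p̄ U²) U²`. This is an injective real linear function of `p`, because `Re (p̄ U²)`
cannot vanish on an interval when the flux of `U` is not zero (`injective_reImMap`). A
uniform version of the inverse function theorem, which needs only that the Jost solutions are
continuous in the frequency and that the perturbation `G` has a small Lipschitz constant, gives a
mode for all small `Im ω ≥ 0` (`eventually_exists_modeFunction_eq_zero`). The angular eigenvalue is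
continuous along the vertical segment above a real frequency (`exists_continuous_eigenvalue`), which
is all that the radial problem uses about it.
-/

/-! ### Linear second order equations on the line -/

namespace Kerr

open Filter Topology Set

/-- `y` solves `y'' = q y` on the whole line, with derivative `y₁`. -/
def SolvesODE (q y y₁ : ℝ → ℂ) : Prop :=
  ∀ x, HasDerivAt y (y₁ x) x ∧ HasDerivAt y₁ (q x * y x) x

/-- The Wronskian `y z' - y' z`. -/
def wronskian (y y₁ z z₁ : ℝ → ℂ) (x : ℝ) : ℂ := y x * z₁ x - y₁ x * z x

namespace SolvesODE

variable {q p y y₁ z z₁ : ℝ → ℂ}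

theorem continuous (h : SolvesODE q y y₁) : Continuous y :=
  continuous_iff_continuousAt.2 fun x => (h x).1.continuousAt

theorem continuous_deriv (h : SolvesODE q y y₁) : Continuous y₁ :=
  continuous_iff_continuousAt.2 fun x => (h x).2.continuousAt

theorem deriv_eq (h : SolvesODE q y y₁) : deriv y = y₁ := funext fun x => (h x).1.deriv

theorem congr_coeff (h : SolvesODE q y y₁) (hqp : ∀ x, q x = p x) : SolvesODE p y y₁ := by
  have : q = p := funext hqp
  exact this ▸ h

theorem const_mul (h : SolvesODE q y y₁) (c : ℂ) :
    SolvesODE q (fun x => c * y x) (fun x => c * y₁ x) := fun x =>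
  ⟨(h x).1.const_mul c, by simpa [mul_left_comm] using (h x).2.const_mul c⟩

theorem add (h : SolvesODE q y y₁) (h' : SolvesODE q z z₁) :
    SolvesODE q (fun x => y x + z x) (fun x => y₁ x + z₁ x) := fun x =>
  ⟨(h x).1.fun_add (h' x).1, by simpa [mul_add] using (h x).2.fun_add (h' x).2⟩

theorem sub (h : SolvesODE q y y₁) (h' : SolvesODE q z z₁) :
    SolvesODE q (fun x => y x - z x) (fun x => y₁ x - z₁ x) := fun x =>
  ⟨(h x).1.fun_sub (h' x).1, by simpa [mul_sub] using (h x).2.fun_sub (h' x).2⟩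

/-- Complex conjugation preserves solutions of an equation with real coefficient. -/
theorem conj {q : ℝ → ℝ} (h : SolvesODE (fun x => (q x : ℂ)) y y₁) :
    SolvesODE (fun x => (q x : ℂ)) (fun x => starRingEnd ℂ (y x))
      (fun x => starRingEnd ℂ (y₁ x)) := by
  intro x
  refine ⟨(h x).1.star, ?_⟩
  have := (h x).2.star
  simpa using this

theorem comp_neg (h : SolvesODE q y y₁) :
    SolvesODE (fun x => q (-x)) (fun x => y (-x)) (fun x => -y₁ (-x)) := by
  intro x
  have h1 := (h (-x)).1.scomp x (hasDerivAt_neg x)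
  have h2 := ((h (-x)).2.scomp x (hasDerivAt_neg x)).fun_neg
  exact ⟨by simpa [Function.comp_def] using h1, by simpa [Function.comp_def] using h2⟩

theorem comp_sub_const (h : SolvesODE q y y₁) (c : ℝ) :
    SolvesODE (fun x => q (x - c)) (fun x => y (x - c)) (fun x => y₁ (x - c)) := fun x =>
  ⟨(h (x - c)).1.comp_sub_const x c, (h (x - c)).2.comp_sub_const x c⟩

theorem contDiff (h : SolvesODE q y y₁) (hq : ContDiff ℝ ((⊤ : ℕ∞) : WithTop ℕ∞) q) :
    ContDiff ℝ ((⊤ : ℕ∞) : WithTop ℕ∞) y ∧ ContDiff ℝ ((⊤ : ℕ∞) : WithTop ℕ∞) y₁ := by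
  have key : ∀ n : ℕ, ContDiff ℝ n y ∧ ContDiff ℝ n y₁ := by
    intro n
    induction n with
    | zero => exact ⟨by simpa using h.continuous, by simpa using h.continuous_deriv⟩
    | succ n ih =>
      have hq' : ContDiff ℝ n q := hq.of_le (by exact_mod_cast le_top)
      have e2 : deriv y₁ = fun x => q x * y x := funext fun x => (h x).2.deriv
      push_cast
      refine ⟨contDiff_succ_iff_deriv.2 ⟨fun x => (h x).1.differentiableAt, by simp, ?_⟩,
        contDiff_succ_iff_deriv.2 ⟨fun x => (h x).2.differentiableAt, by simp, ?_⟩⟩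
      · rw [h.deriv_eq]; exact ih.2
      · rw [e2]; exact hq'.mul ih.1
  exact ⟨contDiff_infty.2 fun n => (key n).1, contDiff_infty.2 fun n => (key n).2⟩

theorem hasDerivAt_wronskian (h : SolvesODE q y y₁) (h' : SolvesODE p z z₁) (x : ℝ) :
    HasDerivAt (wronskian y y₁ z z₁) ((p x - q x) * (y x * z x)) x := by
  exact (((h x).1.fun_mul (h' x).2).fun_sub ((h x).2.fun_mul (h' x).1)).congr_deriv (by ring)

theorem wronskian_eq (h : SolvesODE q y y₁) (h' : SolvesODE q z z₁) (x x' : ℝ) :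
    wronskian y y₁ z z₁ x = wronskian y y₁ z z₁ x' := by
  have hd := h.hasDerivAt_wronskian h'
  exact is_const_of_deriv_eq_zero (fun x => (hd x).differentiableAt)
    (fun x => by rw [(hd x).deriv]; ring) x x'

/-- Uniqueness for the initial value problem. -/
theorem eq_zero (h : SolvesODE q y y₁) (hq : Continuous q) {x₀ : ℝ} (h0 : y x₀ = 0)
    (h1 : y₁ x₀ = 0) (x : ℝ) : y x = 0 := by
  set A := min x x₀ - 1
  set B := max x x₀ + 1
  obtain ⟨K, hK⟩ := (isCompact_Icc (a := A) (b := B)).exists_bound_of_continuousOn hq.continuousOn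
  have hx : x ∈ Ioo A B := by
    constructor
    · have := min_le_left x x₀; simp only [A]; linarith
    · have := le_max_left x x₀; simp only [B]; linarith
  have hx0 : x₀ ∈ Ioo A B := by
    constructor
    · have := min_le_right x x₀; simp only [A]; linarith
    · have := le_max_right x x₀; simp only [B]; linarith
  have hv : ∀ t ∈ Ioo A B, LipschitzOnWith (max 1 K).toNNReal
      (fun Y : ℂ × ℂ => (Y.2, q t * Y.1)) univ := by
    intro t ht
    refine LipschitzOnWith.of_dist_le_mul fun Y _ Z _ => ?_
    rw [Real.coe_toNNReal _ (zero_le_one.trans (le_max_left _ _)), Prod.dist_eq]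
    refine max_le ?_ ?_
    · calc dist Y.2 Z.2 ≤ dist Y Z := le_max_right _ _
        _ ≤ max 1 K * dist Y Z := le_mul_of_one_le_left dist_nonneg (le_max_left _ _)
    · rw [dist_eq_norm]
      simp only [← mul_sub, norm_mul]
      refine mul_le_mul ((hK t ⟨ht.1.le, ht.2.le⟩).trans (le_max_right _ _)) ?_ (norm_nonneg _)
        (zero_le_one.trans (le_max_left _ _))
      rw [← dist_eq_norm]; exact le_max_left _ _
  have := ODE_solution_unique_of_mem_Ioo (s := fun _ => univ) (f := fun t => (y t, y₁ t))
    (g := fun _ => (0, 0)) hv hx0 (fun t _ => ⟨(h t).1.prodMk (h t).2, mem_univ _⟩)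
    (fun t _ => ⟨(hasDerivAt_const t ((0 : ℂ), (0 : ℂ))).congr_deriv (by ext <;> simp), mem_univ _⟩)
    (by simp [h0, h1]) hx
  exact congrArg Prod.fst this

/-- Solutions with vanishing Wronskian are proportional. -/
theorem eq_const_mul (h : SolvesODE q y y₁) (h' : SolvesODE q z z₁) (hq : Continuous q)
    {x₀ : ℝ} (hz : z x₀ ≠ 0) (hW : wronskian y y₁ z z₁ x₀ = 0) :
    ∃ c : ℂ, (∀ x, y x = c * z x) ∧ ∀ x, y₁ x = c * z₁ x := by
  have hD := h.sub (h'.const_mul (y x₀ / z x₀))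
  have h0 : y x₀ - y x₀ / z x₀ * z x₀ = 0 := by field_simp; ring
  have h1 : y₁ x₀ - y x₀ / z x₀ * z₁ x₀ = 0 := by
    unfold wronskian at hW
    field_simp
    linear_combination -hW
  have e : ∀ x, y x = y x₀ / z x₀ * z x := fun x => sub_eq_zero.1 (hD.eq_zero hq h0 h1 x)
  refine ⟨y x₀ / z x₀, e, fun x => ?_⟩
  have e' : y = fun x => y x₀ / z x₀ * z x := funext e
  have := (h x).1
  rw [e'] at this
  simpa using this.unique ((h' x).1.const_mul (y x₀ / z x₀))

end SolvesODE

/-- Two functions glued at a point near which they agree. -/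
theorem hasDerivAt_ite_lt {f g f₁ g₁ : ℝ → ℂ} {A B x₀ x : ℝ} (hA : A < x₀) (hB : x₀ < B)
    (hf : HasDerivAt f (f₁ x) x) (hg : HasDerivAt g (g₁ x) x)
    (hfg : ∀ t, A < t → t < B → f t = g t) :
    HasDerivAt (fun t => if t < x₀ then f t else g t) (if x < x₀ then f₁ x else g₁ x) x := by
  rcases lt_or_ge x x₀ with h | h
  · rw [if_pos h]
    refine hf.congr_of_eventuallyEq ?_
    filter_upwards [Iio_mem_nhds h] with t ht
    exact if_pos ht
  · rw [if_neg (not_lt.2 h)]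
    refine hg.congr_of_eventuallyEq ?_
    filter_upwards [Ioi_mem_nhds (hA.trans_le h)] with t ht
    split_ifs with h'
    · exact hfg t ht (h'.trans hB)
    · rfl

/-- Two solutions that agree on an overlap glue to a solution. -/
theorem SolvesODE.glue {q p f f₁ g g₁ : ℝ → ℂ} {A B x₀ : ℝ} (hA : A < x₀) (hB : x₀ < B)
    (hf : SolvesODE q f f₁) (hg : SolvesODE p g g₁) (hfg : ∀ t, A < t → t < B → f t = g t) :
    SolvesODE (fun t => if t < x₀ then q t else p t) (fun t => if t < x₀ then f t else g t)
      (fun t => if t < x₀ then f₁ t else g₁ t) := by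
  have hfg₁ : ∀ t, A < t → t < B → f₁ t = g₁ t := by
    intro t h h'
    refine (hf t).1.unique ((hg t).1.congr_of_eventuallyEq ?_)
    filter_upwards [Ioo_mem_nhds h h'] with s hs
    exact hfg s hs.1 hs.2
  intro x
  refine ⟨hasDerivAt_ite_lt hA hB (hf x).1 (hg x).1 hfg, ?_⟩
  have := hasDerivAt_ite_lt (f₁ := fun t => q t * f t) (g₁ := fun t => p t * g t) hA hB
    (hf x).2 (hg x).2 hfg₁
  refine this.congr_deriv ?_
  by_cases h : x < x₀ <;> simp [h]

/-- For a real frequency, solutions satisfying the same radiation condition at `+∞` have vanishing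
Wronskian. -/
theorem SolvesODE.wronskian_eq_zero_of_outgoing {q y y₁ z z₁ : ℝ → ℂ} {κ : ℂ} {N : ℝ}
    (hy : SolvesODE q y y₁) (hz : SolvesODE q z z₁)
    (by' : ∀ᶠ x in atTop, ‖y x‖ ≤ N) (bz : ∀ᶠ x in atTop, ‖z x‖ ≤ N)
    (ty : Tendsto (fun x => y₁ x - κ * y x) atTop (𝓝 0))
    (tz : Tendsto (fun x => z₁ x - κ * z x) atTop (𝓝 0)) (x : ℝ) :
    wronskian y y₁ z z₁ x = 0 := by
  have e : ∀ x, wronskian y y₁ z z₁ x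
      = y x * (z₁ x - κ * z x) - (y₁ x - κ * y x) * z x := fun x => by
    unfold wronskian; ring
  have h1 : Tendsto (fun x => y x * (z₁ x - κ * z x)) atTop (𝓝 0) :=
    isBoundedUnder_le_mul_tendsto_zero (isBoundedUnder_of_eventually_le by') tz
  have h2 : Tendsto (fun x => (y₁ x - κ * y x) * z x) atTop (𝓝 0) :=
    ty.zero_mul_isBoundedUnder_le (isBoundedUnder_of_eventually_le bz)
  have h3 : Tendsto (fun t => wronskian y y₁ z z₁ t) atTop (𝓝 0) := by
    simpa [e] using h1.sub h2
  have h4 : Tendsto (fun _ : ℝ => wronskian y y₁ z z₁ x) atTop (𝓝 0) :=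
    h3.congr fun t => hy.wronskian_eq hz t x
  exact tendsto_nhds_unique tendsto_const_nhds h4

end Kerr

/-! ### Jost solutions depending continuously on parameters -/

noncomputable section

namespace Kerr

open Filter Topology Set MeasureTheory
open scoped BoundedContinuousFunction

/-- The Green function `(e^{2iκs} - 1) / (2iκ)`, truncated to `s ≥ 0`, of `h'' + 2iκ h' = 0`. -/
def jostKernel (κ : ℂ) (s : ℝ) : ℂ :=
  (Complex.exp (2 * Complex.I * κ * (max s 0 : ℝ)) - 1) / (2 * Complex.I * κ)

theorem norm_exp_I_mul_le_one {κ : ℂ} (hκ : 0 ≤ κ.im) {s : ℝ} (hs : 0 ≤ s) :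
    ‖Complex.exp (2 * Complex.I * κ * (s : ℝ))‖ ≤ 1 := by
  rw [Complex.norm_exp]
  refine Real.exp_le_one_iff.2 ?_
  have : (2 * Complex.I * κ * (s : ℝ)).re = -(2 * κ.im * s) := by simp
  rw [this]
  have := mul_nonneg hκ hs
  linarith

theorem jostKernel_of_nonpos (κ : ℂ) {s : ℝ} (hs : s ≤ 0) : jostKernel κ s = 0 := by
  simp [jostKernel, max_eq_right hs]

theorem norm_jostKernel_le {κ : ℂ} (hκ : 0 ≤ κ.im) {k : ℝ} (hk : 0 < k) (hkκ : k ≤ ‖κ‖) (s : ℝ) :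
    ‖jostKernel κ s‖ ≤ 1 / k := by
  unfold jostKernel
  rw [norm_div]
  have h1 : ‖Complex.exp (2 * Complex.I * κ * (max s 0 : ℝ)) - 1‖ ≤ 2 := by
    refine (norm_sub_le _ _).trans ?_
    have := norm_exp_I_mul_le_one hκ (le_max_right s 0)
    simp only [norm_one]
    linarith
  have h2 : ‖2 * Complex.I * κ‖ = 2 * ‖κ‖ := by simp
  rw [h2, div_le_div_iff₀ (by linarith) hk]
  nlinarith

/-- The data of a family of Schrödinger equations `v'' = (q p - κ(p)²) v` with short-range
coefficients: `k` is a lower bound for all the `‖κ p‖`, `Q = -m'` is an integrable majorant of all the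
`q p`, and `m` is its tail integral. -/
structure JostData (P : Type*) [TopologicalSpace P] where
  κ : P → ℂ
  q : P → ℝ → ℂ
  k : ℝ
  Q : ℝ → ℝ
  m : ℝ → ℝ
  continuous_κ : Continuous κ
  im_nonneg : ∀ p, 0 ≤ (κ p).im
  k_pos : 0 < k
  k_le : ∀ p, k ≤ ‖κ p‖
  continuous_q : Continuous (Function.uncurry q)
  norm_q_le : ∀ p x, ‖q p x‖ ≤ Q x
  hasDerivAt_m : ∀ x, HasDerivAt m (-Q x) x
  tendsto_m : Tendsto m atTop (𝓝 0)

namespace JostData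

variable {P : Type*} [TopologicalSpace P] (D : JostData P)

theorem Q_nonneg [Nonempty P] (x : ℝ) : 0 ≤ D.Q x :=
  (norm_nonneg _).trans (D.norm_q_le (Classical.arbitrary P) x)

theorem continuous_m : Continuous D.m :=
  continuous_iff_continuousAt.2 fun x => (D.hasDerivAt_m x).continuousAt

/-- The exponential weight with which the Volterra operator of the Jost solution contracts. -/
def weight (x : ℝ) : ℝ := Real.exp (2 / D.k * D.m x)

theorem weight_pos (x : ℝ) : 0 < D.weight x := Real.exp_pos _

theorem continuous_weight : Continuous D.weight :=
  Real.continuous_exp.comp (continuous_const.mul D.continuous_m)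

theorem tendsto_weight : Tendsto D.weight atTop (𝓝 1) := by
  have h := Real.continuous_exp.continuousAt.tendsto.comp (D.tendsto_m.const_mul (2 / D.k))
  rw [mul_zero, Real.exp_zero] at h
  exact h

theorem tendsto_weight_sub_one : Tendsto (fun x => D.weight x - 1) atTop (𝓝 0) := by
  simpa using D.tendsto_weight.sub_const 1

theorem hasDerivAt_weight (x : ℝ) :
    HasDerivAt (fun x => -(D.k / 2) * D.weight x) (D.Q x * D.weight x) x := by
  have h := (((D.hasDerivAt_m x).const_mul (2 / D.k)).exp).const_mul (-(D.k / 2))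
  refine h.congr_deriv ?_
  have := D.k_pos.ne'
  unfold weight
  field_simp

theorem integrableOn_Q_mul_weight [Nonempty P] (x : ℝ) :
    IntegrableOn (fun t => D.Q t * D.weight t) (Ioi x) :=
  integrableOn_Ioi_deriv_of_nonneg' (fun x _ => D.hasDerivAt_weight x)
    (fun x _ => mul_nonneg (D.Q_nonneg x) (D.weight_pos x).le) (D.tendsto_weight.const_mul _)

theorem integral_Q_mul_weight [Nonempty P] (x : ℝ) :
    ∫ t in Ioi x, D.Q t * D.weight t = D.k / 2 * (D.weight x - 1) := by
  rw [integral_Ioi_of_hasDerivAt_of_nonneg' (fun x _ => D.hasDerivAt_weight x)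
    (fun x _ => mul_nonneg (D.Q_nonneg x) (D.weight_pos x).le) (D.tendsto_weight.const_mul _)]
  ring

theorem one_le_weight [Nonempty P] (x : ℝ) : 1 ≤ D.weight x := by
  have h : 0 ≤ ∫ t in Ioi x, D.Q t * D.weight t :=
    integral_nonneg fun t => mul_nonneg (D.Q_nonneg t) (D.weight_pos t).le
  rw [D.integral_Q_mul_weight] at h
  have := D.k_pos
  by_contra hlt
  nlinarith

/-- A function on the half-line bounded by `N · weight` is integrable against the potentials. -/
theorem norm_integral_le [Nonempty P] {x N c : ℝ} {f : ℝ → ℂ}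
    (hf : ∀ t, x < t → ‖f t‖ ≤ c * (D.Q t * (D.weight t * N))) :
    ‖∫ t in Ioi x, f t‖ ≤ c * N * (D.k / 2 * (D.weight x - 1)) := by
  have hi : IntegrableOn (fun t => c * N * (D.Q t * D.weight t)) (Ioi x) :=
    (D.integrableOn_Q_mul_weight x).const_mul _
  calc ‖∫ t in Ioi x, f t‖ ≤ ∫ t in Ioi x, c * N * (D.Q t * D.weight t) := by
        refine norm_integral_le_of_norm_le hi ?_
        refine (ae_restrict_iff' measurableSet_Ioi).2 (Eventually.of_forall fun t ht => ?_)
        exact (hf t ht).trans (le_of_eq (by ring))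
    _ = c * N * (D.k / 2 * (D.weight x - 1)) := by
        rw [integral_const_mul, D.integral_Q_mul_weight]

/-- The Volterra integrand `K(κ, t - x) q(t) f(t)`. -/
def integrand (f : P × ℝ → ℂ) (y : P × ℝ) (t : ℝ) : ℂ :=
  jostKernel (D.κ y.1) (t - y.2) * (D.q y.1 t * f (y.1, t))

theorem κ_ne_zero (p : P) : D.κ p ≠ 0 := by
  have := D.k_pos.trans_le (D.k_le p)
  exact norm_pos_iff.1 this

theorem continuous_integrand {f : P × ℝ → ℂ} (hf : Continuous f) (t : ℝ) :
    Continuous fun y => D.integrand f y t := by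
  unfold integrand jostKernel
  have h1 : Continuous fun y : P × ℝ => D.κ y.1 := D.continuous_κ.comp continuous_fst
  have h2 : Continuous fun y : P × ℝ => D.q y.1 t :=
    D.continuous_q.comp (continuous_fst.prodMk continuous_const)
  have h3 : Continuous fun y : P × ℝ => f (y.1, t) :=
    hf.comp (continuous_fst.prodMk continuous_const)
  refine Continuous.mul (Continuous.div (by fun_prop) (by fun_prop) ?_) (h2.mul h3)
  intro y
  simp [D.κ_ne_zero]

theorem continuous_integrand_right {f : P × ℝ → ℂ} (hf : Continuous f) (y : P × ℝ) :
    Continuous (D.integrand f y) := by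
  unfold integrand jostKernel
  have h2 : Continuous fun t : ℝ => D.q y.1 t :=
    D.continuous_q.comp (continuous_const.prodMk continuous_id)
  have h3 : Continuous fun t : ℝ => f (y.1, t) :=
    hf.comp (continuous_const.prodMk continuous_id)
  exact Continuous.mul (by fun_prop) (h2.mul h3)

theorem integrand_of_le (f : P × ℝ → ℂ) (y : P × ℝ) {t : ℝ} (ht : t ≤ y.2) :
    D.integrand f y t = 0 := by
  simp [integrand, jostKernel_of_nonpos _ (sub_nonpos.2 ht)]

theorem norm_integrand_le {f : P × ℝ → ℂ} {N : ℝ} {p : P} {x t : ℝ}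
    (hf : ‖f (p, t)‖ ≤ D.weight t * N) :
    ‖D.integrand f (p, x) t‖ ≤ 1 / D.k * (D.Q t * (D.weight t * N)) := by
  unfold integrand
  rw [norm_mul, norm_mul]
  have hk := D.k_pos
  have h0 : 0 ≤ D.weight t * N := (norm_nonneg _).trans hf
  have hQ : 0 ≤ D.Q t := (norm_nonneg _).trans (D.norm_q_le p t)
  exact mul_le_mul (norm_jostKernel_le (D.im_nonneg _) hk (D.k_le _) _)
    (mul_le_mul (D.norm_q_le _ _) hf (norm_nonneg _) hQ) (by positivity) (by positivity)

theorem norm_integral_integrand_le [Nonempty P] {f : P × ℝ → ℂ} {N : ℝ} {p : P} {x : ℝ}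
    (hf : ∀ t, x < t → ‖f (p, t)‖ ≤ D.weight t * N) :
    ‖∫ t in Ioi x, D.integrand f (p, x) t‖ ≤ N / 2 * (D.weight x - 1) := by
  have hk := D.k_pos
  refine (D.norm_integral_le fun t ht => D.norm_integrand_le (hf t ht)).trans
    (le_of_eq ?_)
  field_simp

theorem integrableOn_of_norm_le [Nonempty P] {f : ℝ → ℂ} (hf : Continuous f) {x c N : ℝ}
    (hb : ∀ t, x < t → ‖f t‖ ≤ c * (D.Q t * (D.weight t * N))) : IntegrableOn f (Ioi x) := by
  have hi : IntegrableOn (fun t => c * N * (D.Q t * D.weight t)) (Ioi x) :=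
    (D.integrableOn_Q_mul_weight x).const_mul _
  refine Integrable.mono' hi hf.aestronglyMeasurable ?_
  refine (ae_restrict_iff' measurableSet_Ioi).2 (Eventually.of_forall fun t ht => ?_)
  exact (hb t ht).trans (le_of_eq (by ring))

theorem integrableOn_integrand [Nonempty P] {f : P × ℝ → ℂ} (hf : Continuous f) {N : ℝ}
    (hN : ∀ p t, ‖f (p, t)‖ ≤ D.weight t * N) (y : P × ℝ) :
    IntegrableOn (D.integrand f y) (Ioi y.2) :=
  D.integrableOn_of_norm_le (D.continuous_integrand_right hf y) (c := 1 / D.k) (N := N)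
    fun t _ => D.norm_integrand_le (hN _ t)

theorem norm_weight_mul_le (z : P × ℝ →ᵇ ℂ) (p : P) (t : ℝ) :
    ‖(D.weight t : ℂ) * z (p, t)‖ ≤ D.weight t * ‖z‖ := by
  rw [norm_mul, Complex.norm_real, Real.norm_of_nonneg (D.weight_pos _).le]
  exact mul_le_mul_of_nonneg_left (z.norm_coe_le_norm _) (D.weight_pos _).le

theorem continuous_weight_mul (z : P × ℝ →ᵇ ℂ) :
    Continuous fun w : P × ℝ => (D.weight w.2 : ℂ) * z w :=
  (Complex.continuous_ofReal.comp (D.continuous_weight.comp continuous_snd)).mul z.continuous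

variable [FirstCountableTopology P]

theorem continuous_integral_integrand [Nonempty P] {f : P × ℝ → ℂ} (hf : Continuous f) {N : ℝ}
    (hN : ∀ p t, ‖f (p, t)‖ ≤ D.weight t * N) :
    Continuous fun y : P × ℝ => ∫ t in Ioi y.2, D.integrand f y t := by
  rw [continuous_iff_continuousAt]
  rintro ⟨p₀, x₀⟩
  have hev : ∀ᶠ y : P × ℝ in 𝓝 (p₀, x₀), x₀ - 1 < y.2 :=
    continuous_snd.continuousAt.eventually (Ioi_mem_nhds (by simp))
  have hc : ContinuousAt (fun y : P × ℝ => ∫ t in Ioi (x₀ - 1), D.integrand f y t) (p₀, x₀) := by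
    refine continuousAt_of_dominated
      (bound := fun t => 1 / D.k * N * (D.Q t * D.weight t)) ?_ ?_ ?_ ?_
    · exact Eventually.of_forall fun y => (D.continuous_integrand_right hf y).aestronglyMeasurable
    · refine Eventually.of_forall fun y => Eventually.of_forall fun t => ?_
      exact (D.norm_integrand_le (hN y.1 t)).trans (le_of_eq (by ring))
    · exact (D.integrableOn_Q_mul_weight _).const_mul _
    · exact Eventually.of_forall fun t => (D.continuous_integrand hf t).continuousAt
  refine hc.congr ?_
  filter_upwards [hev] with y hy
  -- the integrand vanishes to the left of `y.2`
  refine setIntegral_eq_of_subset_of_forall_sdiff_eq_zero measurableSet_Ioi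
    (Ioi_subset_Ioi hy.le) fun t ht => D.integrand_of_le f y ?_
  simpa using ht.2

/-- The weighted Volterra operator whose fixed point is the Jost solution. -/
def volterra [Nonempty P] (z : P × ℝ →ᵇ ℂ) : P × ℝ →ᵇ ℂ :=
  BoundedContinuousFunction.ofNormedAddCommGroup
    (fun y => ((D.weight y.2)⁻¹ : ℝ) *
      (1 + ∫ t in Ioi y.2, D.integrand (fun w => (D.weight w.2 : ℂ) * z w) y t))
    (by
      have hw := D.continuous_weight
      have h1 : Continuous fun y : P × ℝ => (D.weight y.2)⁻¹ :=
        (hw.comp continuous_snd).inv₀ fun y => (D.weight_pos _).ne'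
      refine (Complex.continuous_ofReal.comp h1).mul (continuous_const.add ?_)
      refine D.continuous_integral_integrand (N := ‖z‖) ?_ ?_
      · exact (Complex.continuous_ofReal.comp (hw.comp continuous_snd)).mul z.continuous
      · intro p t
        rw [norm_mul, Complex.norm_real, Real.norm_of_nonneg (D.weight_pos _).le]
        exact mul_le_mul_of_nonneg_left (z.norm_coe_le_norm _) (D.weight_pos _).le)
    (1 + ‖z‖ / 2)
    (by
      rintro ⟨p, x⟩
      have h1 := D.one_le_weight x
      have h2 := D.norm_integral_integrand_le (p := p) (x := x) (N := ‖z‖)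
        (f := fun w => (D.weight w.2 : ℂ) * z w) (fun t _ => by
          rw [norm_mul, Complex.norm_real, Real.norm_of_nonneg (D.weight_pos _).le]
          exact mul_le_mul_of_nonneg_left (z.norm_coe_le_norm _) (D.weight_pos _).le)
      rw [norm_mul, Complex.norm_real, Real.norm_of_nonneg (inv_nonneg.2 (D.weight_pos _).le),
        inv_mul_le_iff₀ (D.weight_pos _)]
      refine (norm_add_le _ _).trans ?_
      have hz := norm_nonneg z
      rw [norm_one]
      nlinarith)

theorem volterra_apply [Nonempty P] (z : P × ℝ →ᵇ ℂ) (y : P × ℝ) :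
    D.volterra z y = ((D.weight y.2)⁻¹ : ℝ) *
      (1 + ∫ t in Ioi y.2, D.integrand (fun w => (D.weight w.2 : ℂ) * z w) y t) := rfl

theorem contracting_volterra [Nonempty P] : ContractingWith (1 / 2) D.volterra := by
  refine ⟨by rw [← NNReal.coe_lt_coe]; norm_num, LipschitzWith.of_dist_le_mul fun z z' => ?_⟩
  rw [BoundedContinuousFunction.dist_le (by positivity)]
  rintro ⟨p, x⟩
  rw [D.volterra_apply, D.volterra_apply, dist_eq_norm, ← mul_sub, add_sub_add_left_eq_sub,
    ← integral_sub (D.integrableOn_integrand (D.continuous_weight_mul z) (D.norm_weight_mul_le z) _)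
      (D.integrableOn_integrand (D.continuous_weight_mul z') (D.norm_weight_mul_le z') _)]
  have e : ∀ t, D.integrand (fun w => (D.weight w.2 : ℂ) * z w) (p, x) t
      - D.integrand (fun w => (D.weight w.2 : ℂ) * z' w) (p, x) t
      = D.integrand (fun w => (D.weight w.2 : ℂ) * (z - z') w) (p, x) t := by
    intro t
    simp only [integrand, BoundedContinuousFunction.coe_sub, Pi.sub_apply]
    ring
  simp only [e]
  have h1 := D.one_le_weight x
  have h2 := D.norm_integral_integrand_le (p := p) (x := x) (N := ‖z - z'‖)
    (f := fun w => (D.weight w.2 : ℂ) * (z - z') w)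
    (fun t _ => D.norm_weight_mul_le (z - z') p t)
  rw [norm_mul, Complex.norm_real, Real.norm_of_nonneg (inv_nonneg.2 (D.weight_pos _).le),
    inv_mul_le_iff₀ (D.weight_pos _), dist_eq_norm]
  have hz := norm_nonneg (z - z')
  push_cast
  nlinarith

end JostData

end Kerr

end

noncomputable section

namespace Kerr

open Filter Topology Set MeasureTheory
open scoped BoundedContinuousFunction

theorem hasDerivAt_integral_Ioi {f : ℝ → ℂ} (hf : Continuous f)
    (hi : ∀ x, IntegrableOn f (Ioi x)) (x : ℝ) :
    HasDerivAt (fun x => ∫ t in Ioi x, f t) (-f x) x := by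
  have e : ∀ y, ∫ t in Ioi y, f t = (∫ t in Ioi (0 : ℝ), f t) - ∫ t in (0 : ℝ)..y, f t := by
    intro y
    rw [eq_sub_iff_add_eq, add_comm]
    exact intervalIntegral.integral_interval_add_Ioi (hi 0) (hi y)
  rw [show (fun y => ∫ t in Ioi y, f t) = _ from funext e]
  exact ((hf.integral_hasStrictDerivAt 0 x).hasDerivAt).const_sub _

namespace JostData

variable {P : Type*} [TopologicalSpace P] (D : JostData P) [FirstCountableTopology P] [Nonempty P]

/-- The weighted factor of the Jost solution, the fixed point of the Volterra operator. -/
def fixed : P × ℝ →ᵇ ℂ := ContractingWith.fixedPoint D.volterra D.contracting_volterra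

/-- The factor `h = e^{-iκx} v` of the Jost solution `v`. -/
def factor (y : P × ℝ) : ℂ := D.weight y.2 * D.fixed y

/-- A bound for the weighted factor of the Jost solution. -/
def factorBound : ℝ := ‖D.fixed‖

/-- The derivative of the factor of the Jost solution. -/
def slope (p : P) (x : ℝ) : ℂ :=
  -∫ t in Ioi x, Complex.exp (2 * Complex.I * D.κ p * (max (t - x) 0 : ℝ))
    * (D.q p t * D.factor (p, t))

/-- The Jost solution, asymptotic to `e^{iκx}` at `+∞`. -/
def jost (p : P) (x : ℝ) : ℂ := Complex.exp (Complex.I * D.κ p * x) * D.factor (p, x)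

/-- The derivative of the Jost solution. -/
def jostDeriv (p : P) (x : ℝ) : ℂ :=
  Complex.exp (Complex.I * D.κ p * x) * (Complex.I * D.κ p * D.factor (p, x) + D.slope p x)

theorem continuous_factor : Continuous D.factor := D.continuous_weight_mul _

theorem norm_factor_le (p : P) (t : ℝ) : ‖D.factor (p, t)‖ ≤ D.weight t * D.factorBound :=
  D.norm_weight_mul_le _ p t

theorem factor_eq (p : P) (x : ℝ) :
    D.factor (p, x) = 1 + ∫ t in Ioi x, D.integrand D.factor (p, x) t := by
  have h : D.volterra D.fixed = D.fixed :=
    D.contracting_volterra.fixedPoint_isFixedPt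
  have h' := congrArg (fun z : P × ℝ →ᵇ ℂ => z (p, x)) h
  simp only [D.volterra_apply] at h'
  have hw : (D.weight x : ℂ) ≠ 0 := Complex.ofReal_ne_zero.2 (D.weight_pos x).ne'
  unfold factor
  simp only [← h']
  push_cast
  rw [mul_inv_cancel_left₀ hw]

theorem continuous_jost : Continuous (Function.uncurry D.jost) := by
  have h1 : Continuous fun y : P × ℝ => D.κ y.1 := D.continuous_κ.comp continuous_fst
  have h2 := D.continuous_factor
  exact Continuous.mul (by fun_prop) h2

theorem continuous_q_mul_factor (p : P) : Continuous fun t => D.q p t * D.factor (p, t) :=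
  (D.continuous_q.comp (continuous_const.prodMk continuous_id)).mul
    (D.continuous_factor.comp (continuous_const.prodMk continuous_id))

theorem norm_q_mul_factor_le (p : P) (t : ℝ) :
    ‖D.q p t * D.factor (p, t)‖ ≤ D.Q t * (D.weight t * D.factorBound) := by
  rw [norm_mul]
  exact mul_le_mul (D.norm_q_le _ _) (D.norm_factor_le _ _) (norm_nonneg _) (D.Q_nonneg t)

theorem norm_slope_integrand_le (p : P) (x t : ℝ) :
    ‖Complex.exp (2 * Complex.I * D.κ p * (max (t - x) 0 : ℝ)) * (D.q p t * D.factor (p, t))‖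
      ≤ 1 * (D.Q t * (D.weight t * D.factorBound)) := by
  rw [norm_mul]
  exact mul_le_mul (norm_exp_I_mul_le_one (D.im_nonneg p) (le_max_right _ _))
    (D.norm_q_mul_factor_le p t) (norm_nonneg _) zero_le_one

theorem continuous_slope (x : ℝ) : Continuous fun p => D.slope p x := by
  unfold slope
  refine Continuous.neg ?_
  refine continuous_of_dominated
    (bound := fun t => D.factorBound * (D.Q t * D.weight t)) ?_ ?_ ?_ ?_
  · intro p
    have := D.continuous_q_mul_factor p
    exact (Continuous.mul (by fun_prop) this).aestronglyMeasurable
  · intro p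
    refine Eventually.of_forall fun t => ?_
    exact (D.norm_slope_integrand_le p x t).trans (le_of_eq (by ring))
  · exact (D.integrableOn_Q_mul_weight x).const_mul _
  · refine Eventually.of_forall fun t => ?_
    have h1 := D.continuous_κ
    have h2 : Continuous fun p => D.q p t :=
      D.continuous_q.comp (continuous_id.prodMk continuous_const)
    have h3 : Continuous fun p => D.factor (p, t) :=
      D.continuous_factor.comp (continuous_id.prodMk continuous_const)
    exact Continuous.mul (by fun_prop) (h2.mul h3)

theorem continuous_jost_left (x : ℝ) : Continuous fun p => D.jost p x :=
  D.continuous_jost.comp (continuous_id.prodMk continuous_const)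

theorem continuous_jostDeriv (x : ℝ) : Continuous fun p => D.jostDeriv p x := by
  have h1 := D.continuous_κ
  have h2 := D.continuous_slope x
  have h3 : Continuous fun p => D.factor (p, x) :=
    D.continuous_factor.comp (continuous_id.prodMk continuous_const)
  unfold jostDeriv
  fun_prop

theorem tendsto_factor (p : P) : Tendsto (fun x => D.factor (p, x)) atTop (𝓝 1) := by
  rw [tendsto_iff_norm_sub_tendsto_zero]
  refine squeeze_zero (fun _ => norm_nonneg _) (fun x => ?_)
    (by simpa using D.tendsto_weight_sub_one.const_mul (D.factorBound / 2))
  rw [D.factor_eq, add_sub_cancel_left]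
  exact D.norm_integral_integrand_le fun t _ => D.norm_factor_le p t

theorem tendsto_slope (p : P) : Tendsto (fun x => D.slope p x) atTop (𝓝 0) := by
  rw [tendsto_zero_iff_norm_tendsto_zero]
  refine squeeze_zero (fun _ => norm_nonneg _) (fun x => ?_)
    (by simpa using D.tendsto_weight_sub_one.const_mul (1 * D.factorBound * (D.k / 2)))
  unfold slope
  rw [norm_neg]
  exact (D.norm_integral_le fun t _ => D.norm_slope_integrand_le p x t).trans
    (le_of_eq (by ring))

theorem integrableOn_q_mul_factor (p : P) (x : ℝ) :
    IntegrableOn (fun t => D.q p t * D.factor (p, t)) (Ioi x) :=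
  D.integrableOn_of_norm_le (D.continuous_q_mul_factor p) (c := 1) (N := D.factorBound)
    fun t _ => (D.norm_q_mul_factor_le p t).trans (le_of_eq (by ring))

theorem integrableOn_exp_mul_q_mul_factor (p : P) (x : ℝ) :
    IntegrableOn (fun t => Complex.exp (2 * Complex.I * D.κ p * (t : ℝ))
      * (D.q p t * D.factor (p, t))) (Ioi x) := by
  have h := D.continuous_q_mul_factor p
  have hc : Continuous fun t : ℝ => Complex.exp (2 * Complex.I * D.κ p * (t : ℝ))
      * (D.q p t * D.factor (p, t)) := Continuous.mul (by fun_prop) h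
  refine D.integrableOn_of_norm_le (c := ‖Complex.exp (2 * Complex.I * D.κ p * (x : ℝ))‖)
    (N := D.factorBound) hc fun t ht => ?_
  have e : Complex.exp (2 * Complex.I * D.κ p * (t : ℝ))
      = Complex.exp (2 * Complex.I * D.κ p * (x : ℝ))
        * Complex.exp (2 * Complex.I * D.κ p * ((t - x : ℝ) : ℂ)) := by
    rw [← Complex.exp_add]; congr 1; push_cast; ring
  rw [norm_mul, e, norm_mul]
  refine mul_le_mul ?_ (D.norm_q_mul_factor_le p t) (norm_nonneg _) (norm_nonneg _)
  exact mul_le_of_le_one_right (norm_nonneg _)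
    (norm_exp_I_mul_le_one (D.im_nonneg p) (sub_nonneg.2 (le_of_lt ht)))

/-- The factor and its slope in terms of integrals whose integrands do not depend on `x`, so that they
can be differentiated. -/
theorem slope_eq (p : P) (x : ℝ) :
    D.slope p x = -(Complex.exp (-(2 * Complex.I * D.κ p * x))
      * ∫ t in Ioi x, Complex.exp (2 * Complex.I * D.κ p * (t : ℝ))
        * (D.q p t * D.factor (p, t))) := by
  unfold slope
  rw [← integral_const_mul]
  congr 1
  refine setIntegral_congr_fun measurableSet_Ioi fun t ht => ?_
  have ht' : x < t := ht
  simp only [max_eq_left (sub_nonneg.2 ht'.le)]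
  have e : Complex.exp (2 * Complex.I * D.κ p * ((t - x : ℝ) : ℂ))
      = Complex.exp (-(2 * Complex.I * D.κ p * x))
        * Complex.exp (2 * Complex.I * D.κ p * (t : ℝ)) := by
    rw [← Complex.exp_add]; congr 1; push_cast; ring
  rw [e, mul_assoc]

theorem factor_eq' (p : P) (x : ℝ) :
    D.factor (p, x) = 1 + (-D.slope p x - ∫ t in Ioi x, D.q p t * D.factor (p, t))
      / (2 * Complex.I * D.κ p) := by
  have hk := D.κ_ne_zero p
  rw [D.factor_eq, D.slope_eq, neg_neg, ← integral_const_mul, ← integral_sub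
    ((D.integrableOn_exp_mul_q_mul_factor p x).const_mul _) (D.integrableOn_q_mul_factor p x),
    ← integral_div]
  congr 1
  refine setIntegral_congr_fun measurableSet_Ioi fun t ht => ?_
  have ht' : x < t := ht
  simp only [integrand, jostKernel, max_eq_left (sub_nonneg.2 ht'.le)]
  have e : Complex.exp (2 * Complex.I * D.κ p * ((t - x : ℝ) : ℂ))
      = Complex.exp (-(2 * Complex.I * D.κ p * x))
        * Complex.exp (2 * Complex.I * D.κ p * (t : ℝ)) := by
    rw [← Complex.exp_add]; congr 1; push_cast; ring
  rw [e]
  field_simp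

theorem hasDerivAt_exp_mul (c : ℂ) (x : ℝ) :
    HasDerivAt (fun x : ℝ => Complex.exp (c * x)) (c * Complex.exp (c * x)) x := by
  have h := (((hasDerivAt_id (x : ℂ)).const_mul c).cexp).comp_ofReal
  refine h.congr_deriv ?_
  simp [mul_comm]

theorem hasDerivAt_slope (p : P) (x : ℝ) :
    HasDerivAt (D.slope p)
      (-(2 * Complex.I * D.κ p) * D.slope p x + D.q p x * D.factor (p, x)) x := by
  have e : D.slope p = fun x : ℝ => -(Complex.exp (-(2 * Complex.I * D.κ p) * x)
      * ∫ t in Ioi x, Complex.exp (2 * Complex.I * D.κ p * (t : ℝ))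
        * (D.q p t * D.factor (p, t))) := by
    funext x; rw [D.slope_eq, neg_mul]
  have hc : Continuous fun t : ℝ => Complex.exp (2 * Complex.I * D.κ p * (t : ℝ))
        * (D.q p t * D.factor (p, t)) := by
    have h := D.continuous_q_mul_factor p
    exact Continuous.mul (by fun_prop) h
  have h := ((hasDerivAt_exp_mul (-(2 * Complex.I * D.κ p)) x).fun_mul
    (hasDerivAt_integral_Ioi hc (D.integrableOn_exp_mul_q_mul_factor p) x)).fun_neg
  rw [e]
  refine h.congr_deriv ?_
  have e1 : Complex.exp (-(2 * Complex.I * D.κ p) * x)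
      * Complex.exp (2 * Complex.I * D.κ p * x) = 1 := by
    rw [← Complex.exp_add]; simp
  linear_combination (D.q p x * D.factor (p, x)) * e1

theorem hasDerivAt_factor (p : P) (x : ℝ) :
    HasDerivAt (fun x => D.factor (p, x)) (D.slope p x) x := by
  have e : (fun x => D.factor (p, x)) = fun x => 1 + (-D.slope p x
      - ∫ t in Ioi x, D.q p t * D.factor (p, t)) / (2 * Complex.I * D.κ p) :=
    funext fun x => D.factor_eq' p x
  have h := ((((D.hasDerivAt_slope p x).fun_neg).fun_sub (hasDerivAt_integral_Ioi
    (D.continuous_q_mul_factor p) (D.integrableOn_q_mul_factor p) x)).div_const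
    (2 * Complex.I * D.κ p)).const_add 1
  rw [e]
  refine h.congr_deriv ?_
  have hk := D.κ_ne_zero p
  field_simp
  ring

theorem solvesODE_jost (p : P) :
    SolvesODE (fun x => D.q p x - D.κ p ^ 2) (D.jost p) (D.jostDeriv p) := by
  intro x
  have h1 := hasDerivAt_exp_mul (Complex.I * D.κ p) x
  refine ⟨(h1.fun_mul (D.hasDerivAt_factor p x)).congr_deriv ?_,
    (h1.fun_mul (((D.hasDerivAt_factor p x).const_mul (Complex.I * D.κ p)).fun_add
      (D.hasDerivAt_slope p x))).congr_deriv ?_⟩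
  · simp only [jostDeriv]; ring
  · simp only [jost]
    linear_combination (Complex.exp (Complex.I * D.κ p * x) * D.factor (p, x) * D.κ p ^ 2)
      * Complex.I_sq

theorem exp_mul_jost (p : P) (x : ℝ) :
    Complex.exp (-(Complex.I * D.κ p * x)) * D.jost p x = D.factor (p, x) := by
  unfold jost
  rw [← mul_assoc, ← Complex.exp_add]
  simp

theorem exp_mul_jostDeriv_sub (p : P) (x : ℝ) :
    Complex.exp (-(Complex.I * D.κ p * x))
      * (D.jostDeriv p x - Complex.I * D.κ p * D.jost p x) = D.slope p x := by
  have e : Complex.exp (-(Complex.I * D.κ p * x)) * Complex.exp (Complex.I * D.κ p * x) = 1 := by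
    rw [← Complex.exp_add]; simp
  unfold jost jostDeriv
  linear_combination D.slope p x * e

theorem tendsto_exp_mul_jost (p : P) :
    Tendsto (fun x : ℝ => Complex.exp (-(Complex.I * D.κ p * x)) * D.jost p x) atTop (𝓝 1) := by
  simpa only [D.exp_mul_jost] using D.tendsto_factor p

theorem tendsto_exp_mul_jostDeriv_sub (p : P) :
    Tendsto (fun x : ℝ => Complex.exp (-(Complex.I * D.κ p * x))
      * (D.jostDeriv p x - Complex.I * D.κ p * D.jost p x)) atTop (𝓝 0) := by
  simpa only [D.exp_mul_jostDeriv_sub] using D.tendsto_slope p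

/-- The Jost solution at `x` depends on the coefficient to the right of `x` only. -/
theorem factor_eq_of_eqOn {p p' : P} {x₀ : ℝ} (hκ : D.κ p = D.κ p')
    (hq : ∀ t, x₀ ≤ t → D.q p t = D.q p' t) {x : ℝ} (hx : x₀ ≤ x) :
    D.factor (p, x) = D.factor (p', x) := by
  -- the difference of the factors is a fixed point of the homogeneous Volterra operator,
  -- so that every bound for it can be halved
  have step : ∀ N : ℝ, (∀ t, x₀ ≤ t → ‖D.factor (p, t) - D.factor (p', t)‖ ≤ D.weight t * N) →
      ∀ t, x₀ ≤ t → ‖D.factor (p, t) - D.factor (p', t)‖ ≤ D.weight t * (N / 2) := by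
    intro N hN t ht
    have e : D.factor (p, t) - D.factor (p', t) = ∫ s in Ioi t,
        D.integrand (fun w => D.factor w - D.factor (p', w.2)) (p, t) s := by
      rw [D.factor_eq p t, D.factor_eq p' t, add_sub_add_left_eq_sub,
        ← integral_sub (D.integrableOn_integrand D.continuous_factor D.norm_factor_le (p, t))
        (D.integrableOn_integrand D.continuous_factor D.norm_factor_le (p', t))]
      refine setIntegral_congr_fun measurableSet_Ioi fun s hs => ?_
      have hs' : t < s := hs
      simp only [integrand, hκ, hq s (ht.trans hs'.le)]
      ring
    rw [e]
    refine (D.norm_integral_integrand_le (N := N) fun s hs => hN s (ht.trans hs.le)).trans ?_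
    have h0 : 0 ≤ N := nonneg_of_mul_nonneg_right ((norm_nonneg _).trans (hN t ht))
      (D.weight_pos t)
    nlinarith
  have iter : ∀ n : ℕ, ∀ t, x₀ ≤ t →
      ‖D.factor (p, t) - D.factor (p', t)‖ ≤ D.weight t * (2 * D.factorBound * (1 / 2) ^ n) := by
    intro n
    induction n with
    | zero =>
      intro t _
      refine (norm_sub_le _ _).trans ?_
      have h1 := D.norm_factor_le p t
      have h2 := D.norm_factor_le p' t
      simp only [pow_zero, mul_one]
      linarith
    | succ n ih =>
      intro t ht
      refine (step _ ih t ht).trans (le_of_eq ?_)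
      rw [pow_succ]; ring
  have hlim : Tendsto (fun n : ℕ => D.weight x * (2 * D.factorBound * (1 / 2) ^ n)) atTop
      (𝓝 0) := by
    have := ((tendsto_pow_atTop_nhds_zero_of_lt_one (r := (1 / 2 : ℝ)) (by norm_num)
      (by norm_num)).const_mul (2 * D.factorBound)).const_mul (D.weight x)
    simpa using this
  have := ge_of_tendsto' hlim fun n => iter n x hx
  exact sub_eq_zero.1 (norm_le_zero_iff.1 this)

theorem jost_eq_of_eqOn {p p' : P} {x₀ : ℝ} (hκ : D.κ p = D.κ p')
    (hq : ∀ t, x₀ ≤ t → D.q p t = D.q p' t) {x : ℝ} (hx : x₀ ≤ x) :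
    D.jost p x = D.jost p' x ∧ D.jostDeriv p x = D.jostDeriv p' x := by
  have h := D.factor_eq_of_eqOn hκ hq hx
  have h' : D.slope p x = D.slope p' x := by
    unfold slope
    congr 1
    refine setIntegral_congr_fun measurableSet_Ioi fun s hs => ?_
    have hs' : x < s := hs
    simp only [hκ, hq s (hx.trans hs'.le), D.factor_eq_of_eqOn hκ hq (hx.trans hs'.le)]
  simp only [jost, jostDeriv, hκ, h, h', and_self]

omit [FirstCountableTopology P] [Nonempty P] in
theorem one_div_le_tail {x : ℝ} (hx : 0 ≤ x) : 1 / (1 + x ^ 2) ≤ 2 * (1 - x / √(1 + x ^ 2)) := by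
  have h0 : 0 < 1 + x ^ 2 := by positivity
  have h1 := Real.sq_sqrt h0.le
  have h2 := Real.sqrt_pos.2 h0
  set r := √(1 + x ^ 2)
  have h3 : x ≤ r := by nlinarith
  rw [← h1, div_le_iff₀ (by positivity)]
  have : 2 * (1 - x / r) * r ^ 2 = 2 * (r - x) * r := by field_simp
  rw [this]
  nlinarith

/-- Jost data for coefficients that are bounded and decay like `x⁻²` at `+∞`; the tail integral of
the majorant is a multiple of `√(1 + x²) - x`. -/
def ofBound {P : Type*} [TopologicalSpace P] (κ : P → ℂ) (q : P → ℝ → ℂ) (k A : ℝ)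
    (hκ : Continuous κ) (him : ∀ p, 0 ≤ (κ p).im) (hk : 0 < k) (hkκ : ∀ p, k ≤ ‖κ p‖)
    (hq : Continuous (Function.uncurry q)) (hA : 0 ≤ A) (hqA : ∀ p x, ‖q p x‖ ≤ A)
    (hqA' : ∀ p x, 0 ≤ x → ‖q p x‖ ≤ A / (1 + x ^ 2)) : JostData P where
  κ := κ
  q := q
  k := k
  Q := fun x => 2 * A * (1 - x / √(1 + x ^ 2))
  m := fun x => 2 * A * (√(1 + x ^ 2) - x)
  continuous_κ := hκ
  im_nonneg := him
  k_pos := hk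
  k_le := hkκ
  continuous_q := hq
  norm_q_le := by
    intro p x
    rcases le_total 0 x with hx | hx
    · refine (hqA' p x hx).trans ?_
      have := mul_le_mul_of_nonneg_left (one_div_le_tail hx) hA
      calc A / (1 + x ^ 2) = A * (1 / (1 + x ^ 2)) := by ring
        _ ≤ _ := this
        _ = _ := by ring
    · refine (hqA p x).trans ?_
      have : x / √(1 + x ^ 2) ≤ 0 := div_nonpos_of_nonpos_of_nonneg hx (Real.sqrt_nonneg _)
      nlinarith
  hasDerivAt_m := by
    intro x
    have h0 : 0 < 1 + x ^ 2 := by positivity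
    have h := ((((hasDerivAt_pow 2 x).const_add 1).sqrt h0.ne').sub (hasDerivAt_id x)).const_mul
      (2 * A)
    refine h.congr_deriv ?_
    have := (Real.sqrt_pos.2 h0).ne'
    push_cast
    field_simp
    ring
  tendsto_m := by
    have h1 : Tendsto (fun x : ℝ => 2 * A * x⁻¹) atTop (𝓝 0) := by
      simpa using tendsto_inv_atTop_zero.const_mul (2 * A)
    refine squeeze_zero' (Eventually.of_forall fun x => ?_) ?_ h1
    · refine mul_nonneg (by positivity) (sub_nonneg.2 ?_)
      refine (le_abs_self x).trans (Real.abs_le_sqrt (by linarith))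
    · filter_upwards [eventually_gt_atTop 0] with x hx
      refine mul_le_mul_of_nonneg_left ?_ (by positivity)
      rw [sub_le_iff_le_add]
      refine Real.sqrt_le_iff.2 ⟨by positivity, ?_⟩
      have : (x⁻¹ + x) ^ 2 = x⁻¹ ^ 2 + 2 + x ^ 2 := by field_simp; ring
      rw [this]
      nlinarith [sq_nonneg x⁻¹]

end JostData

end Kerr

end

noncomputable section

/-! ### Compactly supported barriers with prescribed reflection coefficient -/

namespace Kerr

open Filter Topology Set MeasureTheory
open scoped ComplexConjugate

/-- `IsScatterer w₀ τ`: there is a nonzero smooth potential barrier `0 ≤ W ≤ w₀` of compact support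
such that the solution of `y'' + (1 - W) y = 0` equal to `e^{is}` to the right of the barrier is
`c₁ cosh τ e^{is} + c₂ sinh τ e^{-is}` with `|c₁| = |c₂| = 1` to its left. Thus `tanh |τ|` is the
modulus of the reflection coefficient. -/
def IsScatterer (w₀ τ : ℝ) : Prop :=
  ∃ (L : ℝ) (W : ℝ → ℝ) (y y₁ : ℝ → ℂ) (c₁ c₂ : ℂ), 0 < L ∧
    ContDiff ℝ ((⊤ : ℕ∞) : WithTop ℕ∞) W ∧ (∀ s, 0 ≤ W s) ∧ (∀ s, W s ≤ w₀) ∧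
    (∀ s, W s ≠ 0 → s ∈ Icc 0 L) ∧ (∃ s, W s ≠ 0) ∧
    SolvesODE (fun s => (W s : ℂ) - 1) y y₁ ∧ c₁ * conj c₁ = 1 ∧ c₂ * conj c₂ = 1 ∧
    (∀ s : ℝ, L ≤ s → y s = Complex.exp (Complex.I * s)) ∧
    ∀ s : ℝ, s ≤ 0 → y s = Real.cosh τ * c₁ * Complex.exp (Complex.I * s)
      + Real.sinh τ * c₂ * Complex.exp (-(Complex.I * s))

theorem IsScatterer.neg {w₀ τ : ℝ} (h : IsScatterer w₀ τ) : IsScatterer w₀ (-τ) := by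
  obtain ⟨L, W, y, y₁, c₁, c₂, hL, hW, h0, hw, hs, hn, hy, h1, h2, hr, hl⟩ := h
  refine ⟨L, W, y, y₁, c₁, -c₂, hL, hW, h0, hw, hs, hn, hy, h1, by simpa using h2, hr, ?_⟩
  intro s hs0
  rw [hl s hs0]
  simp

/-- Every phase is attained by `e^{2is}` on each interval of length `π`. -/
theorem exists_exp_two_mul_eq (a : ℝ) {ζ : ℂ} (hζ : ‖ζ‖ = 1) :
    ∃ s, a ≤ s ∧ s ≤ a + Real.pi ∧ Complex.exp (2 * Complex.I * s) = ζ := by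
  obtain ⟨n, ⟨h1, h2⟩, -⟩ := existsUnique_add_zsmul_mem_Ico Real.pi_pos (ζ.arg / 2) a
  refine ⟨ζ.arg / 2 + n • Real.pi, h1, h2.le, ?_⟩
  have e : 2 * Complex.I * ((ζ.arg / 2 + n • Real.pi : ℝ) : ℂ)
      = ζ.arg * Complex.I + n * (2 * Real.pi * Complex.I) := by
    push_cast [zsmul_eq_mul]; ring
  rw [e, Complex.exp_add, Complex.exp_int_mul_two_pi_mul_I, mul_one]
  have := Complex.norm_mul_exp_arg_mul_I ζ
  rwa [hζ, Complex.ofReal_one, one_mul] at this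

theorem conj_exp_I_mul (s : ℝ) :
    conj (Complex.exp (Complex.I * s)) = Complex.exp (-(Complex.I * s)) := by
  rw [← Complex.exp_conj]; simp

/-- Two barriers at a suitable distance, so that the reflected waves interfere constructively. -/
theorem IsScatterer.add {w₀ τ σ : ℝ} (h : IsScatterer w₀ τ) (h' : IsScatterer w₀ σ) :
    IsScatterer w₀ (τ + σ) := by
  obtain ⟨L, W, y, y₁, c₁, c₂, hL, hW, h0, hw, hs, hn, hy, h1, h2, hr, hl⟩ := h
  obtain ⟨L', W', z, z₁, d₁, d₂, hL', hW', h0', hw', hs', hn', hz, h1', h2', hr', hl'⟩ := h'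
  have unit : ∀ c : ℂ, c * conj c = 1 → ‖c‖ = 1 := by
    intro c hc
    have : ((‖c‖ ^ 2 : ℝ) : ℂ) = 1 := by rw [← hc, Complex.mul_conj, Complex.normSq_eq_norm_sq]
    have h' : ‖c‖ ^ 2 = 1 := by exact_mod_cast this
    exact (pow_eq_one_iff_of_nonneg (norm_nonneg c) two_ne_zero).1 h'
  obtain ⟨a, ha, -, hea⟩ := exists_exp_two_mul_eq (L + 2) (ζ := d₁ * c₁ * c₂ * conj d₂)
    (by simp [unit _ h1, unit _ h2, unit _ h1', unit _ h2'])
  have hWz : ∀ s, ¬ s ∈ Icc 0 L → W s = 0 := fun s h => by_contra fun h' => h (hs s h')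
  have hWz' : ∀ s, ¬ s ∈ Icc 0 L' → W' s = 0 := fun s h => by_contra fun h' => h (hs' s h')
  set E := Complex.exp (Complex.I * a) with hE
  have hEE : E * E = d₁ * c₁ * c₂ * conj d₂ := by
    rw [← hea, hE, ← Complex.exp_add]; congr 1; ring
  have hEinv : E * Complex.exp (-(Complex.I * a)) = 1 := by
    rw [hE, ← Complex.exp_add]; simp
  have hfr : SolvesODE (fun s => ((W s - 1 : ℝ) : ℂ)) y y₁ := hy.congr_coeff (by simp)
  -- to the left of the gap, the solution with the right asymptotics is a combination of `y`, `ȳ`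
  have hf := (hfr.const_mul (Real.cosh σ * d₁)).add
    (hfr.conj.const_mul (Real.sinh σ * d₂ * (E * E)))
  have hg := (hz.comp_sub_const a).const_mul E
  have hshift : ∀ s : ℝ, Complex.exp (Complex.I * ((s - a : ℝ) : ℂ))
      = Complex.exp (Complex.I * s) * Complex.exp (-(Complex.I * a)) := by
    intro s; rw [← Complex.exp_add]; congr 1; push_cast; ring
  have hshift' : ∀ s : ℝ, Complex.exp (-(Complex.I * ((s - a : ℝ) : ℂ)))
      = Complex.exp (-(Complex.I * s)) * E := by
    intro s; rw [hE, ← Complex.exp_add]; congr 1; push_cast; ring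
  have key := SolvesODE.glue (A := L) (B := a) (x₀ := L + 1) (by linarith) (by linarith) hf hg (by
    intro t ht ht'
    simp only [hr t ht.le, hl' (t - a) (by linarith), conj_exp_I_mul, hshift, hshift']
    linear_combination -(Real.cosh σ * d₁ * Complex.exp (Complex.I * t)) * hEinv)
  refine ⟨a + L', fun s => W s + W' (s - a), _, _, d₁ * c₁, d₁ * c₂, by linarith,
    hW.add (hW'.comp (contDiff_id.sub contDiff_const)), fun s => add_nonneg (h0 _) (h0' _),
    ?_, ?_, ?_, key.congr_coeff ?_, ?_, ?_, ?_, ?_⟩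
  · intro s
    change W s + W' (s - a) ≤ w₀
    by_cases h : s ∈ Icc 0 L
    · rw [hWz' (s - a) (by simp only [mem_Icc, not_and]; intro h'; linarith [h.2]), add_zero]
      exact hw s
    · rw [hWz s h, zero_add]; exact hw' _
  · intro s hns
    by_cases h : s ∈ Icc 0 L
    · exact ⟨h.1, by linarith [h.2]⟩
    · have h' := hs' (s - a) (by simpa [hWz s h] using hns)
      exact ⟨by linarith [h'.1], by linarith [h'.2]⟩
  · obtain ⟨s, hs1⟩ := hn
    refine ⟨s, ?_⟩
    have := lt_of_le_of_ne (h0 s) (Ne.symm hs1)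
    have := h0' (s - a)
    positivity
  · intro s
    change _ = ((W s + W' (s - a) : ℝ) : ℂ) - 1
    split_ifs with h
    · rw [hWz' (s - a) (by simp only [mem_Icc, not_and]; intro h'; linarith)]
      push_cast; ring
    · rw [hWz s (by simp only [mem_Icc, not_and]; intro h'; linarith)]
      push_cast; ring
  · rw [map_mul]; linear_combination c₁ * conj c₁ * h1' + h1
  · rw [map_mul]; linear_combination c₂ * conj c₂ * h1' + h2
  · intro s hsr
    rw [if_neg (by linarith), hr' _ (by linarith), hshift]
    linear_combination Complex.exp (Complex.I * s) * hEinv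
  · intro s hs0
    rw [if_pos (by linarith), hl s hs0, Real.cosh_add, Real.sinh_add]
    simp only [map_add, map_mul, Complex.conj_ofReal, conj_exp_I_mul, hEE]
    have e3 : conj (Complex.exp (-(Complex.I * s))) = Complex.exp (Complex.I * s) := by
      rw [← conj_exp_I_mul, Complex.conj_conj]
    rw [e3]
    push_cast
    linear_combination (Complex.sinh σ * Complex.cosh τ * d₁ * c₂
      * Complex.exp (-(Complex.I * s))) * (c₁ * conj c₁ * h2' + h1)
      + (Complex.sinh σ * Complex.sinh τ * d₁ * c₁
      * Complex.exp (Complex.I * s)) * (c₂ * conj c₂ * h2' + h2)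

/-- Variation of constants: the amplitude of the component `e^{-is}` changes on the barrier only. -/
theorem SolvesODE.wave_plus {W : ℝ → ℂ} {y y₁ : ℝ → ℂ} (hW : Continuous W)
    (h : SolvesODE (fun s => W s - 1) y y₁) (a b : ℝ) :
    (y b + Complex.I * y₁ b) * Complex.exp (Complex.I * b)
      - (y a + Complex.I * y₁ a) * Complex.exp (Complex.I * a)
      = Complex.I * ∫ s in a..b, W s * y s * Complex.exp (Complex.I * s) := by
  have hy := h.continuous
  rw [← intervalIntegral.integral_const_mul, ← intervalIntegral.integral_eq_sub_of_hasDerivAt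
    (f := fun s : ℝ => (y s + Complex.I * y₁ s) * Complex.exp (Complex.I * s))]
  · intro s _
    refine (((h s).1.fun_add ((h s).2.const_mul Complex.I)).fun_mul
      (JostData.hasDerivAt_exp_mul Complex.I s)).congr_deriv ?_
    linear_combination (y₁ s * Complex.exp (Complex.I * s)) * Complex.I_sq
  · exact Continuous.intervalIntegrable (by fun_prop) _ _

/-- Variation of constants for the amplitude of the component `e^{is}`. -/
theorem SolvesODE.wave_minus {W : ℝ → ℂ} {y y₁ : ℝ → ℂ} (hW : Continuous W)
    (h : SolvesODE (fun s => W s - 1) y y₁) (a b : ℝ) :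
    (y b - Complex.I * y₁ b) * Complex.exp (-(Complex.I * b))
      - (y a - Complex.I * y₁ a) * Complex.exp (-(Complex.I * a))
      = -Complex.I * ∫ s in a..b, W s * y s * Complex.exp (-(Complex.I * s)) := by
  have hy := h.continuous
  simp only [← neg_mul]
  rw [← intervalIntegral.integral_const_mul, ← intervalIntegral.integral_eq_sub_of_hasDerivAt
    (f := fun s : ℝ => (y s - Complex.I * y₁ s) * Complex.exp (-Complex.I * s))]
  · intro s _
    refine (((h s).1.fun_sub ((h s).2.const_mul Complex.I)).fun_mul
      (JostData.hasDerivAt_exp_mul (-Complex.I) s)).congr_deriv ?_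
    linear_combination (y₁ s * Complex.exp (-Complex.I * s)) * Complex.I_sq
  · exact Continuous.intervalIntegrable (by fun_prop) _ _

theorem exp_mul_exp_neg (z : ℂ) : Complex.exp z * Complex.exp (-z) = 1 := by
  rw [← Complex.exp_add]; simp

/-- To the right of its support, a barrier leaves the outgoing wave `e^{is}` unperturbed. -/
theorem eq_exp_of_outgoing {W : ℝ → ℂ} {y y₁ : ℝ → ℂ} (hW : Continuous W)
    (h : SolvesODE (fun s => W s - 1) y y₁) {a : ℝ} (h0 : ∀ s, a ≤ s → W s = 0)
    (t1 : Tendsto (fun s : ℝ => Complex.exp (-(Complex.I * s)) * y s) atTop (𝓝 1))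
    (t2 : Tendsto (fun s : ℝ => Complex.exp (-(Complex.I * s)) * (y₁ s - Complex.I * y s)) atTop
      (𝓝 0)) {s : ℝ} (hs : a ≤ s) :
    y s = Complex.exp (Complex.I * s) ∧ y₁ s = Complex.I * Complex.exp (Complex.I * s) := by
  have hn : ∀ s : ℝ, ‖Complex.exp (Complex.I * s)‖ = 1 := fun s => by
    rw [mul_comm]; exact Complex.norm_exp_ofReal_mul_I s
  have hn' : ∀ s : ℝ, ‖Complex.exp (-(Complex.I * s))‖ = 1 := fun s => by
    rw [← conj_exp_I_mul, RCLike.norm_conj, hn]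
  have van : ∀ b, s ≤ b → ∀ g : ℝ → ℂ, ∫ t in s..b, W t * y t * g t = 0 := by
    intro b hb g
    rw [intervalIntegral.integral_congr (g := fun _ => (0 : ℂ))]
    · simp
    · intro t ht
      rw [uIcc_of_le hb] at ht
      simp [h0 t (hs.trans ht.1)]
  have p1 : (y s + Complex.I * y₁ s) * Complex.exp (Complex.I * s) = 0 := by
    have hlim : Tendsto (fun b : ℝ => (y b + Complex.I * y₁ b) * Complex.exp (Complex.I * b)) atTop
        (𝓝 0) := by
      rw [tendsto_zero_iff_norm_tendsto_zero] at t2 ⊢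
      refine t2.congr fun b => ?_
      have : y b + Complex.I * y₁ b = Complex.I * (y₁ b - Complex.I * y b) := by
        linear_combination y b * Complex.I_sq
      rw [this, norm_mul, norm_mul, norm_mul, hn, hn', Complex.norm_I]; ring
    refine tendsto_nhds_unique ((tendsto_const_nhds).congr' ?_) hlim
    filter_upwards [eventually_ge_atTop s] with b hb
    have := h.wave_plus hW s b
    rw [van b hb, mul_zero] at this
    exact (sub_eq_zero.1 this).symm
  have p2 : y s + Complex.I * y₁ s = 0 := by
    rcases mul_eq_zero.1 p1 with h' | h'
    · exact h'
    · exact absurd h' (Complex.exp_ne_zero _)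
  have p3 : (y s - Complex.I * y₁ s) * Complex.exp (-(Complex.I * s)) = 2 := by
    have hlim : Tendsto (fun b : ℝ => (y b - Complex.I * y₁ b) * Complex.exp (-(Complex.I * b)))
        atTop (𝓝 2) := by
      have h3 := (t1.const_mul 2).add (t2.const_mul (-Complex.I))
      simp only [mul_one, mul_zero, add_zero] at h3
      refine h3.congr fun b => ?_
      linear_combination (Complex.exp (-(Complex.I * b)) * y b) * Complex.I_sq
    refine tendsto_nhds_unique ((tendsto_const_nhds).congr' ?_) hlim
    filter_upwards [eventually_ge_atTop s] with b hb
    have := h.wave_minus hW s b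
    rw [van b hb, mul_zero] at this
    exact (sub_eq_zero.1 this).symm
  have e := exp_mul_exp_neg (Complex.I * s)
  have hy : y s = Complex.exp (Complex.I * s) := by
    linear_combination (1 / 2) * p2 + (1 / 2) * Complex.exp (Complex.I * s) * p3
      - (1 / 2) * (y s - Complex.I * y₁ s) * e
  refine ⟨hy, ?_⟩
  rw [← hy]
  linear_combination -Complex.I * p2 + y₁ s * Complex.I_sq

end Kerr

end

noncomputable section

namespace Kerr

open Filter Topology Set MeasureTheory
open scoped ComplexConjugate

/-- A fixed smooth bump supported in `[0, 1/4]`. -/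
def pulse : ContDiffBump (1 / 8 : ℝ) := ⟨1 / 16, 1 / 8, by norm_num, by norm_num⟩

theorem pulse_eq_zero {t : ℝ} (ht : t ∉ Ioo (0 : ℝ) (1 / 4)) : pulse t = 0 := by
  rw [← Function.notMem_support, pulse.support_eq, Real.ball_eq_Ioo]
  convert ht using 3 <;> norm_num [pulse]

theorem pulse_pos {t : ℝ} (ht : t ∈ Ioo (0 : ℝ) (1 / 4)) : 0 < pulse t := by
  refine pulse.pos_of_mem_ball ?_
  rw [Real.ball_eq_Ioo]
  convert ht using 2 <;> norm_num [pulse]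

/-- The equations `v'' + v = κ b v` with the fixed bump `b`, for coupling constants
`κ` clamped to `[0, w₀]`. -/
def pulseData (w₀ : ℝ) (hw₀ : 0 < w₀) : JostData ℝ :=
  JostData.ofBound (fun _ => 1) (fun κ t => ((max 0 (min κ w₀) * pulse t : ℝ) : ℂ)) 1 (2 * w₀)
    continuous_const (by simp) one_pos (by simp)
    (by
      have h : Continuous fun t => pulse t := pulse.continuous
      unfold Function.uncurry
      fun_prop)
    (by positivity)
    (by
      intro p x
      rw [Complex.norm_real, Real.norm_of_nonneg (mul_nonneg (le_max_left _ _) pulse.nonneg)]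
      have h1 : max 0 (min p w₀) ≤ w₀ := max_le hw₀.le (min_le_right _ _)
      have h2 : pulse x ≤ 1 := pulse.le_one
      have h3 : 0 ≤ pulse x := pulse.nonneg
      nlinarith)
    (by
      intro p x hx
      rw [Complex.norm_real, Real.norm_of_nonneg (mul_nonneg (le_max_left _ _) pulse.nonneg)]
      have h1 : max 0 (min p w₀) ≤ w₀ := max_le hw₀.le (min_le_right _ _)
      have h2 : pulse x ≤ 1 := pulse.le_one
      have h3 : 0 ≤ pulse x := pulse.nonneg
      by_cases hxs : x ∈ Ioo (0 : ℝ) (1 / 4)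
      · rw [le_div_iff₀ (by positivity)]
        have : 1 + x ^ 2 ≤ 2 := by nlinarith [hxs.1, hxs.2]
        have h4 : max 0 (min p w₀) * pulse x ≤ w₀ := by nlinarith
        have h5 : 0 ≤ max 0 (min p w₀) * pulse x := mul_nonneg (le_max_left _ _) h3
        nlinarith
      · rw [pulse_eq_zero hxs, mul_zero]; positivity)

/-- Weak barriers: the reflection coefficient of `κ` times a bump depends continuously on `κ`,
vanishes for `κ = 0`, and does not vanish identically (by the Born approximation). -/
theorem exists_isScatterer {w₀ : ℝ} (hw₀ : 0 < w₀) :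
    ∃ τ₀ : ℝ, 0 < τ₀ ∧ ∀ τ, 0 < τ → τ < τ₀ → IsScatterer w₀ τ := by
  set D := pulseData w₀ hw₀ with hD
  set W : ℝ → ℝ → ℝ := fun κ t => max 0 (min κ w₀) * pulse t with hWdef
  have hWc : ∀ κ, Continuous fun t => (W κ t : ℂ) := fun κ =>
    Complex.continuous_ofReal.comp (continuous_const.mul pulse.continuous)
  have hWs : ∀ κ t, t ∉ Ioo (0 : ℝ) (1 / 4) → W κ t = 0 := fun κ t ht => by
    simp only [hWdef, pulse_eq_zero ht, mul_zero]
  have hsol : ∀ κ, SolvesODE (fun t => (W κ t : ℂ) - 1) (D.jost κ) (D.jostDeriv κ) := fun κ => by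
    refine (D.solvesODE_jost κ).congr_coeff fun t => ?_
    simp [hD, pulseData, JostData.ofBound, hWdef]
  have t1 : ∀ κ, Tendsto (fun s : ℝ => Complex.exp (-(Complex.I * s)) * D.jost κ s) atTop
      (𝓝 1) := fun κ => by
    have := D.tendsto_exp_mul_jost κ
    simpa [hD, pulseData, JostData.ofBound] using this
  have t2 : ∀ κ, Tendsto (fun s : ℝ => Complex.exp (-(Complex.I * s))
      * (D.jostDeriv κ s - Complex.I * D.jost κ s)) atTop (𝓝 0) := fun κ => by
    have := D.tendsto_exp_mul_jostDeriv_sub κ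
    simpa [hD, pulseData, JostData.ofBound] using this
  have hright : ∀ κ s, 1 / 4 ≤ s → D.jost κ s = Complex.exp (Complex.I * s)
      ∧ D.jostDeriv κ s = Complex.I * Complex.exp (Complex.I * s) := fun κ s hs =>
    eq_exp_of_outgoing (hWc κ) (hsol κ) (a := 1 / 4) (fun t ht => by
      rw [hWs κ t (fun h => by linarith [h.2]), Complex.ofReal_zero]) (t1 κ) (t2 κ) hs
  set α : ℝ → ℂ := fun κ => (D.jost κ 0 - Complex.I * D.jostDeriv κ 0) / 2 with hα
  set β : ℝ → ℂ := fun κ => (D.jost κ 0 + Complex.I * D.jostDeriv κ 0) / 2 with hβ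
  set J : ℝ → ℂ := fun κ => ∫ t in (0 : ℝ)..(1 / 4),
    (pulse t : ℂ) * D.jost κ t * Complex.exp (Complex.I * t) with hJ
  have hβc : Continuous β := by
    have h1 := D.continuous_jost_left 0
    have h2 := D.continuous_jostDeriv 0
    simp only [hβ]
    fun_prop
  have hJc : Continuous J := by
    refine intervalIntegral.continuous_parametric_intervalIntegral_of_continuous' ?_ 0 (1 / 4)
    have h1 := D.continuous_jost
    have h2 : Continuous fun t : ℝ => (pulse t : ℂ) :=
      Complex.continuous_ofReal.comp pulse.continuous
    exact ((h2.comp continuous_snd).mul h1).mul (by fun_prop)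
  have hβJ : ∀ κ, 2 * β κ = -(Complex.I * (max 0 (min κ w₀) : ℝ) * J κ) := by
    intro κ
    have h := (hsol κ).wave_plus (hWc κ) 0 (1 / 4)
    obtain ⟨r1, r2⟩ := hright κ (1 / 4) le_rfl
    rw [r1, r2] at h
    have e : ∫ t in (0 : ℝ)..(1 / 4), (W κ t : ℂ) * D.jost κ t * Complex.exp (Complex.I * t)
        = (max 0 (min κ w₀) : ℝ) * J κ := by
      rw [hJ, ← intervalIntegral.integral_const_mul]
      refine intervalIntegral.integral_congr fun t _ => ?_
      simp only [hWdef]; push_cast; ring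
    rw [e] at h
    simp only [Complex.ofReal_zero, mul_zero, Complex.exp_zero, mul_one] at h
    simp only [hβ]
    linear_combination -h + Complex.exp (Complex.I * (1 / 4 : ℝ)) ^ 2 * Complex.I_sq
  have hβ0 : β 0 = 0 := by
    have := hβJ 0
    rw [min_eq_left hw₀.le, max_self] at this
    simpa using this
  have hJ0 : J 0 ≠ 0 := by
    have e : J 0 = ∫ t in (0 : ℝ)..(1 / 4), (pulse t : ℂ) * Complex.exp (2 * Complex.I * t) := by
      refine intervalIntegral.integral_congr fun t _ => ?_
      have hj : D.jost 0 t = Complex.exp (Complex.I * t) :=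
        (eq_exp_of_outgoing (hWc 0) (hsol 0) (a := t) (fun s _ => by
          simp [hWdef, min_eq_left hw₀.le]) (t1 0) (t2 0) le_rfl).1
      simp only [hj, mul_assoc, ← Complex.exp_add]
      congr 2; ring
    have hc : Continuous fun t : ℝ => (pulse t : ℂ) * Complex.exp (2 * Complex.I * t) := by
      have h2 : Continuous fun t : ℝ => (pulse t : ℂ) :=
        Complex.continuous_ofReal.comp pulse.continuous
      fun_prop
    have hre : (J 0).re = ∫ t in (0 : ℝ)..(1 / 4), pulse t * Real.cos (2 * t) := by
      rw [e, ← Complex.reCLM_apply, ← ContinuousLinearMap.intervalIntegral_comp_comm _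
        (hc.intervalIntegrable _ _)]
      refine intervalIntegral.integral_congr fun t _ => ?_
      have : Complex.exp (2 * Complex.I * t) = Complex.exp ((2 * t : ℝ) * Complex.I) := by
        congr 1; push_cast; ring
      simp only [Complex.reCLM_apply, Complex.re_ofReal_mul, this, Complex.exp_ofReal_mul_I_re]
    have hpos : 0 < ∫ t in (0 : ℝ)..(1 / 4), pulse t * Real.cos (2 * t) := by
      have h2 : Continuous fun t : ℝ => pulse t := pulse.continuous
      refine intervalIntegral.intervalIntegral_pos_of_pos_on
        (Continuous.intervalIntegrable (by fun_prop) _ _) (fun t ht => ?_) (by norm_num)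
      refine mul_pos (pulse_pos ht) (Real.cos_pos_of_mem_Ioo ⟨?_, ?_⟩)
      · linarith [Real.pi_gt_three, ht.1]
      · linarith [Real.pi_gt_three, ht.2]
    intro h0
    rw [h0] at hre
    simp only [Complex.zero_re] at hre
    linarith
  obtain ⟨κ₁, hκ₁, hκw, hJκ⟩ : ∃ κ₁, 0 < κ₁ ∧ κ₁ ≤ w₀ ∧ J κ₁ ≠ 0 := by
    have h := hJc.continuousAt.eventually_ne hJ0
    obtain ⟨ε, hε, hball⟩ := Metric.eventually_nhds_iff.1 h
    refine ⟨min (ε / 2) w₀, lt_min (by linarith) hw₀, min_le_right _ _, hball ?_⟩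
    rw [Real.dist_eq, sub_zero, abs_of_pos (lt_min (by linarith) hw₀)]
    exact (min_le_left _ _).trans_lt (by linarith)
  have hβ1 : β κ₁ ≠ 0 := by
    have := hβJ κ₁
    rw [min_eq_left hκw, max_eq_right hκ₁.le] at this
    intro h0
    rw [h0, mul_zero, eq_comm, neg_eq_zero] at this
    simp [hκ₁.ne', hJκ] at this
  refine ⟨Real.arsinh ‖β κ₁‖, Real.arsinh_pos_iff.2 (norm_pos_iff.2 hβ1), fun τ hτ hτ₀ => ?_⟩
  have hsτ : 0 < Real.sinh τ := Real.sinh_pos_iff.2 hτ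
  have hsτ' : Real.sinh τ < ‖β κ₁‖ := by
    have := Real.sinh_lt_sinh.2 hτ₀
    rwa [Real.sinh_arsinh] at this
  obtain ⟨κ, hκ, hβκ⟩ := intermediate_value_Icc hκ₁.le hβc.norm.continuousOn
    (show Real.sinh τ ∈ Icc ‖β 0‖ ‖β κ₁‖ by rw [hβ0, norm_zero]; exact ⟨hsτ.le, hsτ'.le⟩)
  simp only at hβκ
  have hκ0 : 0 < κ := by
    refine lt_of_le_of_ne hκ.1 fun h0 => ?_
    rw [← h0, hβ0, norm_zero] at hβκ
    exact hsτ.ne hβκ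
  have hclamp : max 0 (min κ w₀) = κ := by
    rw [min_eq_left (hκ.2.trans hκw), max_eq_right hκ0.le]
  have hleft : ∀ s : ℝ, s ≤ 0 → D.jost κ s = α κ * Complex.exp (Complex.I * s)
      + β κ * Complex.exp (-(Complex.I * s)) := by
    intro s hs
    have van : ∀ g : ℝ → ℂ, ∫ t in s..0, (W κ t : ℂ) * D.jost κ t * g t = 0 := by
      intro g
      rw [intervalIntegral.integral_congr (g := fun _ => (0 : ℂ))]
      · simp
      · intro t ht
        rw [uIcc_of_le hs] at ht
        simp [hWs κ t (fun h => by linarith [h.1, ht.2])]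
    have h1 := (hsol κ).wave_plus (hWc κ) s 0
    have h2 := (hsol κ).wave_minus (hWc κ) s 0
    rw [van] at h1 h2
    simp only [Complex.ofReal_zero, mul_zero, neg_zero, Complex.exp_zero, mul_one] at h1 h2
    have e := exp_mul_exp_neg (Complex.I * s)
    simp only [hα, hβ]
    linear_combination (-1 / 2) * Complex.exp (-(Complex.I * s)) * h1
      - (1 / 2) * Complex.exp (Complex.I * s) * h2 - D.jost κ s * e
  have hflux : α κ * conj (α κ) - β κ * conj (β κ) = 1 := by
    have hreal : SolvesODE (fun t => ((W κ t - 1 : ℝ) : ℂ)) (D.jost κ) (D.jostDeriv κ) :=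
      (hsol κ).congr_coeff (by simp)
    have h := hreal.wronskian_eq hreal.conj 0 (1 / 4)
    obtain ⟨r1, r2⟩ := hright κ (1 / 4) le_rfl
    simp only [wronskian, r1, r2, map_mul, conj_exp_I_mul, Complex.conj_I] at h
    have e := exp_mul_exp_neg (Complex.I * (1 / 4 : ℝ))
    simp only [hα, hβ, map_div₀, map_sub, map_add, map_mul, Complex.conj_I, map_ofNat]
    linear_combination (Complex.I / 2) * h - Complex.I ^ 2 * e - Complex.I_sq
  have hch : 0 < Real.cosh τ := Real.cosh_pos τ
  have hβ2 : β κ * conj (β κ) = (Real.sinh τ : ℂ) ^ 2 := by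
    rw [Complex.mul_conj, Complex.normSq_eq_norm_sq, hβκ]; push_cast; rfl
  have hα2 : α κ * conj (α κ) = (Real.cosh τ : ℂ) ^ 2 := by
    have : (Real.cosh τ : ℂ) ^ 2 = (Real.sinh τ : ℂ) ^ 2 + 1 := by
      exact_mod_cast Real.cosh_sq τ
    rw [this]
    linear_combination hflux + hβ2
  have hc0 : (Real.cosh τ : ℂ) ≠ 0 := Complex.ofReal_ne_zero.2 hch.ne'
  have hs0 : (Real.sinh τ : ℂ) ≠ 0 := Complex.ofReal_ne_zero.2 hsτ.ne'
  refine ⟨1 / 4, W κ, D.jost κ, D.jostDeriv κ, α κ / Real.cosh τ, β κ / Real.sinh τ,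
    by norm_num, contDiff_const.mul pulse.contDiff, fun s => ?_, fun s => ?_, fun s hs => ?_,
    ⟨1 / 8, ?_⟩, hsol κ, ?_, ?_, fun s hs => (hright κ s hs).1, fun s hs => ?_⟩
  · exact mul_nonneg (le_max_left _ _) pulse.nonneg
  · have h1 : pulse s ≤ 1 := pulse.le_one
    have h2 : 0 ≤ pulse s := pulse.nonneg
    simp only [hWdef, hclamp]
    nlinarith [hκ.2]
  · by_contra h
    exact hs (hWs κ s fun h' => h ⟨h'.1.le, h'.2.le⟩)
  · simp only [hWdef, hclamp]
    exact (mul_pos hκ0 (pulse_pos (by constructor <;> norm_num))).ne'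
  · rw [map_div₀, Complex.conj_ofReal, div_mul_div_comm, hα2, ← sq, div_self (pow_ne_zero 2 hc0)]
  · rw [map_div₀, Complex.conj_ofReal, div_mul_div_comm, hβ2, ← sq, div_self (pow_ne_zero 2 hs0)]
  · rw [hleft s hs, mul_div_cancel₀ _ hc0, mul_div_cancel₀ _ hs0]

/-- Every reflection coefficient of modulus less than one is attained by arbitrarily weak
nonnegative barriers of compact support. -/
theorem isScatterer {w₀ : ℝ} (hw₀ : 0 < w₀) (τ : ℝ) : IsScatterer w₀ τ := by
  obtain ⟨τ₀, hτ₀, h⟩ := exists_isScatterer hw₀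
  have hmul : ∀ (n : ℕ) (σ : ℝ), IsScatterer w₀ σ → IsScatterer w₀ ((n + 1 : ℕ) * σ) := by
    intro n σ hσ
    induction n with
    | zero => simpa using hσ
    | succ n ih => convert ih.add hσ using 1; push_cast; ring
  have hpos : ∀ σ, 0 < σ → IsScatterer w₀ σ := by
    intro σ hσ
    obtain ⟨n, hn⟩ := exists_nat_gt (σ / τ₀)
    have hn0 : (0 : ℝ) < (n + 1 : ℕ) := by positivity
    have h1 : σ / (n + 1 : ℕ) < τ₀ := by
      rw [div_lt_iff₀ hn0]
      rw [div_lt_iff₀ hτ₀] at hn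
      push_cast
      nlinarith
    have := hmul n _ (h _ (div_pos hσ hn0) h1)
    rwa [mul_div_cancel₀ _ hn0.ne'] at this
  rcases lt_trichotomy τ 0 with hτ | hτ | hτ
  · simpa using (hpos (-τ) (by linarith)).neg
  · simpa [hτ] using (hpos 1 one_pos).add (hpos 1 one_pos).neg
  · exact hpos τ hτ

end Kerr

end

noncomputable section

/-! ### Barriers turning one solution into another -/

namespace Kerr

open Filter Topology Set MeasureTheory
open scoped ComplexConjugate

/-- The flux `Im (v̄ v')`. -/
def flux (v v₁ : ℝ → ℂ) (x : ℝ) : ℝ := (conj (v x) * v₁ x).im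

theorem wronskian_conj (v v₁ : ℝ → ℂ) (x : ℝ) :
    wronskian v v₁ (fun x => conj (v x)) (fun x => conj (v₁ x)) x
      = -2 * Complex.I * flux v v₁ x := by
  unfold wronskian flux
  apply Complex.ext <;> simp <;> ring

theorem SolvesODE.flux_eq {Q : ℝ → ℝ} {v v₁ : ℝ → ℂ} (h : SolvesODE (fun x => (Q x : ℂ)) v v₁)
    (x x' : ℝ) : flux v v₁ x = flux v v₁ x' := by
  have := h.wronskian_eq h.conj x x'
  rw [wronskian_conj, wronskian_conj] at this
  have h2 : (-2 * Complex.I) ≠ 0 := by simp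
  exact_mod_cast mul_left_cancel₀ h2 this

/-- A solution in terms of a solution of nonzero flux and its conjugate. -/
theorem SolvesODE.exists_decomposition {Q : ℝ → ℝ} {u u₁ v v₁ : ℝ → ℂ} {ω F : ℝ} (hω : ω ≠ 0)
    (hv : SolvesODE (fun x => (Q x : ℂ)) v v₁) (hu : SolvesODE (fun x => (Q x : ℂ)) u u₁)
    (fv : ∀ x, flux v v₁ x = ω) (fu : ∀ x, flux u u₁ x = F) :
    ∃ A B : ℂ, (∀ x, u x = A * v x + B * conj (v x)) ∧ ‖A‖ ^ 2 - ‖B‖ ^ 2 = F / ω := by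
  have hI : (-2 * Complex.I * (ω : ℂ)) ≠ 0 := by simp [hω]
  have hω' : (ω : ℂ) ≠ 0 := by simp [hω]
  set N : ℂ := -2 * Complex.I * ω
  set A := wronskian u u₁ (fun x => conj (v x)) (fun x => conj (v₁ x)) 0 / N
  set B := -(wronskian u u₁ v v₁ 0 / N)
  have hA : ∀ x, u x * conj (v₁ x) - u₁ x * conj (v x) = A * N := fun x => by
    rw [div_mul_cancel₀ _ hI, ← hu.wronskian_eq hv.conj x 0]; rfl
  have hB : ∀ x, u x * v₁ x - u₁ x * v x = -(B * N) := fun x => by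
    rw [neg_mul, neg_neg, div_mul_cancel₀ _ hI, ← hu.wronskian_eq hv x 0]; rfl
  have hN : ∀ x, v x * conj (v₁ x) - v₁ x * conj (v x) = N := fun x => by
    have := wronskian_conj v v₁ x
    rw [fv] at this
    exact this
  have e0 : ∀ x, u x = A * v x + B * conj (v x) := fun x => by
    refine mul_right_cancel₀ hI ?_
    linear_combination -(u x) * hN x + v x * hA x - conj (v x) * hB x
  have e1 : ∀ x, u₁ x = A * v₁ x + B * conj (v₁ x) := fun x => by
    refine mul_right_cancel₀ hI ?_
    linear_combination -(u₁ x) * hN x + v₁ x * hA x - conj (v₁ x) * hB x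
  refine ⟨A, B, e0, ?_⟩
  have hF := wronskian_conj u u₁ 0
  rw [fu, wronskian, e0, e1] at hF
  simp only [map_add, map_mul, Complex.conj_conj] at hF
  have e2 : (A * conj A - B * conj B) * N = -2 * Complex.I * F := by
    linear_combination hF - (A * conj A - B * conj B) * hN 0
  rw [Complex.mul_conj, Complex.mul_conj, Complex.normSq_eq_norm_sq, Complex.normSq_eq_norm_sq]
    at e2
  have h2 : (-2 * Complex.I) ≠ 0 := by simp
  have e3 : (((‖A‖ ^ 2 - ‖B‖ ^ 2 : ℝ)) : ℂ) * ω = F := by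
    refine mul_left_cancel₀ h2 ?_
    rw [← e2]; push_cast; simp only [N]; ring
  rw [eq_div_iff hω]
  exact_mod_cast e3

theorem hasDerivAt_re {v : ℝ → ℂ} {v' : ℂ} {x : ℝ} (h : HasDerivAt v v' x) :
    HasDerivAt (fun x => (v x).re) v'.re x :=
  (Complex.reCLM.hasFDerivAt.comp_hasDerivAt x h)

theorem hasDerivAt_im {v : ℝ → ℂ} {v' : ℂ} {x : ℝ} (h : HasDerivAt v v' x) :
    HasDerivAt (fun x => (v x).im) v'.im x :=
  (Complex.imCLM.hasFDerivAt.comp_hasDerivAt x h)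

/-- Liouville normal form: amplitude `σ` and phase `s` of a solution of positive flux `ω`. In the
variable `s`, the equation for `y = u / σ` is that of the free oscillator, and the potential
`ω² W(s) / σ⁴` becomes `W`. -/
theorem exists_liouville {Q : ℝ → ℝ} (hQ : ContDiff ℝ ((⊤ : ℕ∞) : WithTop ℕ∞) Q)
    {v v₁ : ℝ → ℂ} {ω : ℝ} (hω : 0 < ω)
    (hv : SolvesODE (fun x => (Q x : ℂ)) v v₁) (fv : ∀ x, flux v v₁ x = ω) :
    ∃ σ s : ℝ → ℝ, ContDiff ℝ ((⊤ : ℕ∞) : WithTop ℕ∞) σ ∧ ContDiff ℝ ((⊤ : ℕ∞) : WithTop ℕ∞) s ∧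
      (∀ x, 0 < σ x) ∧ (∀ x, σ x = ‖v x‖) ∧ (∀ x, HasDerivAt s (ω / σ x ^ 2) x) ∧
      (∀ x, v x = σ x * Complex.exp (Complex.I * s x)) ∧
      ∀ (W : ℝ → ℝ) (y y₁ : ℝ → ℂ), SolvesODE (fun t => (W t : ℂ) - 1) y y₁ →
        ∃ U₁, SolvesODE (fun x => ((Q x + ω ^ 2 * W (s x) / σ x ^ 4 : ℝ) : ℂ))
          (fun x => σ x * y (s x)) U₁ := by
  have hQ' : ContDiff ℝ ((⊤ : ℕ∞) : WithTop ℕ∞) fun x => (Q x : ℂ) :=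
    Complex.ofRealCLM.contDiff.comp hQ
  set a : ℝ → ℝ := fun x => (v x).re with ha
  set b : ℝ → ℝ := fun x => (v x).im with hb
  set a₁ : ℝ → ℝ := fun x => (v₁ x).re with ha₁
  set b₁ : ℝ → ℝ := fun x => (v₁ x).im with hb₁
  have da : ∀ x, HasDerivAt a (a₁ x) x := fun x => hasDerivAt_re (hv x).1
  have db : ∀ x, HasDerivAt b (b₁ x) x := fun x => hasDerivAt_im (hv x).1
  have da₁ : ∀ x, HasDerivAt a₁ (Q x * a x) x := fun x =>
    (hasDerivAt_re (hv x).2).congr_deriv (by simp [ha])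
  have db₁ : ∀ x, HasDerivAt b₁ (Q x * b x) x := fun x =>
    (hasDerivAt_im (hv x).2).congr_deriv (by simp [hb])
  have hfl : ∀ x, a x * b₁ x - b x * a₁ x = ω := fun x => by
    rw [← fv x]; simp [flux, ha, hb, ha₁, hb₁]; ring
  have hac : ContDiff ℝ ((⊤ : ℕ∞) : WithTop ℕ∞) a :=
    Complex.reCLM.contDiff.comp (hv.contDiff hQ').1
  have hbc : ContDiff ℝ ((⊤ : ℕ∞) : WithTop ℕ∞) b :=
    Complex.imCLM.contDiff.comp (hv.contDiff hQ').1
  have hpos : ∀ x, 0 < a x ^ 2 + b x ^ 2 := by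
    intro x
    by_contra hle
    have h1 : a x = 0 := by nlinarith [sq_nonneg (a x), sq_nonneg (b x)]
    have h2 : b x = 0 := by nlinarith [sq_nonneg (a x), sq_nonneg (b x)]
    have := hfl x
    rw [h1, h2] at this
    linarith
  set σ : ℝ → ℝ := fun x => √(a x ^ 2 + b x ^ 2) with hσ
  have hσc : ContDiff ℝ ((⊤ : ℕ∞) : WithTop ℕ∞) σ :=
    ((hac.pow 2).add (hbc.pow 2)).sqrt fun x => (hpos x).ne'
  have hσpos : ∀ x, 0 < σ x := fun x => Real.sqrt_pos.2 (hpos x)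
  have hσsq : ∀ x, σ x ^ 2 = a x ^ 2 + b x ^ 2 := fun x => Real.sq_sqrt (hpos x).le
  have hσv : ∀ x, σ x = ‖v x‖ := fun x => by
    rw [Complex.norm_def, Complex.normSq_apply, hσ]; simp only [ha, hb, sq]
  have dσ : ∀ x, HasDerivAt σ ((a x * a₁ x + b x * b₁ x) / σ x) x := by
    intro x
    refine ((((da x).fun_pow 2).fun_add ((db x).fun_pow 2)).sqrt (hpos x).ne').congr_deriv ?_
    have := (hσpos x).ne'
    change _ / (2 * σ x) = _
    field_simp
    push_cast
    ring
  have hsc : ContDiff ℝ ((⊤ : ℕ∞) : WithTop ℕ∞) fun x => ω / σ x ^ 2 :=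
    contDiff_const.div (hσc.pow 2) fun x => (pow_pos (hσpos x) 2).ne'
  set s : ℝ → ℝ := fun x => (v 0).arg + ∫ t in (0 : ℝ)..x, ω / σ t ^ 2 with hs
  have ds : ∀ x, HasDerivAt s (ω / σ x ^ 2) x := fun x =>
    ((hsc.continuous.integral_hasStrictDerivAt 0 x).hasDerivAt).const_add _
  have hscd : ContDiff ℝ ((⊤ : ℕ∞) : WithTop ℕ∞) s := by
    refine contDiff_infty_iff_deriv.2 ⟨fun x => (ds x).differentiableAt, ?_⟩
    rw [show deriv s = _ from funext fun x => (ds x).deriv]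
    exact hsc
  refine ⟨σ, s, hσc, hscd, hσpos, hσv, ds, ?_, ?_⟩
  · -- `v e^{-is} / σ` has zero derivative
    have dg : ∀ x, HasDerivAt (fun x => v x * Complex.exp (-Complex.I * s x) / (σ x : ℂ)) 0 x := by
      intro x
      have h0 : (σ x : ℂ) ≠ 0 := Complex.ofReal_ne_zero.2 (hσpos x).ne'
      have h1 := (((ds x).ofReal_comp).const_mul (-Complex.I)).cexp
      refine (((hv x).1.fun_mul h1).fun_div (dσ x).ofReal_comp h0).congr_deriv ?_
      have e1 : v₁ x * (σ x : ℂ) ^ 2 = v x * ((a x * a₁ x + b x * b₁ x : ℝ) + Complex.I * ω) := by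
        have hsq : ((σ x : ℂ)) ^ 2 = ((a x ^ 2 + b x ^ 2 : ℝ) : ℂ) := by
          rw [← hσsq]; push_cast; rfl
        have hv1 : v x = a x + b x * Complex.I := (Complex.re_add_im _).symm
        have hv2 : v₁ x = a₁ x + b₁ x * Complex.I := (Complex.re_add_im _).symm
        rw [hsq, ← hfl x, hv1, hv2]
        push_cast
        linear_combination -((b x : ℂ) * (a x * b₁ x - b x * a₁ x)) * Complex.I_sq
      push_cast at e1 ⊢
      field_simp
      linear_combination Complex.exp (-(Complex.I * (s x))) * e1
    have hconst := is_const_of_deriv_eq_zero (fun x => (dg x).differentiableAt)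
      (fun x => (dg x).deriv)
    intro x
    have h0 : (σ x : ℂ) ≠ 0 := Complex.ofReal_ne_zero.2 (hσpos x).ne'
    have h00 : (σ 0 : ℂ) ≠ 0 := Complex.ofReal_ne_zero.2 (hσpos 0).ne'
    have h1 := hconst x 0
    have h2 : s 0 = (v 0).arg := by simp [hs]
    have h3 : v 0 * Complex.exp (-Complex.I * s 0) / (σ 0 : ℂ) = 1 := by
      rw [div_eq_one_iff_eq h00, h2, hσv]
      have hp := Complex.norm_mul_exp_arg_mul_I (v 0)
      have ee := exp_mul_exp_neg ((v 0).arg * Complex.I)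
      rw [neg_mul, mul_comm Complex.I]
      linear_combination -Complex.exp (-((v 0).arg * Complex.I)) * hp + (‖v 0‖ : ℂ) * ee
    rw [h3, div_eq_one_iff_eq h0] at h1
    rw [← h1, mul_assoc, ← Complex.exp_add]
    simp
  · intro W y y₁ hy
    refine ⟨fun x => ((a x * a₁ x + b x * b₁ x) / σ x : ℝ) * y (s x)
      + (ω / σ x : ℝ) * y₁ (s x), fun x => ?_⟩
    have h0 : (σ x : ℂ) ≠ 0 := Complex.ofReal_ne_zero.2 (hσpos x).ne'
    have h0' := (hσpos x).ne'
    have dy : HasDerivAt (fun x => y (s x)) ((ω / σ x ^ 2 : ℝ) • y₁ (s x)) x :=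
      (hy (s x)).1.scomp x (ds x)
    have dy₁ := (hy (s x)).2.scomp x (ds x)
    refine ⟨((dσ x).ofReal_comp.fun_mul dy).congr_deriv ?_, ?_⟩
    · rw [Complex.real_smul]; push_cast; field_simp
    · have dτ := (((da x).fun_mul (da₁ x)).fun_add ((db x).fun_mul (db₁ x))).fun_div (dσ x) h0'
      have dω := (hasDerivAt_const x ω).fun_div (dσ x) h0'
      refine ((dτ.ofReal_comp.fun_mul dy).fun_add (dω.ofReal_comp.fun_mul dy₁)).congr_deriv ?_
      have e1 : (a₁ x ^ 2 + b₁ x ^ 2) * σ x ^ 2 = (a x * a₁ x + b x * b₁ x) ^ 2 + ω ^ 2 := by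
        rw [hσsq, ← hfl x]; ring
      have e2 := hσsq x
      have e1' : ((a₁ x : ℂ) ^ 2 + b₁ x ^ 2) * σ x ^ 2
          = ((a x : ℂ) * a₁ x + b x * b₁ x) ^ 2 + ω ^ 2 := by exact_mod_cast e1
      have e2' : (σ x : ℂ) ^ 2 = (a x : ℂ) ^ 2 + b x ^ 2 := by exact_mod_cast e2
      simp only [Complex.real_smul, Function.comp_apply]
      push_cast
      field_simp
      linear_combination y (s x) * e1' - y (s x) * Q x * (σ x : ℂ) ^ 2 * e2'

theorem exists_norm_mul_eq (B : ℂ) : ∃ b : ℂ, b * conj b = 1 ∧ B = ‖B‖ * b := by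
  refine ⟨Complex.exp (B.arg * Complex.I), ?_, (Complex.norm_mul_exp_arg_mul_I B).symm⟩
  rw [mul_comm (B.arg : ℂ), conj_exp_I_mul, exp_mul_exp_neg]

/-- The conclusion of the barrier construction: a smooth barrier `V` of height at most `ω² / 3` on
`[x₀, x₀ + ℓ]` turns the solution `u` to its left into a multiple of `v` to its right. -/
def HasBarrier (Q : ℝ → ℝ) (u v : ℝ → ℂ) (ω x₀ ℓ : ℝ) : Prop :=
  ∃ V : ℝ → ℝ, ContDiff ℝ ((⊤ : ℕ∞) : WithTop ℕ∞) V ∧ (∀ x, 0 ≤ V x) ∧ (∀ x, V x ≤ ω ^ 2 / 3) ∧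
    (∀ x, V x ≠ 0 → x ∈ Icc x₀ (x₀ + ℓ)) ∧ (∃ x, V x ≠ 0) ∧
    ∃ U U₁ : ℝ → ℂ, SolvesODE (fun x => ((Q x + V x : ℝ) : ℂ)) U U₁ ∧
      ∃ c₁ c₂ : ℂ, c₁ ≠ 0 ∧ c₂ ≠ 0 ∧ (∀ x ≤ x₀, U x = c₁ * u x) ∧
        ∀ x, x₀ + ℓ ≤ x → U x = c₂ * v x

/-- By conservation of flux, `u` is `A v + B v̄` with `|A| > |B|`. A scatterer of
rapidity `arsinh (|B| / √(|A|² - |B|²))`, pulled back by the phase of `v`, turns it into a multiple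
of `v`. As `|v|²` is at most `2`, the phase grows at least at the rate `ω / 2`, which bounds the length. -/
theorem exists_barrier_of_pos {Q : ℝ → ℝ} (hQ : ContDiff ℝ ((⊤ : ℕ∞) : WithTop ℕ∞) Q)
    {u u₁ v v₁ : ℝ → ℂ} {ω F X : ℝ} (hω : 0 < ω) (hF : 0 < F)
    (hv : SolvesODE (fun x => (Q x : ℂ)) v v₁) (hu : SolvesODE (fun x => (Q x : ℂ)) u u₁)
    (fv : ∀ x, flux v v₁ x = ω) (fu : ∀ x, flux u u₁ x = F)
    (hX : ∀ x, X ≤ x → 1 / 2 ≤ ‖v x‖ ^ 2 ∧ ‖v x‖ ^ 2 ≤ 2) :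
    ∃ ℓ : ℝ, 0 < ℓ ∧ ∀ x₀, X ≤ x₀ → HasBarrier Q u v ω x₀ ℓ := by
  obtain ⟨A, B, hAB, hflux⟩ := hv.exists_decomposition hω.ne' hu fv fu
  obtain ⟨σ, s, hσc, hsc, hσ, hσv, ds, hvσ, hL⟩ := exists_liouville hQ hω hv fv
  -- `|A| = √f cosh τ` and `|B| = √f sinh τ`
  set f := F / ω with hf
  have hf0 : 0 < f := div_pos hF hω
  have hfs : 0 < √f := Real.sqrt_pos.2 hf0
  set τ := Real.arsinh (‖B‖ / √f) with hτ
  have hB : ‖B‖ = √f * Real.sinh τ := by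
    rw [hτ, Real.sinh_arsinh, mul_div_cancel₀ _ hfs.ne']
  have hA : ‖A‖ = √f * Real.cosh τ := by
    have h1 := Real.cosh_sq τ
    have h2 := Real.sq_sqrt hf0.le
    refine (pow_left_inj₀ (norm_nonneg A) (mul_pos hfs (Real.cosh_pos τ)).le two_ne_zero).1 ?_
    rw [mul_pow, h1, h2]
    rw [hB, mul_pow, h2] at hflux
    linarith
  obtain ⟨a, haa, ha⟩ := exists_norm_mul_eq A
  obtain ⟨b, hbb, hb⟩ := exists_norm_mul_eq B
  obtain ⟨L, W, y, y₁, c₁, c₂, hLpos, hWc, hW0, hWw, hWs, ⟨t₀, ht₀⟩, hy, hc₁, hc₂, hyr, hyl⟩ :=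
    isScatterer (w₀ := 1 / 12) (by norm_num) τ
  have hsmono : StrictMono s := strictMono_of_hasDerivAt_pos ds fun x =>
    div_pos hω (pow_pos (hσ x) 2)
  refine ⟨2 * (Real.pi + L) / ω, by have := Real.pi_pos; positivity, fun x₀ hx₀ => ?_⟩
  set ℓ := 2 * (Real.pi + L) / ω with hℓ
  have hℓ0 : 0 < ℓ := by have := Real.pi_pos; positivity
  have hgrow : ∀ x, x₀ ≤ x → ω / 2 * (x - x₀) ≤ s x - s x₀ := by
    intro x hx
    refine (convex_Ici x₀).mul_sub_le_image_sub_of_le_deriv hsc.continuous.continuousOn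
      (fun x _ => (ds x).differentiableAt.differentiableWithinAt) (fun t ht => ?_) x₀
      self_mem_Ici x hx hx
    rw [interior_Ici] at ht
    have ht' : x₀ < t := ht
    rw [(ds t).deriv, hσv]
    have h2 := (hX t (hx₀.trans ht'.le)).2
    have h1 := (hX t (hx₀.trans ht'.le)).1
    exact div_le_div_of_nonneg_left hω.le (by linarith) h2
  have unit : ∀ c : ℂ, c * conj c = 1 → ‖c‖ = 1 := by
    intro c hc
    have : ((‖c‖ ^ 2 : ℝ) : ℂ) = 1 := by rw [← hc, Complex.mul_conj, Complex.normSq_eq_norm_sq]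
    have h' : ‖c‖ ^ 2 = 1 := by exact_mod_cast this
    exact (pow_eq_one_iff_of_nonneg (norm_nonneg c) two_ne_zero).1 h'
  obtain ⟨s₁, hs₁, hs₁', hE⟩ := exists_exp_two_mul_eq (s x₀) (ζ := c₁ * b * conj a * conj c₂)
    (by simp [unit _ haa, unit _ hbb, unit _ hc₁, unit _ hc₂])
  set E := Complex.exp (Complex.I * s₁) with hEdef
  have hEE : E * E = c₁ * b * conj a * conj c₂ := by
    rw [← hE, hEdef, ← Complex.exp_add]; congr 1; ring
  have hEi : E * Complex.exp (-(Complex.I * s₁)) = 1 := exp_mul_exp_neg _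
  have hend : s x₀ + (Real.pi + L) ≤ s (x₀ + ℓ) := by
    have := hgrow (x₀ + ℓ) (by linarith)
    have e : ω / 2 * (x₀ + ℓ - x₀) = Real.pi + L := by rw [hℓ]; field_simp; ring
    linarith
  have hysol : SolvesODE (fun t => ((W (t - s₁) : ℝ) : ℂ) - 1) (fun t => y (t - s₁))
    (fun t => y₁ (t - s₁)) := hy.comp_sub_const s₁
  obtain ⟨U₁, hU⟩ := hL (fun t => W (t - s₁)) _ _ hysol
  have hfsC : (√f : ℂ) ≠ 0 := Complex.ofReal_ne_zero.2 hfs.ne'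
  have ne0 : ∀ c : ℂ, c * conj c = 1 → c ≠ 0 := fun c hc h => by simp [h] at hc
  refine ⟨fun x => ω ^ 2 * W (s x - s₁) / σ x ^ 4, ?_, ?_, ?_, ?_, ?_, _, U₁, hU,
    c₁ * Complex.exp (-(Complex.I * s₁)) * conj a / √f, Complex.exp (-(Complex.I * s₁)), ?_,
    Complex.exp_ne_zero _, ?_, ?_⟩
  · exact (contDiff_const.mul (hWc.comp (hsc.sub contDiff_const))).div (hσc.pow 4)
      fun x => (pow_pos (hσ x) 4).ne'
  · intro x
    have := hW0 (s x - s₁)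
    have := hσ x
    positivity
  · intro x
    beta_reduce
    by_cases hx : x₀ ≤ x
    · rw [div_le_iff₀ (pow_pos (hσ x) 4)]
      have h1 := (hX x (hx₀.trans hx)).1
      rw [← hσv] at h1
      have h2 : (1 : ℝ) / 4 ≤ σ x ^ 4 := by nlinarith
      have h3 := hWw (s x - s₁)
      have h4 : 0 < ω ^ 2 := by positivity
      nlinarith
    · have h1 : W (s x - s₁) = 0 := by
        by_contra h
        have := (hWs _ h).1
        have := hsmono (not_le.1 hx)
        linarith
      rw [h1, mul_zero, zero_div]; positivity
  · intro x hx
    have h := hWs (s x - s₁) fun h0 => hx (by simp [h0])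
    refine ⟨?_, ?_⟩
    · by_contra hlt
      have := hsmono (not_le.1 hlt)
      linarith [h.1]
    · by_contra hlt
      have := hsmono (not_le.1 hlt)
      linarith [h.2]
  · have h := hWs t₀ ht₀
    obtain ⟨x, -, hx⟩ := intermediate_value_Icc (show x₀ ≤ x₀ + ℓ by linarith)
      hsc.continuous.continuousOn (show t₀ + s₁ ∈ Icc (s x₀) (s (x₀ + ℓ)) from
        ⟨by linarith [h.1], by linarith [h.2]⟩)
    refine ⟨x, ?_⟩
    beta_reduce
    have h1 : s x - s₁ = t₀ := by linarith
    have h2 := hσ x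
    rw [h1]
    positivity
  · have h1 : conj a ≠ 0 := by simpa using ne0 a haa
    exact div_ne_zero (mul_ne_zero (mul_ne_zero (ne0 _ hc₁) (Complex.exp_ne_zero _)) h1) hfsC
  · intro x hx
    have h1 : s x - s₁ ≤ 0 := by linarith [hsmono.monotone hx]
    have e1 : Complex.exp (Complex.I * ((s x - s₁ : ℝ) : ℂ))
        = Complex.exp (Complex.I * s x) * Complex.exp (-(Complex.I * s₁)) := by
      rw [← Complex.exp_add]; congr 1; push_cast; ring
    have e2 : Complex.exp (-(Complex.I * ((s x - s₁ : ℝ) : ℂ)))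
        = Complex.exp (-(Complex.I * s x)) * E := by
      rw [hEdef, ← Complex.exp_add]; congr 1; push_cast; ring
    have hA' : A = √f * Real.cosh τ * a := by
      rw [ha, hA]; push_cast; rfl
    have hB' : B = √f * Real.sinh τ * b := by
      rw [hb, hB]; push_cast; rfl
    rw [hyl _ h1, e1, e2, hAB, hvσ x, hA', hB', map_mul, conj_exp_I_mul, Complex.conj_ofReal]
    set e := Complex.exp (Complex.I * s x)
    set e' := Complex.exp (-(Complex.I * s x))
    set E' := Complex.exp (-(Complex.I * s₁))
    rw [div_mul_eq_mul_div, eq_div_iff hfsC]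
    linear_combination (-√f * σ x * Real.cosh τ * c₁ * e * E') * haa
      + √f * σ x * Real.sinh τ * e' * (-c₂ * E * hEi + c₂ * E' * hEE + c₁ * b * conj a * E' * hc₂)
  · intro x hx
    have h1 : L ≤ s x - s₁ := by linarith [hsmono.monotone hx]
    have e1 : Complex.exp (Complex.I * ((s x - s₁ : ℝ) : ℂ))
        = Complex.exp (Complex.I * s x) * Complex.exp (-(Complex.I * s₁)) := by
      rw [← Complex.exp_add]; congr 1; push_cast; ring
    rw [hyr _ h1, e1, hvσ x]
    ring

theorem flux_conj (v v₁ : ℝ → ℂ) (x : ℝ) :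
    flux (fun x => conj (v x)) (fun x => conj (v₁ x)) x = -flux v v₁ x := by
  simp [flux]; ring

/-- Solutions whose fluxes have the same sign are joined by a barrier, at any place, whose length
does not depend on the place. -/
theorem exists_barrier {Q : ℝ → ℝ} (hQ : ContDiff ℝ ((⊤ : ℕ∞) : WithTop ℕ∞) Q)
    {u u₁ v v₁ : ℝ → ℂ} {ω F X : ℝ} (hωF : 0 < ω * F)
    (hv : SolvesODE (fun x => (Q x : ℂ)) v v₁) (hu : SolvesODE (fun x => (Q x : ℂ)) u u₁)
    (fv : ∀ x, flux v v₁ x = ω) (fu : ∀ x, flux u u₁ x = F)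
    (hX : ∀ x, X ≤ x → 1 / 2 ≤ ‖v x‖ ^ 2 ∧ ‖v x‖ ^ 2 ≤ 2) :
    ∃ ℓ : ℝ, 0 < ℓ ∧ ∀ x₀, X ≤ x₀ → HasBarrier Q u v ω x₀ ℓ := by
  rcases pos_and_pos_or_neg_and_neg_of_mul_pos hωF with ⟨h1, h2⟩ | ⟨h1, h2⟩
  · exact exists_barrier_of_pos hQ h1 h2 hv hu fv fu hX
  · obtain ⟨ℓ, hℓ, h⟩ := exists_barrier_of_pos hQ (ω := -ω) (F := -F) (X := X) (by linarith)
      (by linarith) hv.conj hu.conj (fun x => by rw [flux_conj, fv]) (fun x => by rw [flux_conj, fu])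
      (fun x hx => by simpa using hX x hx)
    refine ⟨ℓ, hℓ, fun x₀ hx₀ => ?_⟩
    obtain ⟨V, hVc, hV0, hVb, hVs, hVn, U, U₁, hU, c₁, c₂, hc₁, hc₂, hl, hr⟩ := h x₀ hx₀
    refine ⟨V, hVc, hV0, by simpa using hVb, hVs, hVn, _, _, hU.conj, conj c₁, conj c₂,
      by simpa using hc₁, by simpa using hc₂, fun x hx => ?_, fun x hx => ?_⟩
    · simp only [hl x hx, map_mul, Complex.conj_conj]
    · simp only [hr x hx, map_mul, Complex.conj_conj]

end Kerr

end

noncomputable section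

/-! ### The tortoise coordinate -/

namespace Kerr

open Filter Topology Set MeasureTheory

section Tortoise

variable {M a : ℝ}

theorem sq_lt_sq_mass (haM : |a| < M) : a ^ 2 < M ^ 2 := by
  have h := abs_nonneg a
  rw [← sq_abs a]
  nlinarith

theorem rPlus_sub_mass_pos (haM : |a| < M) : 0 < rPlus M a - M := by
  unfold rPlus
  rw [add_sub_cancel_left]
  exact Real.sqrt_pos.2 (sub_pos.2 (sq_lt_sq_mass haM))

theorem rPlus_pos (haM : |a| < M) : 0 < rPlus M a := by
  linarith [rPlus_sub_mass_pos haM, abs_nonneg a]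

theorem Delta_rPlus (haM : |a| < M) : Delta M a (rPlus M a) = 0 := by
  have := Real.sq_sqrt (sub_nonneg.2 (sq_lt_sq_mass haM).le)
  unfold Delta rPlus
  linear_combination this

/-- Factorization of `Δ` over the horizon radii `r₊` and `r₋ = 2M - r₊`. -/
theorem Delta_eq (haM : |a| < M) (r : ℝ) :
    Delta M a r = (r - rPlus M a) * (r - (2 * M - rPlus M a)) := by
  have := Delta_rPlus haM
  unfold Delta at *
  linear_combination this

theorem Delta_pos (haM : |a| < M) {r : ℝ} (hr : rPlus M a < r) : 0 < Delta M a r := by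
  rw [Delta_eq haM]
  have := rPlus_sub_mass_pos haM
  exact mul_pos (by linarith) (by linarith)

theorem Delta_le (haM : |a| < M) {r : ℝ} (hr : 0 ≤ r) : Delta M a r ≤ r ^ 2 + a ^ 2 := by
  unfold Delta
  have : 0 ≤ M := (abs_nonneg a).trans haM.le
  nlinarith [mul_nonneg this hr]

theorem sq_add_sq_pos (ha : 0 < |a|) (r : ℝ) : 0 < r ^ 2 + a ^ 2 := by
  have : a ≠ 0 := abs_pos.1 ha
  positivity

theorem hasDerivAt_rStar (haM : |a| < M) (c : ℝ) {r : ℝ} (hr : rPlus M a < r) :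
    HasDerivAt (rStar M a c) ((r ^ 2 + a ^ 2) / Delta M a r) r := by
  have hpos := rPlus_pos haM
  have hc : ContinuousOn (fun s : ℝ => (s ^ 2 + a ^ 2) / Delta M a s) (Ioi (rPlus M a)) := by
    refine ContinuousOn.div (by fun_prop) ?_ fun s hs => (Delta_pos haM hs).ne'
    unfold Delta; fun_prop
  have hsub : uIcc (2 * rPlus M a) r ⊆ Ioi (rPlus M a) := by
    rw [uIcc, Icc_subset_Ioi_iff inf_le_sup]
    exact lt_inf_iff.2 ⟨by linarith, hr⟩
  refine (intervalIntegral.integral_hasDerivAt_right (hc.mono hsub).intervalIntegrable ?_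
    (hc.continuousAt (Ioi_mem_nhds hr))).const_add c
  exact hc.stronglyMeasurableAtFilter isOpen_Ioi r hr

theorem rStar_add_const (M a c r : ℝ) : rStar M a c r = rStar M a 0 r + c := by
  simp [rStar, add_comm]

theorem rStar_base (M a c : ℝ) : rStar M a c (2 * rPlus M a) = c := by simp [rStar]

theorem strictMonoOn_rStar (haM : |a| < M) (c : ℝ) :
    StrictMonoOn (rStar M a c) (Ioi (rPlus M a)) := by
  refine strictMonoOn_of_deriv_pos (convex_Ioi _)
    (fun r hr => (hasDerivAt_rStar haM c hr).continuousAt.continuousWithinAt) fun r hr => ?_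
  rw [interior_Ioi] at hr
  rw [(hasDerivAt_rStar haM c hr).deriv]
  have h : rPlus M a < r := hr
  have := rPlus_pos haM
  have := Delta_pos haM h
  have : 0 < r := by linarith
  positivity

theorem sub_le_rStar (haM : |a| < M) {r : ℝ} (hr : 2 * rPlus M a ≤ r) :
    r - 2 * rPlus M a ≤ rStar M a 0 r := by
  have hpos := rPlus_pos haM
  have h := (convex_Ici (2 * rPlus M a)).mul_sub_le_image_sub_of_le_deriv (f := rStar M a 0)
    (C := 1) (fun t ht => (hasDerivAt_rStar haM 0
      (by have : 2 * rPlus M a ≤ t := ht; linarith)).continuousAt.continuousWithinAt)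
    (fun t ht => by
      rw [interior_Ici] at ht
      have : 2 * rPlus M a < t := ht
      exact (hasDerivAt_rStar haM 0 (by linarith)).differentiableAt.differentiableWithinAt)
    (fun t ht => by
      rw [interior_Ici] at ht
      have h1 : 2 * rPlus M a < t := ht
      have h2 : rPlus M a < t := by linarith
      rw [(hasDerivAt_rStar haM 0 h2).deriv, one_le_div (Delta_pos haM h2)]
      exact Delta_le haM (by linarith))
    _ self_mem_Ici r hr hr
  rw [rStar_base, one_mul, sub_zero] at h
  exact h

/-- The logarithmic divergence of the tortoise coordinate at the horizon. -/
theorem rStar_le_log (haM : |a| < M) {r : ℝ} (hr : rPlus M a < r) (hr' : r ≤ 2 * rPlus M a) :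
    rStar M a 0 r ≤ rPlus M a / 2 * (Real.log (r - rPlus M a) - Real.log (rPlus M a)) := by
  have hpos := rPlus_pos haM
  have hM := rPlus_sub_mass_pos haM
  have hd : ∀ t, rPlus M a < t → HasDerivAt (fun t => rStar M a 0 t
      - rPlus M a / 2 * Real.log (t - rPlus M a))
      ((t ^ 2 + a ^ 2) / Delta M a t - rPlus M a / 2 * (1 / (t - rPlus M a))) t := fun t ht =>
    (hasDerivAt_rStar haM 0 ht).sub
      ((((hasDerivAt_id t).sub_const _).log (sub_pos.2 ht).ne').const_mul _)
  have h : MonotoneOn (fun t => rStar M a 0 t - rPlus M a / 2 * Real.log (t - rPlus M a))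
      (Icc r (2 * rPlus M a)) := by
    refine monotoneOn_of_deriv_nonneg (convex_Icc _ _)
      (fun t ht => (hd t (hr.trans_le ht.1)).continuousAt.continuousWithinAt)
      (fun t ht => ?_) fun t ht => ?_
    · rw [interior_Icc] at ht
      exact (hd t (hr.trans ht.1)).differentiableAt.differentiableWithinAt
    · rw [interior_Icc] at ht
      have h1 := hr.trans ht.1
      rw [(hd t h1).deriv, Delta_eq haM]
      have h2 : 0 < t - rPlus M a := sub_pos.2 h1
      have h3 : 0 < t - (2 * M - rPlus M a) := by linarith
      rw [sub_nonneg, mul_one_div, div_le_div_iff₀ h2 (mul_pos h2 h3)]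
      have h0 : 0 ≤ M := (abs_nonneg a).trans haM.le
      have h4 : t - (2 * M - rPlus M a) ≤ 2 * rPlus M a := by
        have := Delta_rPlus haM
        have h5 : 0 ≤ 2 * M - rPlus M a := by
          unfold Delta at this
          by_contra hlt
          nlinarith [sq_nonneg a]
        linarith [ht.2]
      have h6 : rPlus M a / 2 * (t - (2 * M - rPlus M a)) ≤ t ^ 2 + a ^ 2 := by
        nlinarith [sq_nonneg a]
      nlinarith
  have := h ⟨le_rfl, hr'⟩ ⟨hr', le_rfl⟩ hr'
  simp only [rStar_base] at this
  rw [show 2 * rPlus M a - rPlus M a = rPlus M a by ring] at this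
  linarith

theorem surjOn_rStar (haM : |a| < M) (c : ℝ) :
    SurjOn (rStar M a c) (Ioi (rPlus M a)) univ := by
  have hpos := rPlus_pos haM
  intro x _
  set y := x - c with hy
  -- a radius whose tortoise coordinate is at most `y`, and one for which it is at least `y`
  set r₁ := rPlus M a + rPlus M a * Real.exp (-(2 / rPlus M a * |y|)) with hr₁
  set r₂ := 2 * rPlus M a + |y| with hr₂
  have hexp : 0 < rPlus M a * Real.exp (-(2 / rPlus M a * |y|)) := by positivity
  have hexp1 : Real.exp (-(2 / rPlus M a * |y|)) ≤ 1 := by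
    refine Real.exp_le_one_iff.2 ?_
    have : 0 ≤ 2 / rPlus M a * |y| := by positivity
    linarith
  have h1 : rPlus M a < r₁ := by linarith
  have h1' : r₁ ≤ 2 * rPlus M a := by nlinarith
  have h2 : 2 * rPlus M a ≤ r₂ := by have := abs_nonneg y; linarith
  have e1 : rStar M a 0 r₁ ≤ y := by
    refine (rStar_le_log haM h1 h1').trans ?_
    rw [hr₁, add_sub_cancel_left, Real.log_mul hpos.ne' (Real.exp_pos _).ne', Real.log_exp,
      add_sub_cancel_left]
    have : rPlus M a / 2 * -(2 / rPlus M a * |y|) = -|y| := by field_simp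
    rw [this]
    exact neg_abs_le y
  have e2 : y ≤ rStar M a 0 r₂ := by
    have := sub_le_rStar haM h2
    have := le_abs_self y
    linarith
  obtain ⟨r, hr, hrx⟩ := intermediate_value_Icc (h1'.trans h2)
    (fun t ht => (hasDerivAt_rStar haM 0 (h1.trans_le ht.1)).continuousAt.continuousWithinAt)
    (show y ∈ Icc (rStar M a 0 r₁) (rStar M a 0 r₂) from ⟨e1, e2⟩)
  refine ⟨r, h1.trans_le hr.1, ?_⟩
  rw [rStar_add_const, hrx, hy]; ring

theorem rPlus_lt_radius (haM : |a| < M) (c x : ℝ) : rPlus M a < radius M a c x :=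
  Function.invFunOn_mem (surjOn_rStar haM c (mem_univ x))

theorem rStar_radius (haM : |a| < M) (c x : ℝ) : rStar M a c (radius M a c x) = x :=
  Function.invFunOn_eq (surjOn_rStar haM c (mem_univ x))

theorem radius_rStar (haM : |a| < M) (c : ℝ) {r : ℝ} (hr : rPlus M a < r) :
    radius M a c (rStar M a c r) = r :=
  (strictMonoOn_rStar haM c).injOn (rPlus_lt_radius haM c _) hr (rStar_radius haM c _)

theorem radius_eq (haM : |a| < M) (c x : ℝ) : radius M a c x = radius M a 0 (x - c) := by
  refine (strictMonoOn_rStar haM c).injOn (rPlus_lt_radius haM c _) (rPlus_lt_radius haM 0 _) ?_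
  rw [rStar_radius haM, rStar_add_const, rStar_radius haM]; ring

theorem strictMono_radius (haM : |a| < M) (c : ℝ) : StrictMono (radius M a c) := by
  intro x y hxy
  rw [← (strictMonoOn_rStar haM c).lt_iff_lt (rPlus_lt_radius haM c x) (rPlus_lt_radius haM c y),
    rStar_radius haM, rStar_radius haM]
  exact hxy

theorem hasDerivAt_radius (ha : 0 < |a|) (haM : |a| < M) (c x : ℝ) :
    HasDerivAt (radius M a c)
      (Delta M a (radius M a c x) / (radius M a c x ^ 2 + a ^ 2)) x := by
  have hcont : ContinuousAt (radius M a c) x := by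
    refine continuousAt_of_monotoneOn_of_image_mem_nhds (s := univ)
      ((strictMono_radius haM c).monotone.monotoneOn _) univ_mem ?_
    refine mem_of_superset (Ioi_mem_nhds (rPlus_lt_radius haM c x)) fun r hr => ?_
    exact ⟨rStar M a c r, mem_univ _, radius_rStar haM c hr⟩
  have h := rPlus_lt_radius haM c x
  have h1 := (Delta_pos haM h).ne'
  have h2 := (sq_add_sq_pos ha (radius M a c x)).ne'
  refine ((hasDerivAt_rStar haM c h).of_local_left_inverse hcont (div_ne_zero h2 h1)
    (Eventually.of_forall fun y => rStar_radius haM c y)).congr_deriv (inv_div _ _)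

theorem contDiff_Delta_div (ha : 0 < |a|) :
    ContDiff ℝ ((⊤ : ℕ∞) : WithTop ℕ∞) fun r => Delta M a r / (r ^ 2 + a ^ 2) := by
  unfold Delta
  exact ContDiff.div (by fun_prop) (by fun_prop) fun r => (sq_add_sq_pos ha r).ne'

theorem contDiff_radius (ha : 0 < |a|) (haM : |a| < M) (c : ℝ) :
    ContDiff ℝ ((⊤ : ℕ∞) : WithTop ℕ∞) (radius M a c) := by
  have hd := hasDerivAt_radius ha haM c
  refine contDiff_infty.2 fun n => ?_
  induction n with
  | zero =>
    have : Continuous (radius M a c) := continuous_iff_continuousAt.2 fun x => (hd x).continuousAt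
    simpa using this
  | succ n ih =>
    push_cast
    refine contDiff_succ_iff_deriv.2 ⟨fun x => (hd x).differentiableAt, by simp, ?_⟩
    rw [show deriv (radius M a c) = _ from funext fun x => (hd x).deriv]
    exact ((contDiff_Delta_div (M := M) ha).of_le (by exact_mod_cast le_top)).comp ih

theorem contDiffOn_rStar (haM : |a| < M) (c : ℝ) :
    ContDiffOn ℝ ((⊤ : ℕ∞) : WithTop ℕ∞) (rStar M a c) (Ioi (rPlus M a)) := by
  refine (contDiffOn_infty_iff_deriv_of_isOpen isOpen_Ioi).2 ⟨fun r hr =>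
    (hasDerivAt_rStar haM c hr).differentiableAt.differentiableWithinAt, ?_⟩
  have : ContDiffOn ℝ ((⊤ : ℕ∞) : WithTop ℕ∞) (fun r => (r ^ 2 + a ^ 2) / Delta M a r)
      (Ioi (rPlus M a)) := by
    refine ContDiffOn.div (by fun_prop) ?_ fun r hr => (Delta_pos haM hr).ne'
    unfold Delta; fun_prop
  exact this.congr fun r hr => (hasDerivAt_rStar haM c hr).deriv

theorem radius_sub_le (ha : 0 < |a|) (haM : |a| < M) {x y : ℝ} (hxy : x ≤ y) :
    radius M a 0 y - radius M a 0 x ≤ y - x := by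
  have h := Convex.image_sub_le_mul_sub_of_deriv_le (convex_univ (𝕜 := ℝ)) (f := radius M a 0)
    (C := 1)
    (contDiff_radius ha haM 0).continuous.continuousOn
    (fun t _ => (hasDerivAt_radius ha haM 0 t).differentiableAt.differentiableWithinAt)
    (fun t _ => by
      rw [(hasDerivAt_radius ha haM 0 t).deriv, div_le_one (sq_add_sq_pos ha _)]
      exact Delta_le haM (by linarith [rPlus_pos haM, rPlus_lt_radius haM 0 t]))
    x (mem_univ _) y (mem_univ _) hxy
  linarith

theorem radius_zero (haM : |a| < M) : radius M a 0 0 = 2 * rPlus M a := by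
  have h := radius_rStar haM 0 (r := 2 * rPlus M a) (by linarith [rPlus_pos haM])
  rwa [rStar_base] at h

/-- Linear growth of the radius at infinity. -/
theorem le_radius (ha : 0 < |a|) (haM : |a| < M) {x : ℝ} (hx : 0 ≤ x) :
    2 * rPlus M a + x / 8 ≤ radius M a 0 x := by
  have hpos := rPlus_pos haM
  have h := (convex_Ici (0 : ℝ)).mul_sub_le_image_sub_of_le_deriv (f := radius M a 0)
    (C := 1 / 8) (contDiff_radius ha haM 0).continuous.continuousOn
    (fun t _ => (hasDerivAt_radius ha haM 0 t).differentiableAt.differentiableWithinAt)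
    (fun t ht => by
      rw [interior_Ici] at ht
      have h1 : 2 * rPlus M a < radius M a 0 t := by
        rw [← radius_zero haM]; exact strictMono_radius haM 0 ht
      rw [(hasDerivAt_radius ha haM 0 t).deriv, le_div_iff₀ (sq_add_sq_pos ha _), Delta_eq haM]
      have h2 := rPlus_sub_mass_pos haM
      have h3 : a ^ 2 < M ^ 2 := sq_lt_sq_mass haM
      have h0 : 0 ≤ M := (abs_nonneg a).trans haM.le
      set r := radius M a 0 t
      have h4 : M ^ 2 ≤ r ^ 2 := by nlinarith
      have h5 : r / 2 * (r / 2) ≤ (r - rPlus M a) * (r - (2 * M - rPlus M a)) := by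
        refine mul_le_mul (by linarith) (by linarith) (by linarith) (by linarith)
      nlinarith)
    0 self_mem_Ici x hx hx
  rw [radius_zero haM] at h
  linarith

theorem exists_one_div_radius_sq_le (ha : 0 < |a|) (haM : |a| < M) :
    ∃ K : ℝ, 0 ≤ K ∧ ∀ x, 0 ≤ x → 1 / radius M a 0 x ^ 2 ≤ K / (1 + x ^ 2) := by
  have hpos := rPlus_pos haM
  refine ⟨1 / (2 * rPlus M a) ^ 2 + 64, by positivity, fun x hx => ?_⟩
  have h := le_radius ha haM hx
  have hr : 0 < radius M a 0 x := by linarith [rPlus_lt_radius haM 0 x]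
  rw [div_le_div_iff₀ (by positivity) (by positivity), one_mul]
  have h1 : (2 * rPlus M a) ^ 2 + (x / 8) ^ 2 ≤ radius M a 0 x ^ 2 := by
    have : 0 ≤ rPlus M a * (x / 8) := by positivity
    nlinarith
  have h2 : 1 ≤ 1 / (2 * rPlus M a) ^ 2 * radius M a 0 x ^ 2 := by
    rw [one_div, le_inv_mul_iff₀ (by positivity)]
    nlinarith [sq_nonneg (x / 8)]
  nlinarith [sq_nonneg (2 * rPlus M a)]

/-- The radius approaches `r₊` exponentially, hence faster than `x⁻²`, at the horizon. -/
theorem exists_radius_sub_le (ha : 0 < |a|) (haM : |a| < M) :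
    ∃ K : ℝ, 0 ≤ K ∧ ∀ x, x ≤ 0 → radius M a 0 x - rPlus M a ≤ K / (1 + x ^ 2) := by
  have hpos := rPlus_pos haM
  have hM := rPlus_sub_mass_pos haM
  have hM0 : 0 ≤ M := (abs_nonneg a).trans haM.le
  set d := rPlus M a - M with hd
  set β := 2 * d / (5 * rPlus M a ^ 2) with hβ
  have hβ0 : 0 < β := by positivity
  have hder : ∀ x, HasDerivAt (fun x => (radius M a 0 x - rPlus M a) * Real.exp (-β * x))
      (Delta M a (radius M a 0 x) / (radius M a 0 x ^ 2 + a ^ 2) * Real.exp (-β * x)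
        + (radius M a 0 x - rPlus M a) * (Real.exp (-β * x) * -β)) x := fun x =>
    ((hasDerivAt_radius ha haM 0 x).sub_const _).mul
      (by simpa using ((hasDerivAt_id x).const_mul (-β)).exp)
  have hmono : MonotoneOn (fun x => (radius M a 0 x - rPlus M a) * Real.exp (-β * x))
      (Iic 0) := by
    refine monotoneOn_of_deriv_nonneg (convex_Iic 0)
      (fun x _ => (hder x).continuousAt.continuousWithinAt)
      (fun x _ => (hder x).differentiableAt.differentiableWithinAt) fun x hx => ?_
    rw [interior_Iic] at hx
    rw [(hder x).deriv, Delta_eq haM]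
    have h1 := rPlus_lt_radius haM 0 x
    have h2 : radius M a 0 x < 2 * rPlus M a := by
      rw [← radius_zero haM]; exact strictMono_radius haM 0 hx
    set r := radius M a 0 x
    have h3 : 0 < r ^ 2 + a ^ 2 := sq_add_sq_pos ha r
    have h4 : β ≤ (r - (2 * M - rPlus M a)) / (r ^ 2 + a ^ 2) := by
      have h5 : a ^ 2 < M ^ 2 := sq_lt_sq_mass haM
      have h6 : r ^ 2 + a ^ 2 ≤ 5 * rPlus M a ^ 2 := by nlinarith
      rw [hβ]
      exact div_le_div₀ (by linarith) (by linarith) h3 h6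
    have h7 : 0 ≤ (r - rPlus M a) * ((r - (2 * M - rPlus M a)) / (r ^ 2 + a ^ 2) - β) :=
      mul_nonneg (by linarith) (by linarith)
    have h8 := mul_nonneg h7 (Real.exp_pos (-β * x)).le
    calc 0 ≤ _ := h8
      _ = _ := by ring
  refine ⟨rPlus M a * (1 + 2 / β ^ 2), by positivity, fun x hx => ?_⟩
  have h := hmono hx (mem_Iic.2 le_rfl) hx
  simp only [mul_zero, Real.exp_zero, mul_one] at h
  rw [radius_zero haM] at h
  rw [le_div_iff₀ (by positivity)]
  have h0 : 0 < radius M a 0 x - rPlus M a := sub_pos.2 (rPlus_lt_radius haM 0 x)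
  have hq := Real.quadratic_le_exp_of_nonneg (x := -β * x) (by nlinarith)
  have h1 : 1 + x ^ 2 ≤ Real.exp (-β * x) * (1 + 2 / β ^ 2) := by
    have e1 : 1 + (β * x) ^ 2 / 2 ≤ Real.exp (-β * x) := by nlinarith
    have e2 : 0 < 2 / β ^ 2 := by positivity
    have e3 : (β * x) ^ 2 / 2 * (2 / β ^ 2) = x ^ 2 := by field_simp
    nlinarith [sq_nonneg (β * x)]
  calc (radius M a 0 x - rPlus M a) * (1 + x ^ 2)
      ≤ (radius M a 0 x - rPlus M a) * (Real.exp (-β * x) * (1 + 2 / β ^ 2)) :=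
        mul_le_mul_of_nonneg_left h1 h0.le
    _ = (radius M a 0 x - rPlus M a) * Real.exp (-β * x) * (1 + 2 / β ^ 2) := by ring
    _ ≤ rPlus M a * (1 + 2 / β ^ 2) := by
        refine mul_le_mul_of_nonneg_right (by linarith) (by positivity)

end Tortoise

end Kerr

end

noncomputable section

/-! ### The radial potential -/

namespace Kerr

open Filter Topology Set MeasureTheory

/-- Eigenvalues on a short vertical segment above a real frequency are values of one holomorphic
family, by the identity theorem, or constant if there is no such family. -/
theorem exists_continuous_eigenvalue (a ω : ℝ) (m l : ℤ) :
    ∃ δ : ℝ, 0 < δ ∧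
      Continuous fun t : Icc (0 : ℝ) δ => eigenvalue a ((ω : ℂ) + Complex.I * (t : ℝ)) m l := by
  have hre : ∀ t : ℝ, ((ω : ℂ) + Complex.I * t).re = ω := fun t => by simp
  have him : ∀ t : ℝ, ((ω : ℂ) + Complex.I * t).im = t := fun t => by simp
  by_cases hex : ∃ ρ : ℝ, 0 < ρ ∧ ∃ f : ℂ → ℂ, IsHolomorphicBranch a m l ω ρ f
  · obtain ⟨ρ, hρ, f, hf, hf', hfr⟩ := hex
    have hmem : ∀ (t : Icc (0 : ℝ) (ρ / 2)) (σ : ℝ), (t : ℝ) < σ →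
        (ω : ℂ) + Complex.I * (t : ℝ) ∈ Metric.ball (ω : ℂ) σ := fun t σ h => by
      simpa [Metric.mem_ball, dist_eq_norm, abs_of_nonneg t.2.1] using h
    have hlt : ∀ t : Icc (0 : ℝ) (ρ / 2), (t : ℝ) < ρ := fun t => by linarith [t.2.2]
    refine ⟨ρ / 2, by linarith, ?_⟩
    have key : ∀ t : Icc (0 : ℝ) (ρ / 2), eigenvalue a ((ω : ℂ) + Complex.I * (t : ℝ)) m l
        = f ((ω : ℂ) + Complex.I * (t : ℝ)) := by
      intro t
      have h : ∃ f : ℂ → ℂ, ∃ ρ : ℝ, |((ω : ℂ) + Complex.I * (t : ℝ)).im| < ρ ∧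
          IsHolomorphicBranch a m l ((ω : ℂ) + Complex.I * (t : ℝ)).re ρ f :=
        ⟨f, ρ, by rw [him, abs_of_nonneg t.2.1]; exact hlt t, by rw [hre]; exact ⟨hf, hf', hfr⟩⟩
      unfold eigenvalue
      rw [dif_pos h]
      obtain ⟨ρ', hρ', hg, -, hgr⟩ := h.choose_spec
      set g := h.choose
      rw [him, abs_of_nonneg t.2.1] at hρ'
      rw [hre] at hg hgr
      set σ := min ρ ρ' with hσ
      have hσ0 : 0 < σ := lt_min hρ (t.2.1.trans_lt hρ')
      have hg' : AnalyticOnNhd ℂ g (Metric.ball (ω : ℂ) σ) :=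
        (hg.mono (Metric.ball_subset_ball (min_le_right _ _))).analyticOnNhd Metric.isOpen_ball
      have hf'' : AnalyticOnNhd ℂ f (Metric.ball (ω : ℂ) σ) :=
        (hf.mono (Metric.ball_subset_ball (min_le_left _ _))).analyticOnNhd Metric.isOpen_ball
      refine hg'.eqOn_of_preconnected_of_frequently_eq hf''
        (convex_ball _ _).isPreconnected (Metric.mem_ball_self hσ0) ?_
        (hmem t σ (lt_min (hlt t) hρ'))
      have hfreq : ∃ᶠ x : ℝ in 𝓝[≠] ω, g (x : ℂ) = f (x : ℂ) := by
        refine Eventually.frequently ?_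
        filter_upwards [nhdsWithin_le_nhds (Metric.ball_mem_nhds ω hσ0)] with x hx
        have hx' : (x : ℂ) ∈ Metric.ball (ω : ℂ) σ := by
          rw [Metric.mem_ball, Complex.dist_of_im_eq (by simp)]
          simpa using hx
        rw [hgr x (Metric.ball_subset_ball (min_le_right _ _) hx'),
          hfr x (Metric.ball_subset_ball (min_le_left _ _) hx')]
      have htend : Tendsto (fun x : ℝ => (x : ℂ)) (𝓝[≠] ω) (𝓝[≠] (ω : ℂ)) := by
        refine tendsto_nhdsWithin_iff.2
          ⟨(Complex.continuous_ofReal.tendsto ω).mono_left nhdsWithin_le_nhds, ?_⟩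
        filter_upwards [self_mem_nhdsWithin] with x hx
        simpa using hx
      exact htend.frequently hfreq
    simp only [key]
    exact hf.continuousOn.comp_continuous (by fun_prop) fun t => hmem t ρ (hlt t)
  · refine ⟨1, one_pos, ?_⟩
    have key : ∀ t : Icc (0 : ℝ) 1, eigenvalue a ((ω : ℂ) + Complex.I * (t : ℝ)) m l
        = (eigenvalueReal a ω m l : ℂ) := by
      intro t
      unfold eigenvalue
      rw [dif_neg, hre]
      rintro ⟨f, ρ, hρ, hf⟩
      rw [hre] at hf
      exact hex ⟨ρ, (abs_nonneg _).trans_lt hρ, f, hf⟩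
    simp only [key]
    exact continuous_const

variable {M a : ℝ} {m : ℤ}

/-- The part of the radial potential that does not depend on the frequency. -/
def potentialZero (M a : ℝ) (m : ℤ) (r : ℝ) : ℝ :=
  -(a ^ 2 * (m : ℝ) ^ 2) / (r ^ 2 + a ^ 2) ^ 2 + Delta M a r / (r ^ 2 + a ^ 2) ^ 4
    * (a ^ 2 * Delta M a r + 2 * M * r * (r ^ 2 - a ^ 2))

/-- The coefficient of `ω` in the radial potential. -/
def potentialOne (M a : ℝ) (m : ℤ) (r : ℝ) : ℝ := 4 * M * r * a * m / (r ^ 2 + a ^ 2) ^ 2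

/-- The coefficient of `λ + a² ω²` in the radial potential. -/
def potentialTwo (M a : ℝ) (r : ℝ) : ℝ := Delta M a r / (r ^ 2 + a ^ 2) ^ 2

theorem potential_eq (M a : ℝ) (ω : ℂ) (m l : ℤ) (r : ℝ) :
    potential M a ω m l r = potentialZero M a m r + ω * potentialOne M a m r
      + (eigenvalue a ω m l + (a : ℂ) ^ 2 * ω ^ 2) * potentialTwo M a r := by
  unfold potential potentialZero potentialOne potentialTwo
  push_cast
  ring

theorem contDiff_potentialZero (ha : 0 < |a|) :
    ContDiff ℝ ((⊤ : ℕ∞) : WithTop ℕ∞) (potentialZero M a m) := by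
  unfold potentialZero Delta
  refine ContDiff.add (ContDiff.div (by fun_prop) (by fun_prop) fun r => ?_)
    (ContDiff.mul (ContDiff.div (by fun_prop) (by fun_prop) fun r => ?_) (by fun_prop))
  all_goals exact pow_ne_zero _ (sq_add_sq_pos ha r).ne'

theorem contDiff_potentialOne (ha : 0 < |a|) :
    ContDiff ℝ ((⊤ : ℕ∞) : WithTop ℕ∞) (potentialOne M a m) := by
  unfold potentialOne
  exact ContDiff.div (by fun_prop) (by fun_prop) fun r => pow_ne_zero _ (sq_add_sq_pos ha r).ne'

theorem contDiff_potentialTwo (ha : 0 < |a|) :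
    ContDiff ℝ ((⊤ : ℕ∞) : WithTop ℕ∞) (potentialTwo M a) := by
  unfold potentialTwo Delta
  exact ContDiff.div (by fun_prop) (by fun_prop) fun r => pow_ne_zero _ (sq_add_sq_pos ha r).ne'

theorem abs_potentialTwo_le (ha : 0 < |a|) (haM : |a| < M) {r : ℝ} (hr : rPlus M a ≤ r) :
    |potentialTwo M a r| ≤ 1 / r ^ 2 := by
  have hpos := rPlus_pos haM
  have hr0 : 0 < r := by linarith
  have hD := sq_add_sq_pos ha r
  have h1 := Delta_le haM hr0.le
  have h0 : 0 ≤ Delta M a r := by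
    rcases hr.eq_or_lt with h | h
    · rw [← h, Delta_rPlus haM]
    · exact (Delta_pos haM h).le
  unfold potentialTwo
  rw [abs_of_nonneg (by positivity), div_le_div_iff₀ (by positivity) (by positivity), one_mul]
  have h2 : r ^ 2 ≤ r ^ 2 + a ^ 2 := by nlinarith [sq_nonneg a]
  rw [sq (r ^ 2 + a ^ 2)]
  exact mul_le_mul h1 h2 (by positivity) hD.le

theorem abs_potentialOne_le (ha : 0 < |a|) (haM : |a| < M) {r : ℝ} (hr : rPlus M a ≤ r) :
    |potentialOne M a m r| ≤ 4 * |a * m| / r ^ 2 := by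
  have hM := rPlus_sub_mass_pos haM
  have hpos := rPlus_pos haM
  have hr0 : 0 < r := by linarith
  have hM0 : 0 ≤ M := (abs_nonneg a).trans haM.le
  have hD := sq_add_sq_pos ha r
  unfold potentialOne
  have e : 4 * M * r * a * m = 4 * M * r * (a * m) := by ring
  rw [abs_div, e, abs_mul, abs_of_nonneg (show 0 ≤ 4 * M * r by positivity),
    abs_of_nonneg (show 0 ≤ (r ^ 2 + a ^ 2) ^ 2 by positivity),
    div_le_div_iff₀ (by positivity) (by positivity)]
  have h1 : M * r * r ^ 2 ≤ (r ^ 2 + a ^ 2) ^ 2 := by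
    have : M * r ≤ r ^ 2 := by nlinarith
    have h2 : r ^ 2 ≤ r ^ 2 + a ^ 2 := by nlinarith [sq_nonneg a]
    rw [sq (r ^ 2 + a ^ 2)]
    exact mul_le_mul (this.trans h2) h2 (by positivity) hD.le
  have := mul_le_mul_of_nonneg_left h1 (show 0 ≤ 4 * |a * m| by positivity)
  linarith

theorem abs_potentialZero_le (ha : 0 < |a|) (haM : |a| < M) {r : ℝ} (hr : rPlus M a ≤ r) :
    |potentialZero M a m r| ≤ ((m : ℝ) ^ 2 + 2) / r ^ 2 := by
  have hM := rPlus_sub_mass_pos haM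
  have hpos := rPlus_pos haM
  have hr0 : 0 < r := by linarith
  have hM0 : 0 ≤ M := (abs_nonneg a).trans haM.le
  have hD := sq_add_sq_pos ha r
  have h1 := Delta_le haM hr0.le
  have h0 : 0 ≤ Delta M a r := by
    rcases hr.eq_or_lt with h | h
    · rw [← h, Delta_rPlus haM]
    · exact (Delta_pos haM h).le
  have ha2 : a ^ 2 < M ^ 2 := sq_lt_sq_mass haM
  have hMr : M ^ 2 ≤ r ^ 2 := by nlinarith
  have h2 : r ^ 2 ≤ r ^ 2 + a ^ 2 := by nlinarith [sq_nonneg a]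
  have hrr : 0 < r ^ 2 := by positivity
  unfold potentialZero
  set D := r ^ 2 + a ^ 2 with hDdef
  refine (abs_add_le _ _).trans ?_
  rw [add_div]
  refine add_le_add ?_ ?_
  · rw [abs_div, abs_neg, abs_of_nonneg (by positivity), abs_of_nonneg (by positivity),
      div_le_div_iff₀ (by positivity) (by positivity)]
    have : a ^ 2 * r ^ 2 ≤ D ^ 2 := by
      rw [sq D]
      exact mul_le_mul (by linarith) h2 hrr.le hD.le
    nlinarith [sq_nonneg (m : ℝ)]
  · have hb : |a ^ 2 * Delta M a r + 2 * M * r * (r ^ 2 - a ^ 2)| ≤ 2 * D ^ 2 := by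
      have e1 : 0 ≤ r ^ 2 - a ^ 2 := by linarith
      have e2 : M * r ≤ r ^ 2 := by nlinarith
      have e3 : 2 * M * r * (r ^ 2 - a ^ 2) ≤ 2 * r ^ 2 * D := by
        have := mul_le_mul e2 (show r ^ 2 - a ^ 2 ≤ D by nlinarith [sq_nonneg a]) e1 hrr.le
        linarith
      have e4 : a ^ 2 * Delta M a r ≤ a ^ 2 * D := mul_le_mul_of_nonneg_left h1 (sq_nonneg a)
      have e5 : 0 ≤ 2 * M * r * (r ^ 2 - a ^ 2) := by positivity
      have e6 : 0 ≤ a ^ 2 * Delta M a r := by positivity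
      rw [abs_of_nonneg (by linarith)]
      nlinarith [mul_nonneg (sq_nonneg a) hD.le]
    rw [abs_mul, abs_of_nonneg (show 0 ≤ Delta M a r / D ^ 4 by positivity)]
    calc Delta M a r / D ^ 4 * |a ^ 2 * Delta M a r + 2 * M * r * (r ^ 2 - a ^ 2)|
        ≤ D / D ^ 4 * (2 * D ^ 2) :=
          mul_le_mul (div_le_div_of_nonneg_right h1 (by positivity)) hb (abs_nonneg _)
            (by positivity)
      _ = 2 / D := by field_simp
      _ ≤ 2 / r ^ 2 := div_le_div_of_nonneg_left (by norm_num) hrr h2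

/-- A smooth function is Lipschitz near the horizon. -/
theorem exists_abs_sub_rPlus_le {f : ℝ → ℝ} (hf : ContDiff ℝ ((⊤ : ℕ∞) : WithTop ℕ∞) f)
    (M a : ℝ) : ∃ K : ℝ, 0 ≤ K ∧ ∀ r, rPlus M a ≤ r → r ≤ 2 * rPlus M a →
      |f r - f (rPlus M a)| ≤ K * (r - rPlus M a) := by
  have hd : Continuous (deriv f) := hf.continuous_deriv (by simp)
  obtain ⟨K, hK⟩ := (isCompact_Icc (a := rPlus M a)
    (b := 2 * rPlus M a)).exists_bound_of_continuousOn hd.continuousOn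
  refine ⟨max K 0, le_max_right _ _, fun r h1 h2 => ?_⟩
  have := (convex_Icc (rPlus M a) (2 * rPlus M a)).norm_image_sub_le_of_norm_deriv_le
    (f := f) (C := max K 0) (fun x _ => hf.differentiable (by simp) x)
    (fun x hx => (hK x hx).trans (le_max_left _ _)) ⟨le_rfl, h1.trans h2⟩ ⟨h1, h2⟩
  rwa [Real.norm_eq_abs, Real.norm_eq_abs, abs_of_nonneg (sub_nonneg.2 h1)] at this

theorem sq_add_sq_rPlus (haM : |a| < M) : rPlus M a ^ 2 + a ^ 2 = 2 * M * rPlus M a := by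
  have := Delta_rPlus haM
  unfold Delta at this
  linarith

/-- At the horizon the potential is `ω² - k²` with `k = ω - am / (2 M r₊)`. -/
theorem potential_rPlus (haM : |a| < M) (ω : ℂ) (m l : ℤ) :
    potential M a ω m l (rPlus M a)
      = ω ^ 2 - (ω - a * m / (2 * M * rPlus M a)) ^ 2 := by
  have hM : 0 < M := (abs_nonneg a).trans_lt haM
  have hp := rPlus_pos haM
  have h1 : (M : ℂ) ≠ 0 := Complex.ofReal_ne_zero.2 hM.ne'
  have h2 : (rPlus M a : ℂ) ≠ 0 := Complex.ofReal_ne_zero.2 hp.ne'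
  have h3 : (rPlus M a : ℂ) ^ 2 + (a : ℂ) ^ 2 = 2 * M * rPlus M a := by
    exact_mod_cast sq_add_sq_rPlus haM
  unfold potential
  rw [Delta_rPlus haM, h3]
  field_simp
  push_cast
  ring

end Kerr

end

noncomputable section

/-! ### Modes as zeros of a Wronskian -/

namespace Kerr

open Filter Topology Set MeasureTheory
open scoped ComplexConjugate

/-- A family of equations `u'' = C(p) u` whose coefficients tend to `-κOut(p)²` at `+∞` and to
`-κHor(p)²` at `-∞` at the rate `x⁻²`, with a constant `A` independent of `p`. The lower bound `k`
keeps `κOut` and `κHor` away from `0`. -/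
structure RadialFamily (P : Type*) [TopologicalSpace P] where
  κOut : P → ℂ
  κHor : P → ℂ
  C : P → ℝ → ℂ
  k : ℝ
  A : ℝ
  continuous_κOut : Continuous κOut
  continuous_κHor : Continuous κHor
  im_κOut : ∀ p, 0 ≤ (κOut p).im
  im_κHor : ∀ p, 0 ≤ (κHor p).im
  k_pos : 0 < k
  k_le_out : ∀ p, k ≤ ‖κOut p‖
  k_le_hor : ∀ p, k ≤ ‖κHor p‖
  continuous_C : Continuous (Function.uncurry C)
  A_nonneg : 0 ≤ A
  bound_out : ∀ p x, ‖C p x + κOut p ^ 2‖ ≤ A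
  decay_out : ∀ p x, 0 ≤ x → ‖C p x + κOut p ^ 2‖ ≤ A / (1 + x ^ 2)
  bound_hor : ∀ p x, ‖C p x + κHor p ^ 2‖ ≤ A
  decay_hor : ∀ p x, x ≤ 0 → ‖C p x + κHor p ^ 2‖ ≤ A / (1 + x ^ 2)

namespace RadialFamily

variable {P : Type*} [TopologicalSpace P] (D : RadialFamily P)

theorem continuous_C_right (p : P) : Continuous (D.C p) :=
  D.continuous_C.comp (continuous_const.prodMk continuous_id)

theorem continuous_right : Continuous (Function.uncurry fun p x => D.C p x + D.κOut p ^ 2) := by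
  have h1 := D.continuous_C
  have h2 : Continuous fun y : P × ℝ => D.κOut y.1 := D.continuous_κOut.comp continuous_fst
  exact h1.fun_add (h2.fun_pow 2)

theorem continuous_left : Continuous (Function.uncurry fun p x => D.C p (-x) + D.κHor p ^ 2) := by
  have h1 : Continuous fun y : P × ℝ => D.C y.1 (-y.2) :=
    D.continuous_C.comp (continuous_fst.prodMk continuous_snd.neg)
  have h2 : Continuous fun y : P × ℝ => D.κHor y.1 := D.continuous_κHor.comp continuous_fst
  exact h1.fun_add (h2.fun_pow 2)

/-- The Jost data at `+∞`. -/
def rightData : JostData P :=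
  JostData.ofBound D.κOut (fun p x => D.C p x + D.κOut p ^ 2) D.k D.A D.continuous_κOut D.im_κOut D.k_pos
    D.k_le_out D.continuous_right D.A_nonneg D.bound_out
    D.decay_out

/-- The Jost data at `-∞`, reflected to `+∞`. -/
def leftData : JostData P :=
  JostData.ofBound D.κHor (fun p x => D.C p (-x) + D.κHor p ^ 2) D.k D.A D.continuous_κHor D.im_κHor D.k_pos
    D.k_le_hor D.continuous_left D.A_nonneg
    (fun p x => D.bound_hor p (-x)) (fun p x hx => by simpa using D.decay_hor p (-x) (by linarith))

variable [FirstCountableTopology P] [Nonempty P]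

/-- The outgoing solution. -/
def out (p : P) (x : ℝ) : ℂ := D.rightData.jost p x

/-- The derivative of the outgoing solution. -/
def outDeriv (p : P) (x : ℝ) : ℂ := D.rightData.jostDeriv p x

/-- The solution satisfying the condition at the horizon `-∞`. -/
def hor (p : P) (x : ℝ) : ℂ := D.leftData.jost p (-x)

/-- The derivative of the horizon solution. -/
def horDeriv (p : P) (x : ℝ) : ℂ := -D.leftData.jostDeriv p (-x)

theorem solvesODE_out (p : P) : SolvesODE (D.C p) (D.out p) (D.outDeriv p) :=
  (D.rightData.solvesODE_jost p).congr_coeff fun x => by simp [rightData, JostData.ofBound]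

theorem solvesODE_hor (p : P) : SolvesODE (D.C p) (D.hor p) (D.horDeriv p) :=
  (D.leftData.solvesODE_jost p).comp_neg.congr_coeff fun x => by simp [leftData, JostData.ofBound]

theorem tendsto_out (p : P) :
    Tendsto (fun x : ℝ => Complex.exp (-(Complex.I * D.κOut p * x)) * D.out p x) atTop (𝓝 1) :=
  D.rightData.tendsto_exp_mul_jost p

theorem tendsto_outDeriv_sub (p : P) :
    Tendsto (fun x : ℝ => Complex.exp (-(Complex.I * D.κOut p * x))
      * (D.outDeriv p x - Complex.I * D.κOut p * D.out p x)) atTop (𝓝 0) :=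
  D.rightData.tendsto_exp_mul_jostDeriv_sub p

theorem tendsto_hor (p : P) :
    Tendsto (fun x : ℝ => Complex.exp (Complex.I * D.κHor p * x) * D.hor p x) atBot (𝓝 1) := by
  refine ((D.leftData.tendsto_exp_mul_jost p).comp tendsto_neg_atBot_atTop).congr fun x => ?_
  simp [hor, leftData, JostData.ofBound]

theorem tendsto_horDeriv_add (p : P) :
    Tendsto (fun x : ℝ => Complex.exp (Complex.I * D.κHor p * x)
      * (D.horDeriv p x + Complex.I * D.κHor p * D.hor p x)) atBot (𝓝 0) := by
  have h := ((D.leftData.tendsto_exp_mul_jostDeriv_sub p).comp tendsto_neg_atBot_atTop).neg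
  rw [neg_zero] at h
  refine h.congr fun x => ?_
  simp [hor, horDeriv, leftData, JostData.ofBound]
  ring

theorem continuous_out : Continuous (Function.uncurry D.out) := D.rightData.continuous_jost

theorem continuous_hor : Continuous (Function.uncurry D.hor) :=
  D.leftData.continuous_jost.comp (continuous_fst.prodMk continuous_snd.neg)

theorem exists_out_ne_zero (p : P) : ∃ x, D.out p x ≠ 0 := by
  by_contra! h
  have := D.tendsto_out p
  simp only [h, mul_zero] at this
  exact one_ne_zero (tendsto_nhds_unique this tendsto_const_nhds)

theorem exists_hor_ne_zero (p : P) : ∃ x, D.hor p x ≠ 0 := by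
  by_contra! h
  have := D.tendsto_hor p
  simp only [h, mul_zero] at this
  exact one_ne_zero (tendsto_nhds_unique this tendsto_const_nhds)

/-- The Wronskian of the horizon solution and the outgoing solution. Its zeros are the modes. -/
def modeFunction (p : P) : ℂ := wronskian (D.hor p) (D.horDeriv p) (D.out p) (D.outDeriv p) 0

theorem continuous_modeFunction : Continuous D.modeFunction := by
  unfold modeFunction wronskian out outDeriv hor horDeriv
  exact ((D.leftData.continuous_jost_left _).mul (D.rightData.continuous_jostDeriv _)).sub
    ((D.leftData.continuous_jostDeriv _).neg.mul (D.rightData.continuous_jost_left _))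

/-- A zero of the Wronskian gives a solution with both asymptotic conditions. -/
theorem exists_mode {p : P} (hp : D.modeFunction p = 0) :
    ∃ u u₁ : ℝ → ℂ, SolvesODE (D.C p) u u₁ ∧ (∃ x, u x ≠ 0) ∧
      Tendsto (fun x : ℝ => Complex.exp (-(Complex.I * D.κOut p * x))
        * (u₁ x - Complex.I * D.κOut p * u x)) atTop (𝓝 0) ∧
      Tendsto (fun x : ℝ => Complex.exp (Complex.I * D.κHor p * x)
        * (u₁ x + Complex.I * D.κHor p * u x)) atBot (𝓝 0) := by
  obtain ⟨x₀, hx₀⟩ := D.exists_out_ne_zero p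
  obtain ⟨c, hc, hc₁⟩ := (D.solvesODE_hor p).eq_const_mul (D.solvesODE_out p)
    (D.continuous_C_right p) hx₀
    (by rw [(D.solvesODE_hor p).wronskian_eq (D.solvesODE_out p) x₀ 0]; exact hp)
  refine ⟨D.hor p, D.horDeriv p, D.solvesODE_hor p, D.exists_hor_ne_zero p, ?_,
    D.tendsto_horDeriv_add p⟩
  have h := (D.tendsto_outDeriv_sub p).const_mul c
  rw [mul_zero] at h
  refine h.congr fun x => ?_
  rw [hc, hc₁]; ring

/-- Variation of the mode function under a change of the coefficient on a compact interval. -/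
theorem modeFunction_sub {p p' : P} {x₀ x₁ : ℝ} (h_out : D.κOut p = D.κOut p') (h_hor : D.κHor p = D.κHor p')
    (hl : ∀ x, x ≤ x₀ → D.C p x = D.C p' x) (hr : ∀ x, x₁ ≤ x → D.C p x = D.C p' x) :
    D.modeFunction p - D.modeFunction p'
      = ∫ x in x₀..x₁, (D.C p' x - D.C p x) * (D.hor p x * D.out p' x) := by
  have hd := fun x => (D.solvesODE_hor p).hasDerivAt_wronskian (D.solvesODE_out p') x
  have hi : IntervalIntegrable (fun x => (D.C p' x - D.C p x) * (D.hor p x * D.out p' x))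
      volume x₀ x₁ :=
    (((D.continuous_C_right p').sub (D.continuous_C_right p)).mul
      ((D.solvesODE_hor p).continuous.mul (D.solvesODE_out p').continuous)).intervalIntegrable _ _
  rw [intervalIntegral.integral_eq_sub_of_hasDerivAt (fun x _ => hd x) hi]
  have e1 := D.rightData.jost_eq_of_eqOn (p := p) (p' := p') (x₀ := x₁) h_out
    (fun t ht => by simp only [rightData, JostData.ofBound, hr t ht, h_out]) le_rfl
  have e0 := D.leftData.jost_eq_of_eqOn (p := p) (p' := p') (x₀ := -x₀) h_hor
    (fun t ht => by simp only [leftData, JostData.ofBound, hl (-t) (by linarith), h_hor]) le_rfl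
  congr 1
  · rw [modeFunction, (D.solvesODE_hor p).wronskian_eq (D.solvesODE_out p) 0 x₁]
    simp only [wronskian, out, outDeriv, e1.1, e1.2]
  · rw [modeFunction, (D.solvesODE_hor p').wronskian_eq (D.solvesODE_out p') 0 x₀]
    simp only [wronskian, hor, horDeriv, e0.1, e0.2]

theorem norm_exp_I_mul_real (κ x : ℝ) : ‖Complex.exp (Complex.I * κ * x)‖ = 1 := by
  rw [Complex.norm_exp]; simp

/-- For real frequencies, every mode is a multiple of the horizon and of the outgoing solution. -/
theorem exists_const_mul_of_mode {p : P} {ω k : ℝ} (hω : D.κOut p = ω) (hk : D.κHor p = k)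
    {U U₁ : ℝ → ℂ} (hU : SolvesODE (D.C p) U U₁) (hU0 : ∃ x, U x ≠ 0) {N : ℝ}
    (bt : ∀ᶠ x in atTop, ‖U x‖ ≤ N) (bb : ∀ᶠ x in atBot, ‖U x‖ ≤ N)
    (ht : Tendsto (fun x => U₁ x - Complex.I * ω * U x) atTop (𝓝 0))
    (hb : Tendsto (fun x => U₁ x + Complex.I * k * U x) atBot (𝓝 0)) :
    ∃ α β : ℂ, α ≠ 0 ∧ β ≠ 0 ∧ (∀ x, D.hor p x = α * U x) ∧ ∀ x, D.out p x = β * U x := by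
  obtain ⟨x₀, hx₀⟩ := hU0
  have n1 : ∀ x : ℝ, ‖Complex.exp (-(Complex.I * ω * x))‖ = 1 := fun x => by
    have := norm_exp_I_mul_real ω (-x)
    rw [Complex.ofReal_neg, mul_neg] at this
    exact this
  have wo : wronskian (D.out p) (D.outDeriv p) U U₁ x₀ = 0 := by
    have t1 := D.tendsto_out p
    have t2 := D.tendsto_outDeriv_sub p
    rw [hω] at t1 t2
    refine (D.solvesODE_out p).wronskian_eq_zero_of_outgoing (N := max N 2) hU ?_ ?_
      (κ := Complex.I * ω) ?_ ht x₀
    · filter_upwards [t1.norm.eventually (Iio_mem_nhds (show ‖(1 : ℂ)‖ < 2 by simp))] with x hx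
      rw [norm_mul, n1, one_mul] at hx
      exact (le_of_lt hx).trans (le_max_right _ _)
    · exact bt.mono fun x hx => hx.trans (le_max_left _ _)
    · rw [tendsto_zero_iff_norm_tendsto_zero] at t2 ⊢
      refine t2.congr fun x => ?_
      rw [norm_mul, n1, one_mul]
  have wh : wronskian (D.hor p) (D.horDeriv p) U U₁ x₀ = 0 := by
    have t1 := (D.tendsto_hor p).comp tendsto_neg_atTop_atBot
    have t2 := ((D.tendsto_horDeriv_add p).comp tendsto_neg_atTop_atBot).neg
    have hb' := (hb.comp tendsto_neg_atTop_atBot).neg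
    rw [hk, neg_zero] at t2
    rw [hk] at t1
    rw [neg_zero] at hb'
    have h := (D.solvesODE_hor p).comp_neg.wronskian_eq_zero_of_outgoing (N := max N 2) hU.comp_neg
      (κ := Complex.I * k) ?_ ?_ ?_ ?_ (-x₀)
    · simp only [wronskian, neg_neg] at h ⊢
      linear_combination -h
    · filter_upwards [t1.norm.eventually (Iio_mem_nhds (show ‖(1 : ℂ)‖ < 2 by simp))] with x hx
      simp only [Function.comp_apply, norm_mul, norm_exp_I_mul_real, one_mul] at hx
      exact (le_of_lt hx).trans (le_max_right _ _)
    · exact (tendsto_neg_atTop_atBot.eventually bb).mono fun x hx => hx.trans (le_max_left _ _)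
    · rw [tendsto_zero_iff_norm_tendsto_zero] at t2 ⊢
      refine t2.congr fun x => ?_
      simp only [Function.comp_apply, norm_neg, norm_mul, norm_exp_I_mul_real, one_mul]
      rw [← norm_neg]; congr 1; ring
    · refine hb'.congr fun x => ?_
      simp only [Function.comp_apply]; ring
  obtain ⟨α, hα, -⟩ := (D.solvesODE_hor p).eq_const_mul hU (D.continuous_C_right p) hx₀ wh
  obtain ⟨β, hβ, -⟩ := (D.solvesODE_out p).eq_const_mul hU (D.continuous_C_right p) hx₀ wo
  refine ⟨α, β, ?_, ?_, hα, hβ⟩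
  · rintro rfl
    obtain ⟨x, hx⟩ := D.exists_hor_ne_zero p
    exact hx (by rw [hα, zero_mul])
  · rintro rfl
    obtain ⟨x, hx⟩ := D.exists_out_ne_zero p
    exact hx (by rw [hβ, zero_mul])

end RadialFamily

end Kerr

end

noncomputable section

/-! ### Persistence of modes under a tuned barrier -/

namespace Kerr

open Filter Topology Set MeasureTheory
open scoped ComplexConjugate

/-- Truncation to `[-1/2, 1/2]`. -/
def clampHalf (y : ℝ) : ℝ := max (-(1 / 2)) (min y (1 / 2))

theorem clampHalf_mem (y : ℝ) : -(1 / 2) ≤ clampHalf y ∧ clampHalf y ≤ 1 / 2 :=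
  ⟨le_max_left _ _, max_le (by norm_num) (min_le_right _ _)⟩

theorem clampHalf_eq {y : ℝ} (hy : |y| ≤ 1 / 2) : clampHalf y = y := by
  obtain ⟨h1, h2⟩ := abs_le.1 hy
  unfold clampHalf
  rw [min_eq_left h2, max_eq_right h1]

theorem continuous_clampHalf : Continuous clampHalf := by
  unfold clampHalf; fun_prop

/-- The barrier `V₀ (1 + Re (p̄ E))` with a complex parameter `p`. The second factor is truncated to
`[1/2, 3/2]`, which keeps the barrier nonnegative for all `p` and has no effect for small `p`. -/
def tunedBarrier (V₀ : ℝ → ℝ) (E : ℝ → ℂ) (p : ℂ) (x : ℝ) : ℝ :=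
  V₀ x * (1 + clampHalf (conj p * E x).re)

theorem tunedBarrier_zero (V₀ : ℝ → ℝ) (E : ℝ → ℂ) (x : ℝ) : tunedBarrier V₀ E 0 x = V₀ x := by
  simp [tunedBarrier, clampHalf_eq]

theorem tunedBarrier_nonneg {V₀ : ℝ → ℝ} (h : ∀ x, 0 ≤ V₀ x) (E : ℝ → ℂ) (p : ℂ) (x : ℝ) :
    0 ≤ tunedBarrier V₀ E p x :=
  mul_nonneg (h x) (by linarith [(clampHalf_mem (conj p * E x).re).1])

theorem tunedBarrier_le {V₀ : ℝ → ℝ} (h : ∀ x, 0 ≤ V₀ x) (E : ℝ → ℂ) (p : ℂ) (x : ℝ) :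
    tunedBarrier V₀ E p x ≤ 3 / 2 * V₀ x := by
  unfold tunedBarrier
  nlinarith [h x, (clampHalf_mem (conj p * E x).re).2]

/-- The linear map `p ↦ p.re c₁ + p.im c₂`. -/
def reImMap (c₁ c₂ : ℂ) : ℂ →L[ℝ] ℂ := Complex.reCLM.smulRight c₁ + Complex.imCLM.smulRight c₂

theorem conj_mul_re (p E : ℂ) : (conj p * E).re = p.re * E.re + p.im * E.im := by simp

theorem reImMap_integral {V₀ : ℝ → ℝ} {E : ℝ → ℂ} (hV₀ : Continuous V₀) (hE : Continuous E)
    (γ : ℂ) (x₀ x₁ : ℝ) (p : ℂ) :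
    reImMap (-γ * ∫ x in x₀..x₁, ((V₀ x * (E x).re : ℝ) : ℂ) * E x)
      (-γ * ∫ x in x₀..x₁, ((V₀ x * (E x).im : ℝ) : ℂ) * E x) p
      = ∫ x in x₀..x₁, -((V₀ x * (conj p * E x).re : ℝ) : ℂ) * (γ * E x) := by
  have h1 : Continuous fun x => ((V₀ x * (E x).re : ℝ) : ℂ) * E x := by fun_prop
  have h2 : Continuous fun x => ((V₀ x * (E x).im : ℝ) : ℂ) * E x := by fun_prop
  simp only [reImMap, add_apply, ContinuousLinearMap.smulRight_apply,
    Complex.reCLM_apply, Complex.imCLM_apply, Complex.real_smul]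
  rw [← intervalIntegral.integral_const_mul, ← intervalIntegral.integral_const_mul,
    ← intervalIntegral.integral_const_mul, ← intervalIntegral.integral_const_mul,
    ← intervalIntegral.integral_add]
  · refine intervalIntegral.integral_congr fun x _ => ?_
    simp only [conj_mul_re]
    push_cast
    ring
  · exact Continuous.intervalIntegrable (by fun_prop) _ _
  · exact Continuous.intervalIntegrable (by fun_prop) _ _

/-- The derivative of the mode function with respect to the barrier is injective: its quadratic form
is `∫ V₀ (Re (p̄ U²))²`, and `Re (p̄ U²)` cannot vanish on an interval for a solution `U` of nonzero
flux. -/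
theorem injective_reImMap {V₀ : ℝ → ℝ} {q U U₁ : ℝ → ℂ} (hV₀ : Continuous V₀)
    (hV₀0 : ∀ x, 0 ≤ V₀ x) (hU : SolvesODE q U U₁) (hfl : ∀ x, flux U U₁ x ≠ 0)
    {γ : ℂ} (hγ : γ ≠ 0) {x₀ x₁ : ℝ} (hx : x₀ < x₁) (hV : ∃ x ∈ Icc x₀ x₁, V₀ x ≠ 0) {p : ℂ}
    (hp : reImMap (-γ * ∫ x in x₀..x₁, ((V₀ x * (U x ^ 2).re : ℝ) : ℂ) * U x ^ 2)
      (-γ * ∫ x in x₀..x₁, ((V₀ x * (U x ^ 2).im : ℝ) : ℂ) * U x ^ 2) p = 0) : p = 0 := by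
  have hUc := hU.continuous
  have hE : Continuous fun x => U x ^ 2 := by fun_prop
  rw [reImMap_integral hV₀ hE] at hp
  have h0 : ∫ x in x₀..x₁, ((V₀ x * (conj p * U x ^ 2).re : ℝ) : ℂ) * (conj p * U x ^ 2) = 0 := by
    have e : ∀ x, -((V₀ x * (conj p * U x ^ 2).re : ℝ) : ℂ) * (γ * U x ^ 2)
        = -γ * (((V₀ x * (conj p * U x ^ 2).re : ℝ) : ℂ) * U x ^ 2) := fun x => by ring
    have e' : ∀ x, ((V₀ x * (conj p * U x ^ 2).re : ℝ) : ℂ) * (conj p * U x ^ 2)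
        = conj p * (((V₀ x * (conj p * U x ^ 2).re : ℝ) : ℂ) * U x ^ 2) := fun x => by ring
    simp only [e, intervalIntegral.integral_const_mul] at hp
    simp only [e', intervalIntegral.integral_const_mul]
    rw [(mul_eq_zero.1 hp).resolve_left (neg_ne_zero.2 hγ), mul_zero]
  have h1 : ∫ x in x₀..x₁, V₀ x * (conj p * U x ^ 2).re ^ 2 = 0 := by
    have hc : Continuous fun x => ((V₀ x * (conj p * U x ^ 2).re : ℝ) : ℂ) * (conj p * U x ^ 2) := by
      fun_prop
    have := congrArg Complex.reCLM h0
    rw [← ContinuousLinearMap.intervalIntegral_comp_comm _ (hc.intervalIntegrable _ _), map_zero]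
      at this
    rw [← this]
    refine intervalIntegral.integral_congr fun x _ => ?_
    simp only [Complex.reCLM_apply, Complex.re_ofReal_mul]
    ring
  have hc2 : Continuous fun x => V₀ x * (conj p * U x ^ 2).re ^ 2 := by fun_prop
  have h2 : ∀ x ∈ Icc x₀ x₁, V₀ x * (conj p * U x ^ 2).re ^ 2 = 0 := by
    by_contra! hne
    obtain ⟨c, hc, hcne⟩ := hne
    have hpos : 0 < V₀ c * (conj p * U c ^ 2).re ^ 2 :=
      lt_of_le_of_ne (mul_nonneg (hV₀0 c) (sq_nonneg _)) hcne.symm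
    have := intervalIntegral.integral_pos hx hc2.continuousOn
      (fun x _ => mul_nonneg (hV₀0 x) (sq_nonneg _)) ⟨c, hc, hpos⟩
    linarith
  -- an interior point where the barrier does not vanish
  obtain ⟨y, hy, hVy⟩ : ∃ y ∈ Ioo x₀ x₁, V₀ y ≠ 0 := by
    by_contra! hall
    obtain ⟨x, hxm, hVx⟩ := hV
    have hcl : closure (Ioo x₀ x₁) ⊆ {x | V₀ x = 0} :=
      closure_minimal (fun y hy => hall y hy) (isClosed_eq hV₀ continuous_const)
    rw [closure_Ioo hx.ne] at hcl
    exact hVx (hcl hxm)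
  have hev : (fun x => (conj p * U x ^ 2).re) =ᶠ[𝓝 y] fun _ => 0 := by
    filter_upwards [Ioo_mem_nhds hy.1 hy.2, hV₀.continuousAt.eventually_ne hVy] with x hx1 hx2
    have := (mul_eq_zero.1 (h2 x ⟨hx1.1.le, hx1.2.le⟩)).resolve_left hx2
    exact pow_eq_zero_iff two_ne_zero |>.1 this
  have d0 : (conj p * U y ^ 2).re = 0 := hev.eq_of_nhds
  have d1 : (conj p * (2 * U y * U₁ y)).re = 0 := by
    have hd := hasDerivAt_re (((hU y).1.fun_pow 2).const_mul (conj p))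
    have hd' := (hasDerivAt_const y (0 : ℝ)).congr_of_eventuallyEq hev
    have := hd.unique hd'
    rw [← this]
    congr 1
    push_cast; ring
  -- `z = p̄ U` is orthogonal to the real-linearly independent vectors `Ū` and `Ū'`
  set z := conj p * U y with hz
  have a1 : z.re * (U y).re - z.im * (U y).im = 0 := by
    rw [← Complex.mul_re, hz, ← d0]; congr 1; ring
  have a2 : z.re * (U₁ y).re - z.im * (U₁ y).im = 0 := by
    have : (2 * (z * U₁ y)).re = 0 := by rw [← d1, hz]; congr 1; ring
    rw [← Complex.mul_re]
    simpa using this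
  have hf := hfl y
  simp only [flux, Complex.mul_im, Complex.conj_re, Complex.conj_im] at hf
  have b1 : z.re = 0 := by
    refine (mul_eq_zero.1 (?_ : z.re * ((U y).re * (U₁ y).im + -(U y).im * (U₁ y).re) = 0)).resolve_right hf
    linear_combination (U₁ y).im * a1 - (U y).im * a2
  have b2 : z.im = 0 := by
    refine (mul_eq_zero.1 (?_ : z.im * ((U y).re * (U₁ y).im + -(U y).im * (U₁ y).re) = 0)).resolve_right hf
    linear_combination (U₁ y).re * a1 - (U y).re * a2
  have hz0 : z = 0 := Complex.ext b1 b2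
  have hUy : U y ≠ 0 := fun h => hf (by simp [h])
  have := (mul_eq_zero.1 hz0).resolve_right hUy
  simpa using this

/-- Persistence of a mode. The frequency parameter `t` near `t₀` perturbs an equation that has a
mode at `t₀` with barrier `V₀`; the parameter `p` of the barrier can be chosen such that there is a
mode for `t`. The proof is a uniform version of the inverse function theorem for the mode
function. -/
theorem eventually_exists_modeFunction_eq_zero {T : Type*} [TopologicalSpace T]
    [FirstCountableTopology T] [Nonempty T] (D : RadialFamily (ℂ × T)) {t₀ : T} {N : T → ℝ → ℂ}
    {G : T → ℝ → ℝ → ℂ} {V₀ : ℝ → ℝ} {q U U₁ : ℝ → ℂ} {x₀ x₁ : ℝ} {α β : ℂ}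
    (hκOut : ∀ p t, D.κOut (p, t) = D.κOut (0, t)) (hκHor : ∀ p t, D.κHor (p, t) = D.κHor (0, t))
    (hC : ∀ p t x, D.C (p, t) x = N t x + (tunedBarrier V₀ (fun x => U x ^ 2) p x : ℂ)
      - G t (tunedBarrier V₀ (fun x => U x ^ 2) p x) x)
    (hG : ∀ R ε : ℝ, 0 < ε → ∀ᶠ t in 𝓝 t₀, ∀ x ∈ Icc x₀ x₁, ∀ v ∈ Icc 0 R, ∀ v' ∈ Icc 0 R,
      ‖G t v x - G t v' x‖ ≤ ε * |v - v'|)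
    (hV₀ : Continuous V₀) (hV₀0 : ∀ x, 0 ≤ V₀ x) (hV₀s : ∀ x, V₀ x ≠ 0 → x ∈ Icc x₀ x₁)
    (hV₀n : ∃ x, V₀ x ≠ 0) (hx : x₀ < x₁) (hU : SolvesODE q U U₁)
    (hfl : ∀ x, flux U U₁ x ≠ 0) (hα : α ≠ 0) (hβ : β ≠ 0)
    (hhor : ∀ x, D.hor (0, t₀) x = α * U x) (hout : ∀ x, D.out (0, t₀) x = β * U x)
    {ρ₀ : ℝ} (hρ₀ : 0 < ρ₀) :
    ∀ᶠ t in 𝓝 t₀, ∃ p : ℂ, ‖p‖ ≤ ρ₀ ∧ D.modeFunction (p, t) = 0 := by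
  have hUc := hU.continuous
  set E : ℝ → ℂ := fun x => U x ^ 2 with hE
  have hEc : Continuous E := by fun_prop
  set γ := α * β with hγ
  have hγ0 : γ ≠ 0 := mul_ne_zero hα hβ
  set L : ℂ →L[ℝ] ℂ := reImMap (-γ * ∫ x in x₀..x₁, ((V₀ x * (E x).re : ℝ) : ℂ) * E x)
      (-γ * ∫ x in x₀..x₁, ((V₀ x * (E x).im : ℝ) : ℂ) * E x) with hL
  have hLp : ∀ p, L p = ∫ x in x₀..x₁, -((V₀ x * (conj p * E x).re : ℝ) : ℂ) * (γ * E x) :=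
    fun p => reImMap_integral hV₀ hEc γ x₀ x₁ p
  have hinj : Function.Injective L := (injective_iff_map_eq_zero L).2 fun p hp =>
    injective_reImMap hV₀ hV₀0 hU hfl hγ0 hx
      (hV₀n.imp fun x h => ⟨hV₀s x h, h⟩) hp
  set Le : ℂ ≃L[ℝ] ℂ := (LinearEquiv.ofInjectiveEndo L.toLinearMap hinj).toContinuousLinearEquiv
    with hLe
  have hLeL : (Le : ℂ →L[ℝ] ℂ) = L := by ext; rfl
  set ν := Le.toNonlinearRightInverse.nnnorm with hν
  have hνpos : 0 < ν := by
    have : Le.symm.toContinuousLinearMap ≠ 0 := by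
      intro h
      have h1 : Le.symm 1 = 0 := by
        exact congrArg (fun f : ℂ →L[ℝ] ℂ => f 1) h
      have h2 := Le.apply_symm_apply 1
      rw [h1, map_zero] at h2
      exact zero_ne_one h2
    exact nnnorm_pos.2 this
  -- the mode function is approximated by `Le` up to an error of Lipschitz constant `c`
  set c : NNReal := ν⁻¹ / 2 with hc
  have hc0 : 0 < c := by positivity
  -- bounds on the support of the barrier
  obtain ⟨Emax, hEmax⟩ := (isCompact_Icc (a := x₀) (b := x₁)).exists_bound_of_continuousOn
    hEc.continuousOn
  obtain ⟨Vmax, hVmax⟩ := (isCompact_Icc (a := x₀) (b := x₁)).exists_bound_of_continuousOn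
    hV₀.continuousOn
  have hEm0 : 0 ≤ Emax := (norm_nonneg _).trans (hEmax x₀ ⟨le_rfl, hx.le⟩)
  have hVm0 : 0 ≤ Vmax := (norm_nonneg _).trans (hVmax x₀ ⟨le_rfl, hx.le⟩)
  set K := Vmax * Emax with hK
  have hK0 : 0 ≤ K := mul_nonneg hVm0 hEm0
  set K' := ‖γ‖ * Emax with hK'
  have hK'0 : 0 ≤ K' := mul_nonneg (norm_nonneg _) hEm0
  have hlen : 0 < x₁ - x₀ := sub_pos.2 hx
  -- `η` and `ε` are such that the contributions of the change of the solutions and of `G` to the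
  -- increments of the mode function are at most `c / 2` each
  set η : ℝ := min 1 (c / (2 * (K + 1) * (x₁ - x₀))) with hη
  have hη0 : 0 < η := lt_min one_pos (by positivity)
  set ε : ℝ := c / (2 * (K + 1) * (K' + 1) * (x₁ - x₀)) with hε
  have hε0 : 0 < ε := by positivity
  -- uniform closeness of the solutions
  have hunif : ∀ᶠ y : (ℂ × ℂ) × T in 𝓝 ((0, 0), t₀), ∀ x ∈ Icc x₀ x₁,
      ‖D.hor (y.1.1, y.2) x * D.out (y.1.2, y.2) x - γ * E x‖ < η := by
    refine isCompact_Icc.eventually_forall_of_forall_eventually fun x _ => ?_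
    have hcont : Continuous fun w : ((ℂ × ℂ) × T) × ℝ =>
        ‖D.hor (w.1.1.1, w.1.2) w.2 * D.out (w.1.1.2, w.1.2) w.2 - γ * E w.2‖ := by
      have h1 : Continuous fun w : ((ℂ × ℂ) × T) × ℝ => D.hor (w.1.1.1, w.1.2) w.2 :=
        D.continuous_hor.comp (f := fun w : ((ℂ × ℂ) × T) × ℝ => ((w.1.1.1, w.1.2), w.2))
          (by fun_prop)
      have h2 : Continuous fun w : ((ℂ × ℂ) × T) × ℝ => D.out (w.1.1.2, w.1.2) w.2 :=
        D.continuous_out.comp (f := fun w : ((ℂ × ℂ) × T) × ℝ => ((w.1.1.2, w.1.2), w.2))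
          (by fun_prop)
      fun_prop
    refine hcont.continuousAt.eventually (Iio_mem_nhds ?_)
    simp only [hhor, hout]
    have : α * U x * (β * U x) - γ * E x = 0 := by simp only [hγ, hE]; ring
    rw [this, norm_zero]
    exact hη0
  rw [nhds_prod_eq, nhds_prod_eq] at hunif
  obtain ⟨P1, hP1, P2, hP2, hunif⟩ := eventually_prod_iff.1 hunif
  obtain ⟨Q1, hQ1, Q2, hQ2, hP1⟩ := eventually_prod_iff.1 hP1
  obtain ⟨ρ₁, hρ₁, hball⟩ := Metric.eventually_nhds_iff.1 (hQ1.and hQ2)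
  set ρ := min (ρ₁ / 2) (min ρ₀ (1 / (2 * (Emax + 1)))) with hρ
  have hρpos : 0 < ρ := by
    refine lt_min (by linarith) (lt_min hρ₀ (by positivity))
  have hρ1 : ρ < ρ₁ := (min_le_left _ _).trans_lt (by linarith)
  have hρ2 : ρ ≤ 1 / (2 * (Emax + 1)) := (min_le_right _ _).trans (min_le_right _ _)
  -- small parameters are not affected by the truncation
  have hclamp : ∀ p : ℂ, ‖p‖ ≤ ρ → ∀ x ∈ Icc x₀ x₁, tunedBarrier V₀ E p x
      = V₀ x * (1 + (conj p * E x).re) := by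
    intro p hp x hxm
    unfold tunedBarrier
    rw [clampHalf_eq]
    refine (Complex.abs_re_le_norm _).trans ?_
    rw [norm_mul, RCLike.norm_conj]
    have h1 : ‖p‖ * ‖E x‖ ≤ 1 / (2 * (Emax + 1)) * (Emax + 1) :=
      mul_le_mul (hp.trans hρ2) ((hEmax x hxm).trans (by linarith)) (norm_nonneg _) (by positivity)
    refine h1.trans (le_of_eq ?_)
    field_simp
  have hdiff : ∀ p p' : ℂ, ‖p‖ ≤ ρ → ‖p'‖ ≤ ρ → ∀ x ∈ Icc x₀ x₁,
      tunedBarrier V₀ E p x - tunedBarrier V₀ E p' x = V₀ x * (conj (p - p') * E x).re := by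
    intro p p' hp hp' x hxm
    rw [hclamp p hp x hxm, hclamp p' hp' x hxm, map_sub, sub_mul, Complex.sub_re]; ring
  have hdiff' : ∀ p p' : ℂ, ∀ x ∈ Icc x₀ x₁, |V₀ x * (conj (p - p') * E x).re| ≤ K * ‖p - p'‖ := by
    intro p p' x hxm
    rw [abs_mul]
    have h1 : |(conj (p - p') * E x).re| ≤ ‖p - p'‖ * Emax := by
      refine (Complex.abs_re_le_norm _).trans ?_
      rw [norm_mul, RCLike.norm_conj]
      exact mul_le_mul_of_nonneg_left (hEmax x hxm) (norm_nonneg _)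
    calc |V₀ x| * |(conj (p - p') * E x).re| ≤ Vmax * (‖p - p'‖ * Emax) :=
          mul_le_mul (hVmax x hxm) h1 (abs_nonneg _) hVm0
      _ = K * ‖p - p'‖ := by rw [hK]; ring
  have hmode0 : D.modeFunction (0, t₀) = 0 := by
    have e1 : D.hor (0, t₀) = fun x => α * U x := funext hhor
    have e2 : D.out (0, t₀) = fun x => β * U x := funext hout
    have f1 := (D.solvesODE_hor (0, t₀) 0).1
    have f2 := (D.solvesODE_out (0, t₀) 0).1
    rw [e1] at f1
    rw [e2] at f2
    have g1 := f1.unique ((hU 0).1.const_mul α)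
    have g2 := f2.unique ((hU 0).1.const_mul β)
    unfold RadialFamily.modeFunction wronskian
    rw [hhor, hout, g1, g2]; ring
  have hsmall : ∀ᶠ t in 𝓝 t₀, ‖D.modeFunction (0, t)‖ < (ν⁻¹ - c : ℝ) * ρ := by
    have hcont : Continuous fun t => ‖D.modeFunction (0, t)‖ :=
      (D.continuous_modeFunction.comp (continuous_const.prodMk continuous_id)).norm
    refine hcont.continuousAt.eventually (Iio_mem_nhds ?_)
    beta_reduce
    rw [hmode0, norm_zero]
    have h1 : (ν⁻¹ - c : ℝ) = c := by rw [hc]; push_cast; ring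
    rw [h1]
    positivity
  filter_upwards [hsmall, hG (3 / 2 * Vmax) ε hε0, hP2] with t ht1 ht2 ht3
  have happrox : ApproximatesLinearOn (fun p => D.modeFunction (p, t)) (Le : ℂ →L[ℝ] ℂ)
      (Metric.closedBall 0 ρ) c := by
    intro p hp p' hp'
    rw [mem_closedBall_zero_iff] at hp hp'
    have hout0 : ∀ x, x ∉ Icc x₀ x₁ → D.C (p, t) x = D.C (p', t) x := by
      intro x hxn
      have : V₀ x = 0 := by_contra fun h => hxn (hV₀s x h)
      simp only [hC, tunedBarrier, this, zero_mul]
    have hcontC : ∀ x, x ≤ x₀ ∨ x₁ ≤ x → D.C (p, t) x = D.C (p', t) x := by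
      -- at the endpoints the coefficients agree by continuity
      have hcl : ∀ S : Set ℝ, (∀ x ∈ S, D.C (p, t) x = D.C (p', t) x) →
          closure S ⊆ {x | D.C (p, t) x = D.C (p', t) x} := fun S hS =>
        closure_minimal hS (isClosed_eq (D.continuous_C_right _) (D.continuous_C_right _))
      rintro x (h | h)
      · have := hcl (Iio x₀) fun x hx => hout0 x fun h' => absurd hx (not_lt.2 h'.1)
        rw [closure_Iio] at this
        exact this h
      · have := hcl (Ioi x₁) fun x hx => hout0 x fun h' => absurd hx (not_lt.2 h'.2)
        rw [closure_Ioi] at this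
        exact this h
    have hsub := D.modeFunction_sub (p := (p, t)) (p' := (p', t)) (x₀ := x₀) (x₁ := x₁)
      (by rw [hκOut p, hκOut p']) (by rw [hκHor p, hκHor p']) (fun x h => hcontC x (Or.inl h))
      (fun x h => hcontC x (Or.inr h))
    have hi1 : IntervalIntegrable (fun x => (D.C (p', t) x - D.C (p, t) x)
        * (D.hor (p, t) x * D.out (p', t) x)) volume x₀ x₁ :=
      (((D.continuous_C_right _).sub (D.continuous_C_right _)).mul
        ((D.solvesODE_hor _).continuous.mul (D.solvesODE_out _).continuous)).intervalIntegrable _ _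
    have hi2 : IntervalIntegrable
        (fun x => -((V₀ x * (conj (p - p') * E x).re : ℝ) : ℂ) * (γ * E x)) volume x₀ x₁ :=
      Continuous.intervalIntegrable (by fun_prop) _ _
    rw [hLeL, hLp, hsub, ← intervalIntegral.integral_sub hi1 hi2]
    have hbound : ∀ x ∈ uIoc x₀ x₁, ‖(D.C (p', t) x - D.C (p, t) x)
        * (D.hor (p, t) x * D.out (p', t) x)
        - -((V₀ x * (conj (p - p') * E x).re : ℝ) : ℂ) * (γ * E x)‖
        ≤ (K * η + ε * K * (K' + 1)) * ‖p - p'‖ := by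
      intro x hxu
      rw [uIoc_of_le hx.le] at hxu
      have hxm : x ∈ Icc x₀ x₁ := ⟨hxu.1.le, hxu.2⟩
      have d1 := hdiff p p' hp hp' x hxm
      have d2 := hdiff' p p' x hxm
      have hbp : ∀ p, tunedBarrier V₀ E p x ∈ Icc 0 (3 / 2 * Vmax) := fun p =>
        ⟨tunedBarrier_nonneg hV₀0 E p x, (tunedBarrier_le hV₀0 E p x).trans
          (mul_le_mul_of_nonneg_left ((le_abs_self _).trans (hVmax x hxm)) (by norm_num))⟩
      have d3 := ht2 x hxm _ (hbp p) _ (hbp p')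
      rw [d1] at d3
      have hb1 := hball (y := p) (by rw [dist_zero_right]; linarith)
      have hb2 := hball (y := p') (by rw [dist_zero_right]; linarith)
      have d4 := (hunif (hP1 hb1.1 hb2.2) ht3 x hxm).le
      simp only at d4
      have d5 : ‖D.hor (p, t) x * D.out (p', t) x‖ ≤ K' + 1 := by
        have h1 : ‖γ * E x‖ ≤ K' := by
          rw [norm_mul]; exact mul_le_mul_of_nonneg_left (hEmax x hxm) (norm_nonneg _)
        have h2 := norm_sub_norm_le (D.hor (p, t) x * D.out (p', t) x) (γ * E x)
        have h3 : η ≤ 1 := min_le_left _ _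
        linarith
      have e : (D.C (p', t) x - D.C (p, t) x) * (D.hor (p, t) x * D.out (p', t) x)
          - -((V₀ x * (conj (p - p') * E x).re : ℝ) : ℂ) * (γ * E x)
          = -((V₀ x * (conj (p - p') * E x).re : ℝ) : ℂ)
              * (D.hor (p, t) x * D.out (p', t) x - γ * E x)
            + (G t (tunedBarrier V₀ E p x) x - G t (tunedBarrier V₀ E p' x) x)
              * (D.hor (p, t) x * D.out (p', t) x) := by
        have d1' : (tunedBarrier V₀ E p x : ℂ) - tunedBarrier V₀ E p' x
            = ((V₀ x * (conj (p - p') * E x).re : ℝ) : ℂ) := by rw [← d1]; push_cast; rfl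
        rw [hC, hC, ← d1']
        ring
      rw [e]
      refine (norm_add_le _ _).trans ?_
      rw [norm_mul, norm_mul, norm_neg, Complex.norm_real, Real.norm_eq_abs]
      have hpp := norm_nonneg (p - p')
      have g1 : |V₀ x * (conj (p - p') * E x).re| * ‖D.hor (p, t) x * D.out (p', t) x - γ * E x‖
          ≤ K * ‖p - p'‖ * η := mul_le_mul d2 d4 (norm_nonneg _) (by positivity)
      have g2 : ‖G t (tunedBarrier V₀ E p x) x - G t (tunedBarrier V₀ E p' x) x‖
          * ‖D.hor (p, t) x * D.out (p', t) x‖ ≤ ε * (K * ‖p - p'‖) * (K' + 1) :=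
        mul_le_mul (d3.trans (mul_le_mul_of_nonneg_left d2 hε0.le)) d5 (norm_nonneg _)
          (by positivity)
      linarith
    refine (intervalIntegral.norm_integral_le_of_norm_le_const hbound).trans ?_
    rw [abs_of_pos hlen]
    have hcR : (0 : ℝ) < c := hc0
    have k1 : K * η * (x₁ - x₀) ≤ c / 2 := by
      have : η ≤ c / (2 * (K + 1) * (x₁ - x₀)) := min_le_right _ _
      calc K * η * (x₁ - x₀) ≤ (K + 1) * (c / (2 * (K + 1) * (x₁ - x₀))) * (x₁ - x₀) := by
            gcongr; linarith
        _ = c / 2 := by field_simp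
    have k2 : ε * K * (K' + 1) * (x₁ - x₀) ≤ c / 2 := by
      calc ε * K * (K' + 1) * (x₁ - x₀) ≤ ε * (K + 1) * (K' + 1) * (x₁ - x₀) := by
            gcongr; linarith
        _ = c / 2 := by rw [hε]; field_simp
    have hpp := norm_nonneg (p - p')
    calc (K * η + ε * K * (K' + 1)) * ‖p - p'‖ * (x₁ - x₀)
        = (K * η * (x₁ - x₀) + ε * K * (K' + 1) * (x₁ - x₀)) * ‖p - p'‖ := by ring
      _ ≤ c * ‖p - p'‖ := mul_le_mul_of_nonneg_right (by linarith) hpp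
  have hsurj := happrox.surjOn_closedBall_of_nonlinearRightInverse Le.toNonlinearRightInverse
    hρpos.le le_rfl
  obtain ⟨p, hp, hp0⟩ := hsurj (show (0 : ℂ) ∈ Metric.closedBall (D.modeFunction (0, t)) _ by
    rw [Metric.mem_closedBall_comm, mem_closedBall_zero_iff]; exact ht1.le)
  rw [mem_closedBall_zero_iff] at hp
  exact ⟨p, hp.trans ((min_le_right _ _).trans (min_le_left _ _)), hp0⟩

end Kerr

end

noncomputable section

/-! ### The radial equation of the Kerr spacetime -/

namespace Kerr

open Filter Topology Set MeasureTheory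
open scoped ComplexConjugate

variable {M a : ℝ} {m : ℤ}

/-- The frequency `a m / (2 M r₊)`: `ω` is superradiant if it lies between `0` and this value. -/
def horizonFrequency (M a : ℝ) (m : ℤ) : ℝ := a * m / (2 * M * rPlus M a)

/-- Bounds for the potential on bounded sets of frequencies, with inverse square decay towards its
limits at both ends. -/
theorem exists_potential_bound (ha : 0 < |a|) (haM : |a| < M) (m l : ℤ) {B : ℝ} (hB : 0 ≤ B) :
    ∃ A : ℝ, 0 ≤ A ∧ ∀ ω : ℂ, ‖ω‖ ≤ B → ‖eigenvalue a ω m l‖ ≤ B → ∀ x,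
      ‖potential M a ω m l (radius M a 0 x)‖ ≤ A ∧
      (0 ≤ x → ‖potential M a ω m l (radius M a 0 x)‖ ≤ A / (1 + x ^ 2)) ∧
      ‖potential M a ω m l (radius M a 0 x) - potential M a ω m l (rPlus M a)‖ ≤ A ∧
      (x ≤ 0 → ‖potential M a ω m l (radius M a 0 x) - potential M a ω m l (rPlus M a)‖
        ≤ A / (1 + x ^ 2)) := by
  obtain ⟨K, hK, hK'⟩ := exists_one_div_radius_sq_le ha haM
  obtain ⟨K', hK0', hK''⟩ := exists_radius_sub_le ha haM
  obtain ⟨L0, hL0, hL0'⟩ := exists_abs_sub_rPlus_le (contDiff_potentialZero (m := m) (M := M) ha) M a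
  obtain ⟨L1, hL1, hL1'⟩ := exists_abs_sub_rPlus_le (contDiff_potentialOne (m := m) (M := M) ha) M a
  obtain ⟨L2, hL2, hL2'⟩ := exists_abs_sub_rPlus_le (contDiff_potentialTwo (M := M) ha) M a
  have hpos := rPlus_pos haM
  set B₂ := B + a ^ 2 * B ^ 2 with hB₂
  have hB₂0 : 0 ≤ B₂ := by positivity
  set S := ((m : ℝ) ^ 2 + 2) + B * (4 * |a * m|) + B₂ with hS
  have hS0 : 0 ≤ S := by positivity
  set L := L0 + B * L1 + B₂ * L2 with hL
  have hL00 : 0 ≤ L := by positivity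
  have hcomb : ∀ (ω : ℂ) (Λ : ℂ) (y0 y1 y2 : ℝ), ‖ω‖ ≤ B → ‖Λ‖ ≤ B →
      ‖(y0 : ℂ) + ω * y1 + (Λ + (a : ℂ) ^ 2 * ω ^ 2) * y2‖ ≤ |y0| + B * |y1| + B₂ * |y2| := by
    intro ω Λ y0 y1 y2 h1 h2
    have h3 : ‖Λ + (a : ℂ) ^ 2 * ω ^ 2‖ ≤ B₂ := by
      refine (norm_add_le _ _).trans (add_le_add h2 ?_)
      rw [norm_mul, norm_pow, norm_pow, Complex.norm_real, Real.norm_eq_abs, sq_abs]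
      gcongr
    refine (norm_add₃_le).trans ?_
    rw [norm_mul, norm_mul, Complex.norm_real, Complex.norm_real, Complex.norm_real]
    simp only [Real.norm_eq_abs]
    gcongr
  have hdec : ∀ ω : ℂ, ‖ω‖ ≤ B → ‖eigenvalue a ω m l‖ ≤ B → ∀ r, rPlus M a ≤ r →
      ‖potential M a ω m l r‖ ≤ S * (1 / r ^ 2) := by
    intro ω h1 h2 r hr
    rw [potential_eq]
    refine (hcomb ω _ _ _ _ h1 h2).trans ?_
    have e0 := abs_potentialZero_le (m := m) ha haM hr
    have e1 := mul_le_mul_of_nonneg_left (abs_potentialOne_le (m := m) ha haM hr) hB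
    have e2 := mul_le_mul_of_nonneg_left (abs_potentialTwo_le ha haM hr) hB₂0
    calc _ ≤ _ := add_le_add_three e0 e1 e2
      _ = _ := by rw [hS]; ring
  have hbd : ∀ ω : ℂ, ‖ω‖ ≤ B → ‖eigenvalue a ω m l‖ ≤ B → ∀ r, rPlus M a ≤ r →
      ‖potential M a ω m l r‖ ≤ S * (1 / rPlus M a ^ 2) := fun ω h1 h2 r hr =>
    (hdec ω h1 h2 r hr).trans (by gcongr)
  have hlip : ∀ ω : ℂ, ‖ω‖ ≤ B → ‖eigenvalue a ω m l‖ ≤ B → ∀ r, rPlus M a ≤ r →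
      r ≤ 2 * rPlus M a →
      ‖potential M a ω m l r - potential M a ω m l (rPlus M a)‖ ≤ L * (r - rPlus M a) := by
    intro ω h1 h2 r hr hr'
    have e : potential M a ω m l r - potential M a ω m l (rPlus M a)
        = ((potentialZero M a m r - potentialZero M a m (rPlus M a) : ℝ) : ℂ)
          + ω * ((potentialOne M a m r - potentialOne M a m (rPlus M a) : ℝ) : ℂ)
          + (eigenvalue a ω m l + (a : ℂ) ^ 2 * ω ^ 2)
            * ((potentialTwo M a r - potentialTwo M a (rPlus M a) : ℝ) : ℂ) := by
      rw [potential_eq, potential_eq]; push_cast; ring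
    rw [e]
    refine (hcomb ω _ _ _ _ h1 h2).trans ?_
    have e1 := mul_le_mul_of_nonneg_left (hL1' r hr hr') hB
    have e2 := mul_le_mul_of_nonneg_left (hL2' r hr hr') hB₂0
    calc _ ≤ _ := add_le_add_three (hL0' r hr hr') e1 e2
      _ = _ := by rw [hL]; ring
  refine ⟨S * (1 / rPlus M a ^ 2) + S * (1 / rPlus M a ^ 2) + S * K + L * K', by positivity,
    fun ω h1 h2 x => ?_⟩
  have hr := (rPlus_lt_radius haM 0 x).le
  have n1 : 0 ≤ S * (1 / rPlus M a ^ 2) := by positivity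
  have n2 : 0 ≤ S * K := by positivity
  have n3 : 0 ≤ L * K' := by positivity
  have b := hbd ω h1 h2 _ hr
  refine ⟨by linarith, fun hx => ?_, ?_, fun hx => ?_⟩
  · calc _ ≤ S * (1 / radius M a 0 x ^ 2) := hdec ω h1 h2 _ hr
      _ ≤ S * (K / (1 + x ^ 2)) := mul_le_mul_of_nonneg_left (hK' x hx) hS0
      _ = S * K / (1 + x ^ 2) := by ring
      _ ≤ _ := by gcongr; linarith
  · exact (norm_sub_le _ _).trans (by linarith [hbd ω h1 h2 _ (le_refl (rPlus M a))])
  · have hr' : radius M a 0 x ≤ 2 * rPlus M a :=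
      radius_zero haM ▸ (strictMono_radius haM 0).monotone hx
    calc _ ≤ L * (radius M a 0 x - rPlus M a) := hlip ω h1 h2 _ hr hr'
      _ ≤ L * (K' / (1 + x ^ 2)) := mul_le_mul_of_nonneg_left (hK'' x hx) hL00
      _ = L * K' / (1 + x ^ 2) := by ring
      _ ≤ _ := by gcongr; linarith

/-- The radial equation for a bounded family of frequencies in the upper half plane, with a
perturbation supported in a fixed interval. -/
theorem exists_radialFamily (ha : 0 < |a|) (haM : |a| < M) (m l : ℤ) {P : Type*}
    [TopologicalSpace P] {ω : P → ℂ} {W : P → ℝ → ℂ} {B k R : ℝ} (hω : Continuous ω)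
    (hl : Continuous fun p => eigenvalue a (ω p) m l) (hωB : ∀ p, ‖ω p‖ ≤ B)
    (hlB : ∀ p, ‖eigenvalue a (ω p) m l‖ ≤ B) (him : ∀ p, 0 ≤ (ω p).im) (hk : 0 < k)
    (hkω : ∀ p, k ≤ ‖ω p‖) (hkω' : ∀ p, k ≤ ‖ω p - horizonFrequency M a m‖)
    (hW : Continuous (Function.uncurry W)) (hWB : ∀ p x, ‖W p x‖ ≤ B)
    (hWR : ∀ p x, W p x ≠ 0 → |x| ≤ R) :
    ∃ D : RadialFamily P, D.κOut = ω ∧ D.κHor = (fun p => ω p - horizonFrequency M a m) ∧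
      D.C = fun p x => potential M a (ω p) m l (radius M a 0 x) - ω p ^ 2 + W p x := by
  rcases isEmpty_or_nonempty P with hP | ⟨⟨p₀⟩⟩
  · refine ⟨⟨ω, fun p => ω p - horizonFrequency M a m, _, k, 0, hω, hω.sub continuous_const, hP.elim, hP.elim, hk, hP.elim, hP.elim,
      ?_, le_rfl, hP.elim, hP.elim, hP.elim, hP.elim⟩, rfl, rfl, rfl⟩
    exact continuous_iff_continuousAt.2 fun y => hP.elim y.1
  have hB : 0 ≤ B := (norm_nonneg _).trans (hωB p₀)
  obtain ⟨A, hA, hbd⟩ := exists_potential_bound ha haM m l hB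
  have hA' : 0 ≤ A + B * (1 + R ^ 2) := by positivity
  have hWdec : ∀ p x, ‖W p x‖ ≤ B * (1 + R ^ 2) / (1 + x ^ 2) := by
    intro p x
    rw [le_div_iff₀ (by positivity)]
    by_cases h : W p x = 0
    · rw [h, norm_zero, zero_mul]; positivity
    · have := sq_le_sq' (by linarith [neg_abs_le x, hWR p x h]) ((le_abs_self x).trans (hWR p x h))
      gcongr
      exact hWB p x
  have hWB' : ∀ p x, ‖W p x‖ ≤ B * (1 + R ^ 2) := fun p x =>
    (hWB p x).trans (le_mul_of_one_le_right hB (by nlinarith [sq_nonneg R]))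
  have e1 : ∀ p x, potential M a (ω p) m l (radius M a 0 x) - ω p ^ 2 + W p x + ω p ^ 2
      = potential M a (ω p) m l (radius M a 0 x) + W p x := fun p x => by ring
  have e2 : ∀ p x, potential M a (ω p) m l (radius M a 0 x) - ω p ^ 2 + W p x
      + (ω p - horizonFrequency M a m) ^ 2
      = (potential M a (ω p) m l (radius M a 0 x) - potential M a (ω p) m l (rPlus M a))
        + W p x := fun p x => by
    rw [potential_rPlus haM]; unfold horizonFrequency; push_cast; ring
  refine ⟨⟨ω, fun p => ω p - horizonFrequency M a m, _, k, A + B * (1 + R ^ 2), hω, hω.sub continuous_const, him,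
    fun p => by simpa using him p, hk, hkω, hkω', ?_, hA', ?_, ?_, ?_, ?_⟩, rfl, rfl, rfl⟩
  · have hr := (contDiff_radius ha haM 0).continuous
    have h0 := (contDiff_potentialZero (m := m) (M := M) ha).continuous
    have h1 := (contDiff_potentialOne (m := m) (M := M) ha).continuous
    have h2 := (contDiff_potentialTwo (M := M) ha).continuous
    simp only [potential_eq, Function.uncurry_def]
    have hl' : Continuous fun y : P × ℝ => eigenvalue a (ω y.1) m l := hl.comp continuous_fst
    have hω' : Continuous fun y : P × ℝ => ω y.1 := hω.comp continuous_fst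
    have h0' : Continuous fun y : P × ℝ => potentialZero M a m (radius M a 0 y.2) :=
      h0.comp (hr.comp continuous_snd)
    have h1' : Continuous fun y : P × ℝ => potentialOne M a m (radius M a 0 y.2) :=
      h1.comp (hr.comp continuous_snd)
    have h2' : Continuous fun y : P × ℝ => potentialTwo M a (radius M a 0 y.2) :=
      h2.comp (hr.comp continuous_snd)
    have hW' : Continuous fun y : P × ℝ => W y.1 y.2 := hW
    fun_prop
  · intro p x
    rw [e1]
    exact (norm_add_le _ _).trans (add_le_add (hbd _ (hωB p) (hlB p) x).1 (hWB' p x))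
  · intro p x hx
    rw [e1, add_div]
    exact (norm_add_le _ _).trans (add_le_add ((hbd _ (hωB p) (hlB p) x).2.1 hx) (hWdec p x))
  · intro p x
    rw [e2]
    exact (norm_add_le _ _).trans (add_le_add (hbd _ (hωB p) (hlB p) x).2.2.1 (hWB' p x))
  · intro p x hx
    rw [e2, add_div]
    exact (norm_add_le _ _).trans (add_le_add ((hbd _ (hωB p) (hlB p) x).2.2.2 hx) (hWdec p x))

end Kerr

end

noncomputable section

/-! ### The barrier at a real superradiant frequency -/

namespace Kerr

open Filter Topology Set MeasureTheory
open scoped ComplexConjugate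

variable {M a : ℝ} {m : ℤ}

/-- The flux of a solution with the asymptotics `exp (i κ x)` is `κ`. -/
theorem flux_eq_of_tendsto {Q : ℝ → ℝ} {y y₁ e : ℝ → ℂ} {κ : ℝ} {F : Filter ℝ} [F.NeBot]
    (h : SolvesODE (fun x => (Q x : ℂ)) y y₁) (he : ∀ x, ‖e x‖ = 1)
    (h0 : Tendsto (fun x => e x * y x) F (𝓝 1))
    (h1 : Tendsto (fun x => e x * (y₁ x - Complex.I * κ * y x)) F (𝓝 0)) (x : ℝ) :
    flux y y₁ x = κ := by
  have h2 : Tendsto (fun x => e x * y₁ x) F (𝓝 (Complex.I * κ)) := by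
    have := h1.add (h0.const_mul (Complex.I * κ))
    rw [zero_add, mul_one] at this
    refine this.congr fun x => ?_
    ring
  have h3 : Tendsto (fun x => (conj (e x * y x) * (e x * y₁ x)).im) F (𝓝 κ) := by
    have := (Complex.continuous_im.tendsto _).comp
      (((Complex.continuous_conj.tendsto _).comp h0).mul h2)
    simpa [Function.comp_def] using this
  have h4 : ∀ z, (conj (e z * y z) * (e z * y₁ z)).im = flux y y₁ x := fun z => by
    rw [h.flux_eq x z, flux]
    congr 1
    have : conj (e z) * e z = 1 := by
      rw [Complex.conj_mul', he]; simp
    rw [map_mul]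
    linear_combination (conj (y z) * y₁ z) * this
  simp only [h4] at h3
  exact tendsto_nhds_unique tendsto_const_nhds h3

/-- The coefficient of the radial equation at a real frequency. -/
def realCoeff (M a ω : ℝ) (m l : ℤ) (x : ℝ) : ℝ :=
  potentialZero M a m (radius M a 0 x) + ω * potentialOne M a m (radius M a 0 x)
    + (eigenvalueReal a ω m l + a ^ 2 * ω ^ 2) * potentialTwo M a (radius M a 0 x) - ω ^ 2

theorem ofReal_realCoeff (M a ω : ℝ) (m l : ℤ) (x : ℝ) :
    (realCoeff M a ω m l x : ℂ) = potential M a ω m l (radius M a 0 x) - (ω : ℂ) ^ 2 := by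
  rw [potential_eq, eigenvalue_ofReal, realCoeff]; push_cast; ring

theorem contDiff_realCoeff (ha : 0 < |a|) (haM : |a| < M) (ω : ℝ) (m l : ℤ) :
    ContDiff ℝ ((⊤ : ℕ∞) : WithTop ℕ∞) (realCoeff M a ω m l) := by
  have hr := contDiff_radius ha haM 0
  have h0 := (contDiff_potentialZero (m := m) (M := M) ha).comp hr
  have h1 := (contDiff_potentialOne (m := m) (M := M) ha).comp hr
  have h2 := (contDiff_potentialTwo (M := M) ha).comp hr
  exact ((h0.add (contDiff_const.mul h1)).add (contDiff_const.mul h2)).sub contDiff_const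

/-- At a superradiant real frequency, a barrier of fixed length and height at most `ω² / 3` placed
sufficiently far out supports a mode. The horizon and the outgoing solution have fluxes of the same
sign, hence can be joined. -/
theorem exists_realMode (ha : 0 < |a|) (haM : |a| < M) {ω : ℝ} (hω : ω ≠ 0) {l : ℤ}
    (hsup : ω * (ω - horizonFrequency M a m) < 0) :
    ∃ X ℓ : ℝ, 0 < ℓ ∧ ∀ x₀, X ≤ x₀ → ∃ V : ℝ → ℝ, ContDiff ℝ ((⊤ : ℕ∞) : WithTop ℕ∞) V ∧
      (∀ x, 0 ≤ V x) ∧ (∀ x, V x ≤ ω ^ 2 / 3) ∧ (∀ x, V x ≠ 0 → x ∈ Icc x₀ (x₀ + ℓ)) ∧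
      (∃ x, V x ≠ 0) ∧ ∃ U U₁ : ℝ → ℂ,
        SolvesODE (fun x => ((realCoeff M a ω m l x + V x : ℝ) : ℂ)) U U₁ ∧
        (∀ x, flux U U₁ x ≠ 0) ∧
        (∃ N : ℝ, (∀ᶠ x in atTop, ‖U x‖ ≤ N) ∧ ∀ᶠ x in atBot, ‖U x‖ ≤ N) ∧
        Tendsto (fun x => U₁ x - Complex.I * ω * U x) atTop (𝓝 0) ∧
        Tendsto (fun x => U₁ x + Complex.I * (ω - horizonFrequency M a m : ℝ) * U x) atBot
          (𝓝 0) := by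
  set k := ω - horizonFrequency M a m with hk
  have hk0 : k ≠ 0 := fun h => by rw [h, mul_zero] at hsup; exact lt_irrefl _ hsup
  obtain ⟨D, hO, hH, hC⟩ := exists_radialFamily ha haM m l (P := Unit) (ω := fun _ => (ω : ℂ))
    (W := fun _ _ => 0) (B := max |ω| ‖eigenvalue a (ω : ℂ) m l‖) (k := min |ω| |k|) (R := 0)
    continuous_const continuous_const (fun _ => by simp) (fun _ => le_max_right _ _)
    (fun _ => by simp) (lt_min (abs_pos.2 hω) (abs_pos.2 hk0)) (fun _ => by simp)
    (fun _ => by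
      rw [← Complex.ofReal_sub, Complex.norm_real]
      exact min_le_right _ _)
    continuous_const (fun _ _ => by simp) (fun _ _ h => absurd rfl h)
  have hC' : ∀ x, D.C () x = (realCoeff M a ω m l x : ℂ) := fun x => by
    rw [hC, ofReal_realCoeff]; ring
  have hO' : D.κOut () = ω := by rw [hO]
  have hH' : D.κHor () = k := by rw [hH, hk]; push_cast; rfl
  set v := D.out () with hv
  set v₁ := D.outDeriv () with hv₁
  set u := D.hor () with hu
  set u₁ := D.horDeriv () with hu₁
  have sv : SolvesODE (fun x => (realCoeff M a ω m l x : ℂ)) v v₁ :=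
    (D.solvesODE_out ()).congr_coeff hC'
  have su : SolvesODE (fun x => (realCoeff M a ω m l x : ℂ)) u u₁ :=
    (D.solvesODE_hor ()).congr_coeff hC'
  have n1 : ∀ x : ℝ, ‖Complex.exp (-(Complex.I * ω * x))‖ = 1 := fun x => by
    have := RadialFamily.norm_exp_I_mul_real ω (-x)
    rwa [Complex.ofReal_neg, mul_neg] at this
  have n2 := RadialFamily.norm_exp_I_mul_real k
  have tv := D.tendsto_out ()
  have tv' := D.tendsto_outDeriv_sub ()
  have tu := D.tendsto_hor ()
  have tu' := D.tendsto_horDeriv_add ()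
  rw [hO'] at tv tv'
  rw [hH'] at tu tu'
  have fv : ∀ x, flux v v₁ x = ω := flux_eq_of_tendsto sv n1 tv tv'
  have fu : ∀ x, flux u u₁ x = -k := flux_eq_of_tendsto su n2 tu
    (tu'.congr fun x => by push_cast; ring)
  have tvn : Tendsto (fun x => ‖v x‖ ^ 2) atTop (𝓝 1) := by
    have := tv.norm.pow 2
    simpa [norm_mul, n1] using this
  have tun : Tendsto (fun x => ‖u x‖) atBot (𝓝 1) := by
    have := tu.norm
    simpa [norm_mul, n2] using this
  obtain ⟨X, hX⟩ := eventually_atTop.1 (tvn.eventually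
    (Icc_mem_nhds (show (1 / 2 : ℝ) < 1 by norm_num) (show (1 : ℝ) < 2 by norm_num)))
  obtain ⟨ℓ, hℓ, hbar⟩ := exists_barrier (contDiff_realCoeff ha haM ω m l)
    (F := -k) (by linarith) sv su fv fu hX
  refine ⟨X, ℓ, hℓ, fun x₀ hx₀ => ?_⟩
  obtain ⟨V, hV, hV0, hV1, hVs, hVn, U, U₁, hU, c₁, c₂, hc₁, hc₂, hl, hr⟩ := hbar x₀ hx₀
  have hl₁ : ∀ x, x < x₀ → U₁ x = c₁ * u₁ x := fun x hx =>
    ((hU x).1.congr_of_eventuallyEq (by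
      filter_upwards [Iio_mem_nhds hx] with y hy using (hl y (le_of_lt hy)).symm)).unique
      ((su x).1.const_mul c₁)
  have hr₁ : ∀ x, x₀ + ℓ < x → U₁ x = c₂ * v₁ x := fun x hx =>
    ((hU x).1.congr_of_eventuallyEq (by
      filter_upwards [Ioi_mem_nhds hx] with y hy using (hr y (le_of_lt hy)).symm)).unique
      ((sv x).1.const_mul c₂)
  refine ⟨V, hV, hV0, hV1, hVs, hVn, U, U₁, hU, fun x => ?_,
    ⟨max (‖c₂‖ * 2) (‖c₁‖ * 2), ?_, ?_⟩, ?_, ?_⟩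
  · rw [hU.flux_eq x (x₀ - 1), flux, hl _ (by linarith), hl₁ _ (by linarith)]
    have e : conj (c₁ * u (x₀ - 1)) * (c₁ * u₁ (x₀ - 1))
        = ((‖c₁‖ ^ 2 : ℝ) : ℂ) * (conj (u (x₀ - 1)) * u₁ (x₀ - 1)) := by
      rw [map_mul, Complex.ofReal_pow, ← Complex.conj_mul']; ring
    rw [e, Complex.im_ofReal_mul]
    refine mul_ne_zero (by positivity) ?_
    have := fu (x₀ - 1)
    unfold flux at this
    rw [this]
    exact neg_ne_zero.2 hk0
  · filter_upwards [eventually_ge_atTop (x₀ + ℓ), eventually_ge_atTop X] with x h1 h2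
    rw [hr x h1, norm_mul]
    refine (mul_le_mul_of_nonneg_left ?_ (norm_nonneg _)).trans (le_max_left _ _)
    nlinarith [(hX x h2).2, norm_nonneg (v x)]
  · filter_upwards [eventually_le_atBot x₀, tun.eventually
      (Iio_mem_nhds (show (1 : ℝ) < 2 by norm_num))] with x h1 h2
    rw [hl x h1, norm_mul]
    exact (mul_le_mul_of_nonneg_left (le_of_lt h2) (norm_nonneg _)).trans (le_max_right _ _)
  · have h := tv'.const_mul c₂
    rw [mul_zero, tendsto_zero_iff_norm_tendsto_zero] at h
    rw [tendsto_zero_iff_norm_tendsto_zero]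
    refine h.congr' ?_
    filter_upwards [eventually_gt_atTop (x₀ + ℓ)] with x hx
    rw [hr x hx.le, hr₁ x hx, norm_mul, norm_mul, n1, one_mul, ← norm_mul]
    congr 1; ring
  · have h := tu'.const_mul c₁
    rw [mul_zero, tendsto_zero_iff_norm_tendsto_zero] at h
    rw [tendsto_zero_iff_norm_tendsto_zero]
    refine h.congr' ?_
    filter_upwards [eventually_lt_atBot x₀] with x hx
    rw [hl x hx.le, hl₁ x hx, norm_mul, norm_mul, n2, one_mul, ← norm_mul]
    congr 1; ring

/-- A smooth perturbation that vanishes at `w = 0` has, for small `w`, a small Lipschitz constant in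
the second variable on compact sets. -/
theorem eventually_norm_sub_le {g : ℝ → ℝ → ℝ → ℂ}
    (hg : ContDiff ℝ ((⊤ : ℕ∞) : WithTop ℕ∞) (fun p : ℝ × ℝ × ℝ => g p.1 p.2.1 p.2.2))
    (hg0 : ∀ v x, g 0 v x = 0) (x₀ x₁ R : ℝ) {ε : ℝ} (hε : 0 < ε) :
    ∀ᶠ w in 𝓝 (0 : ℝ), ∀ x ∈ Icc x₀ x₁, ∀ v ∈ Icc 0 R, ∀ v' ∈ Icc 0 R,
      ‖g w v x - g w v' x‖ ≤ ε * |v - v'| := by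
  set f : ℝ × ℝ × ℝ → ℂ := fun p => g p.1 p.2.1 p.2.2 with hf
  set H : ℝ × ℝ × ℝ → ℂ := fun p => fderiv ℝ f p (0, 1, 0) with hH
  have hHc : Continuous H := (hg.continuous_fderiv (by simp)).clm_apply continuous_const
  have hder : ∀ w v x, HasDerivAt (fun v => g w v x) (H (w, v, x)) v := by
    intro w v x
    have h1 : HasDerivAt (fun v : ℝ => ((w, v, x) : ℝ × ℝ × ℝ)) (0, 1, 0) v :=
      (hasDerivAt_const v w).prodMk ((hasDerivAt_id v).prodMk (hasDerivAt_const v x))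
    exact (hg.differentiable (by simp) (w, v, x)).hasFDerivAt.comp_hasDerivAt v h1
  have hH0 : ∀ v x, H (0, v, x) = 0 := fun v x => by
    have h := hder 0 v x
    simp only [hg0] at h
    exact h.unique (hasDerivAt_const v 0)
  have hcomp : IsCompact (Icc 0 R ×ˢ Icc x₀ x₁) := isCompact_Icc.prod isCompact_Icc
  have hev : ∀ᶠ w in 𝓝 (0 : ℝ), ∀ y ∈ Icc 0 R ×ˢ Icc x₀ x₁, ‖H (w, y)‖ < ε := by
    refine hcomp.eventually_forall_of_forall_eventually fun y _ => ?_
    have : Tendsto (fun z : ℝ × ℝ × ℝ => ‖H z‖) (𝓝 (0, y)) (𝓝 0) := by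
      have := (hHc.norm).tendsto ((0 : ℝ), y)
      rwa [show H (0, y) = 0 from hH0 y.1 y.2, norm_zero] at this
    exact this.eventually (Iio_mem_nhds hε)
  filter_upwards [hev] with w hw x hx v hv v' hv'
  have := (convex_Icc 0 R).norm_image_sub_le_of_norm_hasDerivWithin_le
    (f := fun v => g w v x) (f' := fun v => H (w, v, x)) (C := ε)
    (fun v _ => (hder w v x).hasDerivWithinAt) (fun v hv => (hw (v, x) ⟨hv, hx⟩).le) hv' hv
  rwa [Real.norm_eq_abs] at this

end Kerr

end

noncomputable section

/-! ### Modes at complex frequencies -/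

namespace Kerr

open Filter Topology Set MeasureTheory
open scoped ComplexConjugate

variable {M a : ℝ} {m : ℤ}

/-- A real mode persists, with a slightly modified barrier, for frequencies with a small positive
imaginary part and under perturbations that vanish at real frequencies. -/
theorem exists_mode_of_realMode (ha : 0 < |a|) (haM : |a| < M) {ω : ℝ} (hω : ω ≠ 0) {l : ℤ}
    (hsup : ω * (ω - horizonFrequency M a m) < 0) {g : ℝ → ℝ → ℝ → ℂ}
    (hg : ContDiff ℝ ((⊤ : ℕ∞) : WithTop ℕ∞) (fun p : ℝ × ℝ × ℝ => g p.1 p.2.1 p.2.2))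
    (hg0 : ∀ v x, g 0 v x = 0) (hg1 : ∀ w x, g w 0 x = 0) {x₀ x₁ : ℝ} (hx : x₀ < x₁)
    {V₀ : ℝ → ℝ} (hV : ContDiff ℝ ((⊤ : ℕ∞) : WithTop ℕ∞) V₀) (hV0 : ∀ x, 0 ≤ V₀ x)
    (hV1 : ∀ x, V₀ x ≤ ω ^ 2 / 3) (hVs : ∀ x, V₀ x ≠ 0 → x ∈ Icc x₀ x₁) (hVn : ∃ x, V₀ x ≠ 0)
    {U U₁ : ℝ → ℂ} (hU : SolvesODE (fun x => ((realCoeff M a ω m l x + V₀ x : ℝ) : ℂ)) U U₁)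
    (hfl : ∀ x, flux U U₁ x ≠ 0) {N : ℝ} (bt : ∀ᶠ x in atTop, ‖U x‖ ≤ N)
    (bb : ∀ᶠ x in atBot, ‖U x‖ ≤ N)
    (ht : Tendsto (fun x => U₁ x - Complex.I * ω * U x) atTop (𝓝 0))
    (hb : Tendsto (fun x => U₁ x + Complex.I * (ω - horizonFrequency M a m : ℝ) * U x) atBot
      (𝓝 0)) :
    ∃ δ : ℝ, 0 < δ ∧ ∀ s : ℝ, 0 ≤ s → s < δ → ∃ V : ℝ → ℝ,
      ContDiff ℝ ((⊤ : ℕ∞) : WithTop ℕ∞) V ∧ (∀ x, 0 ≤ V x) ∧ (∀ x, V x ≤ ω ^ 2 / 2) ∧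
      (∀ x, V x ≠ 0 → x ∈ Icc x₀ x₁) ∧ ∃ u u₁ : ℝ → ℂ,
        SolvesODE (fun x => potential M a ((ω : ℂ) + Complex.I * s) m l (radius M a 0 x)
          - ((ω : ℂ) + Complex.I * s) ^ 2 + ((V x : ℂ) - g s (V x) x)) u u₁ ∧
        (∃ x, u x ≠ 0) ∧
        Tendsto (fun x : ℝ => Complex.exp (-(Complex.I * ((ω : ℂ) + Complex.I * s) * x))
          * (u₁ x - Complex.I * ((ω : ℂ) + Complex.I * s) * u x)) atTop (𝓝 0) ∧
        Tendsto (fun x : ℝ =>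
          Complex.exp (Complex.I * ((ω : ℂ) + Complex.I * s - horizonFrequency M a m) * x)
          * (u₁ x + Complex.I * ((ω : ℂ) + Complex.I * s - horizonFrequency M a m) * u x)) atBot
          (𝓝 0) := by
  set k := ω - horizonFrequency M a m with hk
  have hk0 : k ≠ 0 := fun h => by rw [h, mul_zero] at hsup; exact lt_irrefl _ hsup
  obtain ⟨δ₁, hδ₁, hl⟩ := exists_continuous_eigenvalue a ω m l
  have : Fact ((0 : ℝ) ≤ δ₁) := ⟨hδ₁.le⟩
  set z : Icc (0 : ℝ) δ₁ → ℂ := fun t => (ω : ℂ) + Complex.I * (t : ℝ) with hz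
  have hzc : Continuous z := by fun_prop
  set t₀ : Icc (0 : ℝ) δ₁ := ⟨0, le_rfl, hδ₁.le⟩ with ht₀
  have : Nonempty (Icc (0 : ℝ) δ₁) := ⟨t₀⟩
  set E : ℝ → ℂ := fun x => U x ^ 2 with hE
  have hUc := hU.continuous
  have hEc : Continuous E := by fun_prop
  set W : ℂ × Icc (0 : ℝ) δ₁ → ℝ → ℂ := fun y x =>
    (tunedBarrier V₀ E y.1 x : ℂ) - g (y.2 : ℝ) (tunedBarrier V₀ E y.1 x) x with hW
  have hVc := hV.continuous
  have htc : Continuous fun y : (ℂ × Icc (0 : ℝ) δ₁) × ℝ => tunedBarrier V₀ E y.1.1 y.2 := by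
    unfold tunedBarrier
    have := continuous_clampHalf
    fun_prop
  have hWc : Continuous (Function.uncurry W) := by
    have h1 : Continuous fun y : (ℂ × Icc (0 : ℝ) δ₁) × ℝ =>
        (((y.1.2 : ℝ), tunedBarrier V₀ E y.1.1 y.2, y.2) : ℝ × ℝ × ℝ) := by fun_prop
    exact (Complex.continuous_ofReal.comp htc).sub (hg.continuous.comp h1)
  have hWz : ∀ y x, V₀ x = 0 → W y x = 0 := fun y x h => by
    simp [hW, tunedBarrier, h, hg1]
  have htle : ∀ p x, tunedBarrier V₀ E p x ≤ ω ^ 2 / 2 := fun p x => by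
    have := tunedBarrier_le hV0 E p x
    linarith [hV1 x]
  -- the perturbation is a continuous function on a compact set of arguments
  obtain ⟨B', hB'⟩ := (isCompact_Icc (a := (0 : ℝ)) (b := δ₁)).prod
    ((isCompact_Icc (a := (0 : ℝ)) (b := ω ^ 2 / 2)).prod
      (isCompact_Icc (a := x₀) (b := x₁))) |>.exists_bound_of_continuousOn
    (f := fun p : ℝ × ℝ × ℝ => (p.2.1 : ℂ) - g p.1 p.2.1 p.2.2)
    ((by fun_prop : Continuous fun p : ℝ × ℝ × ℝ => (p.2.1 : ℂ)).sub
      hg.continuous).continuousOn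
  obtain ⟨B₁, hB₁⟩ := isCompact_univ.exists_bound_of_continuousOn hl.continuousOn
  obtain ⟨B₂, hB₂⟩ := isCompact_univ.exists_bound_of_continuousOn hzc.continuousOn
  have hre : ∀ t, (z t).re = ω := fun t => by simp [hz]
  have him : ∀ t, (z t).im = t := fun t => by simp [hz]
  obtain ⟨D, hO, hH, hC⟩ := exists_radialFamily ha haM m l (P := ℂ × Icc (0 : ℝ) δ₁)
    (ω := fun y => z y.2) (W := W) (B := max (max B₁ B₂) (max B' 0)) (k := min |ω| |k|)
    (R := max |x₀| |x₁|)
    (hzc.comp continuous_snd) (hl.comp continuous_snd)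
    (fun y => (hB₂ y.2 (mem_univ _)).trans ((le_max_right _ _).trans (le_max_left _ _)))
    (fun y => (hB₁ y.2 (mem_univ _)).trans ((le_max_left _ _).trans (le_max_left _ _)))
    (fun y => by rw [him]; exact y.2.2.1)
    (lt_min (abs_pos.2 hω) (abs_pos.2 hk0))
    (fun y => (min_le_left _ _).trans (by rw [← hre y.2]; exact Complex.abs_re_le_norm _))
    (fun y => (min_le_right _ _).trans (by
      have : (z y.2 - horizonFrequency M a m).re = k := by
        rw [Complex.sub_re, hre, Complex.ofReal_re]
      rw [← this]; exact Complex.abs_re_le_norm _))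
    hWc
    (fun y x => by
      by_cases h : V₀ x = 0
      · rw [hWz y x h, norm_zero]
        exact (le_max_right _ _).trans (le_max_right _ _)
      · exact (hB' ((y.2 : ℝ), tunedBarrier V₀ E y.1 x, x)
          ⟨y.2.2, ⟨tunedBarrier_nonneg hV0 E _ _, htle _ _⟩, hVs x h⟩).trans
          ((le_max_left _ _).trans (le_max_right _ _)))
    (fun y x h => by
      have := hVs x fun h' => h (hWz y x h')
      exact abs_le_max_abs_abs this.1 this.2)
  have hz0 : z t₀ = ω := by simp [hz, ht₀]
  have hO0 : D.κOut (0, t₀) = ω := by rw [hO]; exact hz0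
  have hH0 : D.κHor (0, t₀) = k := by
    rw [hH]; simp only [hz0, hk]; push_cast; rfl
  have hU' : SolvesODE (D.C (0, t₀)) U U₁ := hU.congr_coeff fun x => by
    rw [hC]
    simp only [hW, hz0, tunedBarrier_zero]
    rw [show ((t₀ : Icc (0 : ℝ) δ₁) : ℝ) = 0 from rfl, hg0, Complex.ofReal_add, ofReal_realCoeff,
      sub_zero]
  have hU0 : ∃ x, U x ≠ 0 := ⟨0, fun h => hfl 0 (by simp [flux, h])⟩
  obtain ⟨α, β, hα, hβ, hhor, hout⟩ := D.exists_const_mul_of_mode hO0 hH0 hU' hU0 bt bb ht hb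
  -- for `‖p‖ ≤ ρ₀` the truncation in the barrier is inactive
  obtain ⟨S, hS⟩ := (isCompact_Icc (a := x₀) (b := x₁)).exists_bound_of_continuousOn
    hEc.continuousOn
  set ρ₀ : ℝ := 1 / (2 * (|S| + 1)) with hρ₀
  have hρ₀pos : 0 < ρ₀ := by positivity
  have hclamp : ∀ p : ℂ, ‖p‖ ≤ ρ₀ → ∀ x,
      tunedBarrier V₀ E p x = V₀ x * (1 + (conj p * E x).re) := by
    intro p hp x
    by_cases h : V₀ x = 0
    · simp [tunedBarrier, h]
    · rw [tunedBarrier, clampHalf_eq]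
      refine (Complex.abs_re_le_norm _).trans ?_
      rw [norm_mul, Complex.norm_conj]
      have h1 : ‖E x‖ ≤ |S| + 1 := (hS x (hVs x h)).trans (by linarith [le_abs_self S])
      calc ‖p‖ * ‖E x‖ ≤ ρ₀ * (|S| + 1) := by gcongr
        _ = 1 / 2 := by rw [hρ₀]; field_simp
  have hG : ∀ R ε : ℝ, 0 < ε → ∀ᶠ t : Icc (0 : ℝ) δ₁ in 𝓝 t₀, ∀ x ∈ Icc x₀ x₁, ∀ v ∈ Icc 0 R,
      ∀ v' ∈ Icc 0 R, ‖g t v x - g t v' x‖ ≤ ε * |v - v'| := fun R ε hε =>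
    (continuous_subtype_val.tendsto t₀).eventually (eventually_norm_sub_le hg hg0 x₀ x₁ R hε)
  have hev := eventually_exists_modeFunction_eq_zero D (t₀ := t₀)
    (N := fun t x => potential M a (z t) m l (radius M a 0 x) - z t ^ 2) (G := fun t => g t)
    (fun p t => by rw [hO]) (fun p t => by rw [hH]) (fun p t x => by rw [hC, add_sub_assoc])
    hG hVc hV0 hVs hVn hx hU' hfl hα hβ hhor hout hρ₀pos
  obtain ⟨δ, hδ, hball⟩ := Metric.eventually_nhds_iff.1 hev
  refine ⟨min δ δ₁, lt_min hδ hδ₁, fun s hs0 hs => ?_⟩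
  set t : Icc (0 : ℝ) δ₁ := ⟨s, hs0, (hs.trans_le (min_le_right _ _)).le⟩ with hts
  obtain ⟨p, hp, hp0⟩ := hball (y := t) (by
    rw [Subtype.dist_eq, Real.dist_eq]
    simpa [hts, ht₀, abs_of_nonneg hs0] using hs.trans_le (min_le_left _ _))
  obtain ⟨u, u₁, hu, hun, hut, hub⟩ := D.exists_mode hp0
  have hzt : z t = (ω : ℂ) + Complex.I * s := rfl
  refine ⟨tunedBarrier V₀ E p, ?_, tunedBarrier_nonneg hV0 E p, htle p, fun x h => ?_, u, u₁, ?_,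
    hun, ?_, ?_⟩
  · rw [show tunedBarrier V₀ E p = fun x => V₀ x * (1 + (conj p * E x).re) from
      funext (hclamp p hp)]
    have hUs := (hU.contDiff (Complex.ofRealCLM.contDiff.comp
      ((contDiff_realCoeff ha haM ω m l).add hV))).1
    have h1 : ContDiff ℝ ((⊤ : ℕ∞) : WithTop ℕ∞) fun x => conj p * E x :=
      contDiff_const.mul (hUs.pow 2)
    exact hV.mul (contDiff_const.add (Complex.reCLM.contDiff.comp h1))
  · exact hVs x fun h' => h (by simp [tunedBarrier, h'])
  · refine hu.congr_coeff fun x => ?_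
    rw [hC]
  · rw [hO] at hut; exact hut
  · rw [hH] at hub; exact hub

end Kerr

open Kerr Filter Topology Set

theorem mainTheorem2 (M a : ℝ) (ha : 0 < |a|) (haM : |a| < M)
    (ωR : ℝ) (hωR : ωR ≠ 0) (m l : ℤ) (hsup : Kerr.IsSuperradiant M a ωR m l) :
    ∃ C C₀ : ℝ, Kerr.rPlus M a < C ∧ 0 < C₀ ∧
      ∀ (c : ℝ) (G : ℝ → ℝ → ℝ → ℝ → ℂ),
        ContDiff ℝ ((⊤ : ℕ∞) : WithTop ℕ∞) (fun p : ℝ × ℝ × ℝ × ℝ => G p.1 p.2.1 p.2.2.1 p.2.2.2) →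
        (∀ v x : ℝ, G ωR 0 v x = 0) →
        (∀ w x : ℝ, G ωR w 0 x = 0) →
        ∀ r₀ : ℝ, C < r₀ → ∀ ε₁ : ℝ, 0 < ε₁ → ε₁ ≤ 1 →
          ∃ δ : ℝ, 0 < δ ∧ ∀ ωI : ℝ, 0 ≤ ωI → ωI < δ →
            ∃ V : ℝ → ℝ,
              ContDiffOn ℝ ((⊤ : ℕ∞) : WithTop ℕ∞) V (Set.Ioi (Kerr.rPlus M a)) ∧
              (∀ r : ℝ, Kerr.rPlus M a < r → 0 ≤ V r) ∧
              (∀ r : ℝ, Kerr.rPlus M a < r → V r ≠ 0 → r ∈ Set.Icc r₀ (r₀ + C₀)) ∧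
              (∀ r : ℝ, r₀ ≤ r →
                V r + (4 * M * r * a * m * ωR - a ^ 2 * (m : ℝ) ^ 2
                    + Kerr.Delta M a r * (Kerr.eigenvalueReal a ωR m l + a ^ 2 * ωR ^ 2))
                  / (r ^ 2 + a ^ 2) ^ 2 ≤ (1 + ε₁) * ωR ^ 2) ∧
              ∃ u : ℝ → ℂ,
                ContDiff ℝ ((⊤ : ℕ∞) : WithTop ℕ∞) u ∧ (∃ x : ℝ, u x ≠ 0) ∧
                (∀ x : ℝ,
                  deriv (deriv u) x
                    + (((ωR : ℂ) + Complex.I * ωI) ^ 2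
                        - Kerr.potential M a ((ωR : ℂ) + Complex.I * ωI) m l
                            (Kerr.radius M a c x)
                        + G ωR ωI (V (Kerr.radius M a c x)) x
                        - (V (Kerr.radius M a c x) : ℂ)) * u x = 0) ∧
                Kerr.IsOutgoing ((ωR : ℂ) + Complex.I * ωI) u ∧
                Kerr.IsRegularAtHorizon M a ((ωR : ℂ) + Complex.I * ωI) m u := by
  have hsup' : ωR * (ωR - horizonFrequency M a m) < 0 := hsup.2
  obtain ⟨X, ℓ, hℓ, hmode⟩ := exists_realMode (l := l) ha haM hωR hsup'
  set Λ := eigenvalueReal a ωR m l + a ^ 2 * ωR ^ 2 with hΛ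
  set K := 4 * |a * m| * |ωR| + |Λ| with hK
  have hω2 : 0 < ωR ^ 2 := by positivity
  -- beyond this radius barriers are available and the rest of the potential is at most `ωR² / 2`
  set C := max (max (rPlus M a + 1) (radius M a 0 X)) (2 * K / ωR ^ 2 + 1) with hC
  have hC1 : rPlus M a + 1 ≤ C := (le_max_left _ _).trans (le_max_left _ _)
  have hC2 : radius M a 0 X ≤ C := (le_max_right _ _).trans (le_max_left _ _)
  have hC3 : 2 * K / ωR ^ 2 + 1 ≤ C := le_max_right _ _
  refine ⟨C, ℓ, by linarith, hℓ, fun c G hG hG0 hG1 r₀ hr₀ ε₁ hε₁ _ => ?_⟩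
  have hr₀' : rPlus M a < r₀ := by linarith
  set x₀ := rStar M a 0 r₀ with hx₀
  have hx₀' : radius M a 0 x₀ = r₀ := radius_rStar haM 0 hr₀'
  have hX : X ≤ x₀ := (strictMono_radius haM 0).le_iff_le.1 (by rw [hx₀']; linarith)
  obtain ⟨V₀, hV, hV0, hV1, hVs, hVn, U, U₁, hU, hfl, ⟨N, bt, bb⟩, ht, hb⟩ := hmode x₀ hX
  have hg : ContDiff ℝ ((⊤ : ℕ∞) : WithTop ℕ∞)
      (fun p : ℝ × ℝ × ℝ => G ωR p.1 p.2.1 (p.2.2 + c)) :=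
    hG.comp (f := fun p : ℝ × ℝ × ℝ => ((ωR, p.1, p.2.1, p.2.2 + c) : ℝ × ℝ × ℝ × ℝ))
      (by fun_prop)
  obtain ⟨δ, hδ, hδ'⟩ := exists_mode_of_realMode ha haM hωR hsup'
    (g := fun w v x => G ωR w v (x + c)) hg (fun v x => hG0 v _) (fun w x => hG1 w _)
    (show x₀ < x₀ + ℓ by linarith) hV hV0 hV1 hVs hVn hU hfl bt bb ht hb
  refine ⟨δ, hδ, fun s hs0 hs => ?_⟩
  obtain ⟨V, hVsm, hVpos, hVle, hVsupp, u, u₁, hu, ⟨y, hy⟩, hout, hhor⟩ := hδ' s hs0 hs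
  set ω : ℂ := (ωR : ℂ) + Complex.I * s with hω
  have hVr : ∀ x, V (rStar M a 0 (radius M a c x)) = V (x - c) := fun x => by
    rw [radius_eq haM c, rStar_radius haM]
  have hq : ContDiff ℝ ((⊤ : ℕ∞) : WithTop ℕ∞) fun x => potential M a ω m l (radius M a 0 x)
      - ω ^ 2 + ((V x : ℂ) - G ωR s (V x) (x + c)) := by
    have hr := contDiff_radius ha haM 0
    have h0 := Complex.ofRealCLM.contDiff.comp ((contDiff_potentialZero (m := m) (M := M) ha).comp hr)
    have h1 := Complex.ofRealCLM.contDiff.comp ((contDiff_potentialOne (m := m) (M := M) ha).comp hr)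
    have h2 := Complex.ofRealCLM.contDiff.comp ((contDiff_potentialTwo (M := M) ha).comp hr)
    have h3 := Complex.ofRealCLM.contDiff.comp hVsm
    have h4 := hg.comp (f := fun x : ℝ => ((s, V x, x) : ℝ × ℝ × ℝ)) (by fun_prop)
    simp only [potential_eq]
    exact ((((h0.add (contDiff_const.mul h1)).add (contDiff_const.mul h2)).sub
      contDiff_const).add (h3.sub h4))
  have husm := (hu.contDiff hq).1
  have hd : deriv (fun x => u (x - c)) = fun x => u₁ (x - c) :=
    funext fun x => ((hu (x - c)).1.comp_sub_const x c).deriv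
  have hshift : ∀ {F : Filter ℝ} {κ : ℂ} {f : ℝ → ℂ}, Tendsto (fun x => x - c) F F →
      Tendsto (fun x : ℝ => Complex.exp (κ * x) * f x) F (𝓝 0) →
      Tendsto (fun x : ℝ => Complex.exp (κ * x) * f (x - c)) F (𝓝 0) := by
    intro F κ f hF h
    have := (h.comp hF).const_mul (Complex.exp (κ * c))
    rw [mul_zero] at this
    refine this.congr fun x => ?_
    rw [Function.comp_apply, ← mul_assoc, ← Complex.exp_add]
    congr 2
    push_cast; ring
  refine ⟨fun r => V (rStar M a 0 r), ?_, fun r _ => hVpos _, fun r hr h => ?_, fun r hr => ?_,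
    fun x => u (x - c), ?_, ⟨y + c, by simpa using hy⟩, fun x => ?_, ?_, ?_⟩
  · exact hVsm.comp_contDiffOn (contDiffOn_rStar haM 0)
  · obtain ⟨h1, h2⟩ := hVsupp _ h
    have e := radius_rStar haM 0 hr
    have h3 := (strictMono_radius haM 0).monotone h1
    have h4 := radius_sub_le ha haM h1
    rw [hx₀', e] at h3 h4
    exact ⟨h3, by linarith⟩
  · have hrC : C < r := hr₀.trans_le hr
    have hrp : rPlus M a < r := by linarith
    have hpos := rPlus_pos haM
    have hKpos : 0 ≤ K := by positivity
    have h1r : 1 ≤ r := by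
      have : 0 ≤ 2 * K / ωR ^ 2 := by positivity
      linarith
    have e1 := abs_potentialOne_le (m := m) ha haM hrp.le
    have e2 := abs_potentialTwo_le ha haM hrp.le
    have e : (4 * M * r * a * m * ωR - a ^ 2 * (m : ℝ) ^ 2 + Delta M a r * Λ) / (r ^ 2 + a ^ 2) ^ 2
        = ωR * potentialOne M a m r + Λ * potentialTwo M a r
          - a ^ 2 * (m : ℝ) ^ 2 / (r ^ 2 + a ^ 2) ^ 2 := by
      unfold potentialOne potentialTwo; ring
    have e3 : ωR * potentialOne M a m r ≤ |ωR| * (4 * |a * m| / r ^ 2) :=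
      (le_abs_self _).trans (by rw [abs_mul]; gcongr)
    have e4 : Λ * potentialTwo M a r ≤ |Λ| * (1 / r ^ 2) :=
      (le_abs_self _).trans (by rw [abs_mul]; gcongr)
    have e5 : 0 ≤ a ^ 2 * (m : ℝ) ^ 2 / (r ^ 2 + a ^ 2) ^ 2 := by positivity
    have e6 : |ωR| * (4 * |a * m| / r ^ 2) + |Λ| * (1 / r ^ 2) ≤ ωR ^ 2 / 2 := by
      have : |ωR| * (4 * |a * m| / r ^ 2) + |Λ| * (1 / r ^ 2) = K / r ^ 2 := by rw [hK]; ring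
      rw [this, div_le_iff₀ (by positivity)]
      have h2 : 2 * K / ωR ^ 2 ≤ r := by linarith
      rw [div_le_iff₀ hω2] at h2
      have h3 : r * ωR ^ 2 ≤ r ^ 2 * ωR ^ 2 := by
        refine mul_le_mul_of_nonneg_right ?_ hω2.le
        nlinarith
      linarith
    have e7 := hVle (rStar M a 0 r)
    have e8 : 0 ≤ ε₁ * ωR ^ 2 := by positivity
    beta_reduce
    rw [e]
    linarith
  · exact husm.comp (contDiff_id.sub contDiff_const)
  · rw [hd, ((hu (x - c)).2.comp_sub_const x c).deriv]
    beta_reduce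
    rw [hVr, radius_eq haM c, sub_add_cancel]
    ring
  · unfold IsOutgoing
    rw [hd]
    refine hshift (κ := -Complex.I * ω)
      (f := fun x => u₁ x - Complex.I * ω * u x) (tendsto_atTop_add_const_right _ _ tendsto_id) ?_
    exact hout.congr fun x => by rw [neg_mul, neg_mul]
  · have hh : (horizonFrequency M a m : ℂ) = a * m / (2 * M * rPlus M a) := by
      unfold horizonFrequency; push_cast; rfl
    unfold IsRegularAtHorizon
    rw [hd, ← hh]
    exact hshift
      (f := fun x => u₁ x + Complex.I * (ω - horizonFrequency M a m) * u x)
      (tendsto_atBot_add_const_right _ _ tendsto_id) hhor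
end
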